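/- Let $d\ge 0$ be an integer and $-1<a<1$. Write $X=(x,z)$, $Y=(y,\zeta)$ for points of $\mathbb R^{d+1}_+=\mathbb R^d\times(0,\infty)$, $d\omega_a(X)=z^a\,dx\,dz$, $L^2_a=L^2(\mathbb R^{d+1}_+,d\omega_a)$, and $\mathscr B^{(a)}_z=\partial_{zz}+\frac az\partial_z$. For $t\ne0$ put $$S_a(z,\zeta,t)=\frac{e^{-i\,\mathrm{sgn}(t)\frac{(a+1)\pi}4}}{(2|t|)^{\frac{a+1}2}}\Big(\frac{z\zeta}{2|t|}\Big)^{\frac{1-a}2}J_{\frac{a-1}2}\Big(\frac{z\zeta}{2|t|}\Big)e^{i\frac{z^2+\zeta^2}{4t}},\qquad S(x,y,t)=(4\pi it)^{-\frac d2}e^{i\frac{|x-y|^2}{4t}},$$ $$S_a(z,0,t)=\lim_{\zeta\to0^+}S_a(z,\zeta,t)=\frac{2^{-a}}{\Gamma(\frac{a+1}2)}\frac{e^{-i\,\mathrm{sgn}(t)\frac{(a+1)\pi}4}}{|t|^{\frac{a+1}2}}e^{i\frac{z^2}{4t}},\qquad \mathbb S_a(X,Y,t)=S_a(z,\zeta,t)\,S(x,y,t).$$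 Let $u_0$ and $F$ be the restrictions to $\mathbb R^{d+1}_+$ and $\mathbb R^{d+1}_+\times\mathbb R$ of Schwartz functions on $\mathbb R^{d+1}$ and $\mathbb R^{d+1}\times\mathbb R$, let $\Phi\in\mathscr S(\mathbb R^{d+1})$ (in the variables $(x,t)$), and let $J\subset\mathbb R$ be an interval containing $0$ (for instance $[0,\infty)$ or $\mathbb R$). Consider the problem $$\partial_tU-i(\Delta_x+\mathscr B^{(a)}_z)U=F,\qquad \lim_{z\to0^+}z^a\partial_zU(x,z,t)=\Phi(x,t),\qquad U(X,0)=u_0(X).$$ If $\Phi=0$, $v_0\in L^2_a$ and $f$ is an integrable $L^2_a$-valued forcing term, the mild solution with datum $v_0$ is the curve $u\in C(J,L^2_a)$, $u(t)=T(t)v_0+\int_0^tT(t-\tau)f(\tau)\,d\tau$, where $T$ is the strongly continuous group on $L^2_a$ generated by $i$ times the realization of $\Delta_x+\mathscr B^{(a)}_z$ with zero Neumann condition, i.e. the adjoint in $L^2_a$ of this operator restricted to the Schwartz functions that are even in $z$. In general, $U\in C(J,L^2_a)$ is a mild solution if for every $R>0$ and every smooth cutoff $h$ with $h=1$ on $[0,R]$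 and $h=0$ on $[2R,\infty)$, with $W(X,t)=\frac{z^{1-a}}{1-a}h(z)\Phi(x,t)$, the function $U-W$ is the mild solution of the problem with zero Neumann condition, datum $u_0-W(\cdot,0)$ and forcing term $F-(\partial_t-i(\Delta_x+\mathscr B_z^{(a)}))W$. Then the problem has one and only one mild solution $U$ on $J$, and for every $t\in J\setminus\{0\}$ and almost every $X\in\mathbb R^{d+1}_+$ it is given by $$U(X,t)=\int_{\mathbb R^{d+1}_+}\mathbb S_a(X,Y,t)u_0(Y)\,d\omega_a(Y)+\int_0^t\!\!\int_{\mathbb R^{d+1}_+}\mathbb S_a(X,Y,t-\tau)F(Y,\tau)\,d\omega_a(Y)\,d\tau-i\int_0^t\!\!\int_{\mathbb R^d}S_a(z,0,t-\tau)S(x,y,t-\tau)\Phi(y,\tau)\,dy\,d\tau,$$ that is, $U=\mathbb T_a^\star(u_0)+\mathbb D_a(F)+\Theta_a^\star(\Phi)$, where the three operators are the three terms in this order and all the iterated integrals converge absolutely. -/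

import Mathlib

open MeasureTheory Set Filter Topology
open scoped ContDiff SchwartzMap

noncomputable section

namespace HalfSpace

/-- Points `X = (x, z)` of `ℝᵈ × ℝ`; the open half-space is `{z > 0}`. -/
abbrev Pt (d : ℕ) : Type := EuclideanSpace ℝ (Fin d) × ℝ

/-- The measure `dω_a(X) = z ^ a dx dz`, carried by the half-space `z > 0`. -/
def omega (d : ℕ) (a : ℝ) : Measure (Pt d) :=
  (volume : Measure (EuclideanSpace ℝ (Fin d))).prod
    ((volume.restrict (Ioi (0 : ℝ))).withDensity fun z => ENNReal.ofReal (z ^ a))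

/-- The Hilbert space `L²_a = L²(ℝ^{d+1}_+, dω_a)`. -/
abbrev L2 (d : ℕ) (a : ℝ) : Type := Lp ℂ 2 (omega d a)

/-! ### The equation -/

/-- The Bessel operator `B_z^{(a)} f = f'' + (a / z) f'`. -/
def besselOp (a : ℝ) (f : ℝ → ℂ) (z : ℝ) : ℂ :=
  deriv (deriv f) z + ((a / z : ℝ) : ℂ) * deriv f z

/-- The operator `Δ_x + B_z^{(a)}`. -/
def halfOp {d : ℕ} (a : ℝ) (f : Pt d → ℂ) (X : Pt d) : ℂ :=
  Laplacian.laplacian (fun x : EuclideanSpace ℝ (Fin d) => f (x, X.2)) X.1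
    + besselOp a (fun z => f (X.1, z)) X.2

/-- Membership of `(v, g)` in the graph of the realization of `Δ_x + B_z^{(a)}` in `L²_a` with the
condition `lim_{z → 0+} z ^ a ∂_z v = 0`. The test functions are the restrictions to the half-space
of Schwartz functions that are even in `z`; they satisfy that condition and form a core, so that
the operator is the adjoint of its restriction to them. -/
def IsNeumannOp {d : ℕ} (a : ℝ) (v g : L2 d a) : Prop :=
  ∀ V : 𝓢(Pt d, ℂ), (∀ x z, V (x, -z) = V (x, z)) →
    ∫ X, g X * V X ∂(omega d a) = ∫ X, v X * halfOp a V X ∂(omega d a)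

/-- `T` is the strongly continuous group on `L²_a` whose infinitesimal generator is
`i (Δ_x + B_z^{(a)})` with zero Neumann condition. -/
structure IsSchrodingerGroup {d : ℕ} (a : ℝ) (T : ℝ → L2 d a →L[ℂ] L2 d a) : Prop where
  zero : T 0 = ContinuousLinearMap.id ℂ (L2 d a)
  add : ∀ s t, T (s + t) = (T s).comp (T t)
  cont : ∀ v, Continuous fun t => T t v
  generator : ∀ v g : L2 d a,
    HasDerivAt (fun t => T t v) (Complex.I • g) 0 ↔ IsNeumannOp a v g

/-- Mild solution, on the time interval `J` (containing `0`), of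
`∂_t u - i (Δ_x + B_z^{(a)}) u = f`, `u(0) = v₀`, with zero Neumann condition: a continuous curve
in `L²_a` given by the variation of constants formula of the generated group. -/
def IsMildSolutionZero {d : ℕ} (a : ℝ) (J : Set ℝ) (v₀ : L2 d a) (f u : ℝ → L2 d a) : Prop :=
  ContinuousOn u J ∧ (∀ t ∈ J, IntervalIntegrable f volume 0 t) ∧
  ∃ T : ℝ → L2 d a →L[ℂ] L2 d a, IsSchrodingerGroup a T ∧
    ∀ t ∈ J, u t = T t v₀ + ∫ τ in (0 : ℝ)..t, T (t - τ) (f τ)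

/-- `h` is a smooth cutoff, `h = 1` on `[0, R]` and `h = 0` on `[2R, ∞)`. -/
def IsCutoff (R : ℝ) (h : ℝ → ℝ) : Prop :=
  ContDiff ℝ ∞ h ∧ (∀ z ∈ Icc 0 R, h z = 1) ∧ ∀ z, 2 * R ≤ z → h z = 0

/-- The function `z ^ (1 - a) / (1 - a) * h(z) * Φ(x, t)`, whose weighted normal derivative
`lim_{z → 0+} z ^ a ∂_z` is `Φ(x, t)`. -/
def neumannLift {d : ℕ} (a : ℝ) (h : ℝ → ℝ) (Φ : 𝓢(Pt d, ℂ)) (t : ℝ) (X : Pt d) : ℂ :=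
  ((X.2 ^ (1 - a) / (1 - a) * h X.2 : ℝ) : ℂ) * Φ (X.1, t)

/-- Mild solution, on the time interval `J` (containing `0`), of
`∂_t U - i (Δ_x + B_z^{(a)}) U = F`, `lim_{z → 0+} z ^ a ∂_z U = Φ`, `U(0) = u₀`: a continuous
curve in `L²_a` such that, for every cutoff `h`, subtracting
`W(X, t) = z ^ (1 - a) / (1 - a) * h(z) * Φ(x, t)` gives the mild solution of the problem with zero
Neumann condition, datum `u₀ - W(·, 0)` and forcing term `F - (∂_t - i (Δ_x + B_z^{(a)})) W`. -/
def IsMildSolution {d : ℕ} (a : ℝ) (J : Set ℝ) (u₀ : 𝓢(Pt d, ℂ)) (F : 𝓢(Pt d × ℝ, ℂ))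
    (Φ : 𝓢(Pt d, ℂ)) (U : ℝ → L2 d a) : Prop :=
  ContinuousOn U J ∧
  ∀ R : ℝ, 0 < R → ∀ h : ℝ → ℝ, IsCutoff R h →
    ∃ (v₀ : L2 d a) (f u : ℝ → L2 d a),
      (v₀ =ᵐ[omega d a] fun X => u₀ X - neumannLift a h Φ 0 X) ∧
      (∀ t ∈ J, f t =ᵐ[omega d a] fun X =>
        F (X, t) - (deriv (fun s => neumannLift a h Φ s X) t
          - Complex.I * halfOp a (neumannLift a h Φ t) X)) ∧
      (∀ t ∈ J, u t =ᵐ[omega d a] fun X => U t X - neumannLift a h Φ t X) ∧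
      IsMildSolutionZero a J v₀ f u

/-! ### The kernels -/

/-- The Bessel function of the first kind `J_ν(x)`, for `x > 0`. -/
def besselJ (ν x : ℝ) : ℝ :=
  ∑' k : ℕ, (-1) ^ k / ((k.factorial : ℝ) * Real.Gamma (k + ν + 1)) * (x / 2) ^ (2 * (k : ℝ) + ν)

/-- The kernel `S_a(z, ζ, t)` on the half-line, for `z, ζ > 0` and `t ≠ 0`. -/
def kerZ (a z ζ t : ℝ) : ℂ :=
  Complex.exp (-Complex.I * ((Real.sign t * (a + 1) * Real.pi / 4 : ℝ) : ℂ))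
    / (((2 * |t|) ^ ((a + 1) / 2) : ℝ) : ℂ)
    * (((z * ζ / (2 * |t|)) ^ ((1 - a) / 2) * besselJ ((a - 1) / 2) (z * ζ / (2 * |t|)) : ℝ) : ℂ)
    * Complex.exp (Complex.I * (((z ^ 2 + ζ ^ 2) / (4 * t) : ℝ) : ℂ))

/-- The boundary kernel `S_a(z, 0, t) = lim_{ζ → 0+} S_a(z, ζ, t)`, for `t ≠ 0`. -/
def kerZ0 (a z t : ℝ) : ℂ :=
  (((2 : ℝ) ^ (-a) / Real.Gamma ((a + 1) / 2) : ℝ) : ℂ)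
    * (Complex.exp (-Complex.I * ((Real.sign t * (a + 1) * Real.pi / 4 : ℝ) : ℂ))
      / ((|t| ^ ((a + 1) / 2) : ℝ) : ℂ))
    * Complex.exp (Complex.I * ((z ^ 2 / (4 * t) : ℝ) : ℂ))

/-- The Schrödinger kernel `S(x, y, t) = (4πit)^{-d/2} exp(i|x-y|²/(4t))` of `ℝᵈ`, for `t ≠ 0`. -/
def kerX {d : ℕ} (x y : EuclideanSpace ℝ (Fin d)) (t : ℝ) : ℂ :=
  (4 * Real.pi * Complex.I * t : ℂ) ^ (-(d / 2 : ℂ))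
    * Complex.exp (Complex.I * ((‖x - y‖ ^ 2 / (4 * t) : ℝ) : ℂ))

/-- The kernel `𝕊_a(X, Y, t) = S_a(z, ζ, t) S(x, y, t)`. -/
def ker {d : ℕ} (a : ℝ) (X Y : Pt d) (t : ℝ) : ℂ :=
  kerZ a X.2 Y.2 t * kerX X.1 Y.1 t

/-- The boundary kernel `S_a(z, 0, t) S(x, y, t)`. -/
def kerBdry {d : ℕ} (a : ℝ) (X : Pt d) (y : EuclideanSpace ℝ (Fin d)) (t : ℝ) : ℂ :=
  kerZ0 a X.2 t * kerX X.1 y t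

/-! ### The three operators of the representation formula -/

/-- `T_a^*(u₀)(X, t)`. -/
def Tstar {d : ℕ} (a : ℝ) (u₀ : 𝓢(Pt d, ℂ)) (X : Pt d) (t : ℝ) : ℂ :=
  ∫ Y, ker a X Y t * u₀ Y ∂(omega d a)

/-- `D_a(F)(X, t)`. -/
def Da {d : ℕ} (a : ℝ) (F : 𝓢(Pt d × ℝ, ℂ)) (X : Pt d) (t : ℝ) : ℂ :=
  ∫ τ in (0 : ℝ)..t, ∫ Y, ker a X Y (t - τ) * F (Y, τ) ∂(omega d a)

/-- `Θ_a^*(Φ)(X, t)`. The factor is `-i`: it is the sign that belongs to the Neumann condition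
`lim_{z → 0+} z ^ a ∂_z U = + Φ`. -/
def ThetaStar {d : ℕ} (a : ℝ) (Φ : 𝓢(Pt d, ℂ)) (X : Pt d) (t : ℝ) : ℂ :=
  -Complex.I * ∫ τ in (0 : ℝ)..t, ∫ y, kerBdry a X y (t - τ) * Φ (y, τ)

/-- All the (iterated) integrals in the representation formula converge absolutely
at `(X, t)`. -/
def DuhamelConverges {d : ℕ} (a : ℝ) (u₀ : 𝓢(Pt d, ℂ)) (F : 𝓢(Pt d × ℝ, ℂ))
    (Φ : 𝓢(Pt d, ℂ)) (X : Pt d) (t : ℝ) : Prop :=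
  Integrable (fun Y => ker a X Y t * u₀ Y) (omega d a) ∧
  (∀ τ, τ ≠ t → Integrable (fun Y => ker a X Y (t - τ) * F (Y, τ)) (omega d a)) ∧
  IntervalIntegrable (fun τ => ∫ Y, ker a X Y (t - τ) * F (Y, τ) ∂(omega d a)) volume 0 t ∧
  (∀ τ, τ ≠ t → Integrable fun y => kerBdry a X y (t - τ) * Φ (y, τ)) ∧
  IntervalIntegrable (fun τ => ∫ y, kerBdry a X y (t - τ) * Φ (y, τ)) volume 0 t

end HalfSpace

end

/-!
Everything is tested against Gaussians `gauss a q b`, of complex width `q` with `0 < re q` and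
centred at `(b, 0)` with a complex vector `b`. The Schrödinger flow acts on them by moving the
width, `q ↦ q + 4it`, with the centre fixed (`hasDerivAt_gauss_shift`).

*The group.* The integral of a product of two Gaussians depends on the widths only through their
sum (`integral_gauss_mul`). Complex conjugation turns `q + 4it` into `q̄ - 4it`, so the flow
preserves the inner products between Gaussians. A function is determined by its integrals against
them (`ae_eq_zero_of_forall_gauss`), because after the change of variables `X ↦ (x, |X|²)` these
integrals contain a characteristic function. So the Gaussians are total in `L²_a`, and the flow
extends to a unitary group `evol`. Gaussians are even Schwartz functions; Green's formula
(`green_half_space`) makes the Neumann operator symmetric on such functions, and testing against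
Gaussians shows that the generator of `evol` is `i` times the adjoint (`isSchrodingerGroup_evol`).
A group with this generator is unique (`IsSchrodingerGroup.eq_evol`).

*The kernel.* `ker` is the heat kernel `heatKer` at imaginary time. Weber's exponential integral,
obtained by integrating the Bessel series term by term, shows that it maps Gaussians to Gaussians
(`integral_heatKer_mul_gauss`). A monotone energy for the Bessel equation gives it polynomial
growth (`exists_abs_bes_le`), so that Fubini's theorem applies, and `evol` is the integral
operator on rapidly decreasing functions (`IsRapid.evol_eq_heatInt`).

*The boundary term.* The integral of `Φ` against the boundary kernel is an explicit multiple of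
the evolution of the tensor product of `Φ` with a Gaussian in `z` (`bdryInt_mul_gaussZ`). Tested
against a Gaussian it is therefore bounded by a multiple of `|t - τ| ^ (-(a + 1) / 2)`
(`exists_integral_norm_bdryInt_le`), which is integrable in time as `a < 1`.

*The mild solution.* Fix a cutoff, and let `U - W` be given by the variation of constants formula.
Integrating the lift `W` along the backward flow of a Gaussian, Green's formula
(`integral_liftOp_mul`) contributes the Neumann datum as a boundary term, and the integral of `U`
against a Gaussian becomes an expression in `u₀`, `F` and `Φ` in which the cutoff does not occur
(`pair_sol`). Hence the same `U` is the mild solution for every cutoff, which gives existence, and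
the right-hand side of the representation formula has the same integrals against Gaussians, so it
equals `U` almost everywhere (`sol_eq_represent`). Uniqueness holds because one cutoff determines
`U - W`.
-/

noncomputable section

namespace HalfSpace

/-! ### The weighted half-line -/

/-- The measure `z ^ a dz` on the half-line `z > 0`, the second factor of `omega`. -/
def nu (a : ℝ) : Measure ℝ :=
  (volume.restrict (Ioi (0 : ℝ))).withDensity fun z => ENNReal.ofReal (z ^ a)

lemma omega_eq_prod (d : ℕ) (a : ℝ) :
    omega d a = (volume : Measure (EuclideanSpace ℝ (Fin d))).prod (nu a) := rfl

instance (a : ℝ) : SFinite (nu a) := by unfold nu; infer_instance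

instance (d : ℕ) (a : ℝ) : SFinite (omega d a) := by rw [omega_eq_prod]; infer_instance

lemma measurable_density (a : ℝ) : Measurable fun z : ℝ => ENNReal.ofReal (z ^ a) := by fun_prop

lemma ae_nu_pos (a : ℝ) : ∀ᵐ z ∂(nu a), 0 < z :=
  (withDensity_absolutelyContinuous _ _).ae_le (ae_restrict_mem measurableSet_Ioi)

lemma ae_omega_pos (d : ℕ) (a : ℝ) : ∀ᵐ X ∂(omega d a), 0 < X.2 := by
  rw [omega_eq_prod]
  exact Measure.quasiMeasurePreserving_snd.ae (ae_nu_pos a)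

lemma integrable_nu_iff {E : Type*} [NormedAddCommGroup E] [NormedSpace ℝ E] {a : ℝ} {f : ℝ → E} :
    Integrable f (nu a) ↔ IntegrableOn (fun z => z ^ a • f z) (Ioi 0) := by
  rw [nu, integrable_withDensity_iff_integrable_smul₀' (measurable_density a).aemeasurable
    (ae_of_all _ fun _ => ENNReal.ofReal_lt_top)]
  refine integrable_congr ?_
  filter_upwards [ae_restrict_mem measurableSet_Ioi] with z hz
  rw [ENNReal.toReal_ofReal (Real.rpow_nonneg (le_of_lt hz) _)]

lemma integral_nu {E : Type*} [NormedAddCommGroup E] [NormedSpace ℝ E] {a : ℝ} (f : ℝ → E) :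
    ∫ z, f z ∂(nu a) = ∫ z in Ioi 0, z ^ a • f z := by
  rw [nu, integral_withDensity_eq_integral_toReal_smul₀ (measurable_density a).aemeasurable
    (ae_of_all _ fun _ => ENNReal.ofReal_lt_top)]
  refine integral_congr_ae ?_
  filter_upwards [ae_restrict_mem measurableSet_Ioi] with z hz
  rw [ENNReal.toReal_ofReal (Real.rpow_nonneg (le_of_lt hz) _)]

/-! ### Complex powers in the half-plane and Gamma integrals -/

lemma mul_cpow_of_re_pos {x y : ℂ} (hx : 0 < x.re) (hy : 0 ≤ y.re) (hy0 : y ≠ 0) (c : ℂ) :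
    (x * y) ^ c = x ^ c * y ^ c := by
  have hx0 : x ≠ 0 := by rintro rfl; simp at hx
  have h1 := Complex.abs_arg_lt_pi_div_two_iff.mpr (Or.inl hx)
  have h2 := Complex.abs_arg_le_pi_div_two_iff.mpr hy
  rw [abs_lt] at h1
  rw [abs_le] at h2
  rw [Complex.cpow_def_of_ne_zero (mul_ne_zero hx0 hy0), Complex.cpow_def_of_ne_zero hx0,
    Complex.cpow_def_of_ne_zero hy0, ← Complex.exp_add, ← add_mul,
    Complex.log_mul hx0 hy0 ⟨by linarith [h1.1, h2.1], by linarith [h1.2, h2.2]⟩]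

lemma re_inv_nonneg {q : ℂ} (hq : 0 ≤ q.re) : 0 ≤ (q⁻¹).re := by
  rw [Complex.inv_re]; exact div_nonneg hq (Complex.normSq_nonneg q)

lemma re_inv_pos {q : ℂ} (hq : 0 < q.re) : 0 < (q⁻¹).re := by
  rw [Complex.inv_re]
  exact div_pos hq (Complex.normSq_pos.mpr (by rintro rfl; simp at hq))

/-- The branch of the power is the principal one throughout, because each factor has its argument
in `[-π/2, π/2]` and every product formed has one factor in the open right half-plane. -/
lemma cpow_mul_cpow_mul_inv_add_inv {q₀ q : ℂ} (h₀ : 0 ≤ q₀.re) (h₀' : q₀ ≠ 0) (hq : 0 < q.re)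
    (c : ℂ) : q₀ ^ c * q ^ c * (q₀⁻¹ + q⁻¹) ^ c = (q₀ + q) ^ c := by
  have hq0 : q ≠ 0 := by rintro rfl; simp at hq
  have h1 : (q₀⁻¹ + q⁻¹) * q = (q₀ + q) * q₀⁻¹ := by field_simp; ring
  have hP : 0 < (q₀⁻¹ + q⁻¹).re := by
    rw [Complex.add_re]; linarith [re_inv_nonneg h₀, re_inv_pos hq]
  have h2 := mul_cpow_of_re_pos hP hq.le hq0 c
  have hs : 0 < (q₀ + q).re := by rw [Complex.add_re]; linarith
  rw [h1, mul_cpow_of_re_pos hs (re_inv_nonneg h₀) (inv_ne_zero h₀') c] at h2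
  have harg : q₀.arg ≠ Real.pi := by
    have := Complex.abs_arg_le_pi_div_two_iff.mpr h₀
    rw [abs_le] at this
    have := Real.pi_pos
    intro h
    linarith
  rw [Complex.inv_cpow _ _ harg] at h2
  have h3 : q₀ ^ c ≠ 0 := by simp [Complex.cpow_eq_zero_iff, h₀']
  calc q₀ ^ c * q ^ c * (q₀⁻¹ + q⁻¹) ^ c = q₀ ^ c * ((q₀⁻¹ + q⁻¹) ^ c * q ^ c) := by ring
    _ = (q₀ + q) ^ c := by rw [← h2]; field_simp

lemma integrable_exp_neg_sq_nu {b r : ℝ} (hb : -1 < b) (hr : 0 < r) :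
    Integrable (fun z => Real.exp (-r * z ^ 2)) (nu b) := by
  rw [integrable_nu_iff]
  exact integrableOn_rpow_mul_exp_neg_mul_sq hr hb

/-- The Gamma integral `∫ z ^ b e ^ {-P z²} dz`, for complex `P` by analytic continuation. -/
lemma integral_cexp_neg_sq_nu {b : ℝ} (hb : -1 < b) {P : ℂ} (hP : 0 < P.re) :
    ∫ z : ℝ, Complex.exp (-P * (z : ℂ) ^ 2) ∂(nu b)
      = (Real.Gamma ((b + 1) / 2) / 2 : ℝ) * P ^ (-(((b + 1) / 2 : ℝ) : ℂ)) := by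
  let X : ℝ → ℝ := fun z => -z ^ 2
  have hset : ∀ r : ℝ, 0 < r → r ∈ interior (ProbabilityTheory.integrableExpSet X (nu b)) := by
    intro r hr
    rw [mem_interior]
    refine ⟨Ioi 0, fun t ht => ?_, isOpen_Ioi, hr⟩
    simpa [ProbabilityTheory.integrableExpSet, X] using integrable_exp_neg_sq_nu hb ht
  have hX : (fun P : ℂ => ∫ z : ℝ, Complex.exp (-P * (z : ℂ) ^ 2) ∂(nu b))
      = ProbabilityTheory.complexMGF X (nu b) := by
    ext P
    simp [ProbabilityTheory.complexMGF, X]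
  have hA : AnalyticOnNhd ℂ (fun P => ∫ z : ℝ, Complex.exp (-P * (z : ℂ) ^ 2) ∂(nu b))
      {P | 0 < P.re} := fun P hP => by
    rw [hX]; exact ProbabilityTheory.analyticAt_complexMGF (hset _ hP)
  have hB : AnalyticOnNhd ℂ (fun P : ℂ => (Real.Gamma ((b + 1) / 2) / 2 : ℝ)
      * P ^ (-(((b + 1) / 2 : ℝ) : ℂ))) {P | 0 < P.re} := fun P hP =>
    analyticAt_const.mul (analyticAt_id.cpow analyticAt_const (Or.inl hP))
  have hreal : ∀ r : ℝ, 0 < r → ∫ z : ℝ, Complex.exp (-(r : ℂ) * (z : ℂ) ^ 2) ∂(nu b)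
      = (Real.Gamma ((b + 1) / 2) / 2 : ℝ) * (r : ℂ) ^ (-(((b + 1) / 2 : ℝ) : ℂ)) := by
    intro r hr
    have h1 := integral_rpow_mul_exp_neg_mul_rpow (p := 2) (q := b) two_pos hb hr
    rw [integral_nu]
    have h2 : ∀ z : ℝ, z ^ b • Complex.exp (-(r : ℂ) * (z : ℂ) ^ 2)
        = ((z ^ b * Real.exp (-r * z ^ (2 : ℝ)) : ℝ) : ℂ) := by
      intro z
      rw [Complex.real_smul, Real.rpow_two]
      push_cast
      ring_nf
    simp_rw [h2]
    rw [integral_complex_ofReal, h1, ← Complex.ofReal_neg, ← Complex.ofReal_cpow hr.le]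
    rw [← Complex.ofReal_mul, neg_div]
    congr 1
    ring
  have hconv : IsPreconnected {P : ℂ | 0 < P.re} := (convex_halfSpace_re_gt 0).isPreconnected
  refine hA.eqOn_of_preconnected_of_frequently_eq hB hconv (z₀ := 1) (by simp) ?_ hP
  have hseq : Tendsto (fun n : ℕ => ((1 + 1 / ((n : ℝ) + 1) : ℝ) : ℂ)) atTop (𝓝[≠] 1) := by
    refine tendsto_nhdsWithin_iff.mpr ⟨?_, .of_forall fun n => ?_⟩
    · have h := tendsto_one_div_add_atTop_nhds_zero_nat (𝕜 := ℝ)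
      have h' := (Complex.continuous_ofReal.tendsto _).comp (h.const_add 1)
      simpa [Function.comp_def] using h'
    · have : (0 : ℝ) < 1 / ((n : ℝ) + 1) := by positivity
      simp only [mem_compl_iff, mem_singleton_iff]
      rw [← Complex.ofReal_one, Complex.ofReal_inj]
      linarith
  exact hseq.frequently (Frequently.of_forall fun n => hreal _ (by positivity))

lemma integral_pow_mul_cexp_neg_sq_nu {a : ℝ} (ha : -1 < a) (k : ℕ) {P : ℂ} (hP : 0 < P.re) :
    ∫ z : ℝ, (z : ℂ) ^ (2 * k) * Complex.exp (-P * (z : ℂ) ^ 2) ∂(nu a)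
      = (Real.Gamma (k + (a + 1) / 2) / 2 : ℝ) * P ^ (-((k + (a + 1) / 2 : ℝ) : ℂ)) := by
  have hk : -1 < a + 2 * k := by linarith [(Nat.cast_nonneg k : (0 : ℝ) ≤ k)]
  have h := integral_cexp_neg_sq_nu hk hP
  rw [show (a + 2 * k + 1) / 2 = k + (a + 1) / 2 by ring] at h
  rw [← h, integral_nu, integral_nu]
  refine setIntegral_congr_fun measurableSet_Ioi fun z hz => ?_
  simp only [Complex.real_smul]
  rw [Real.rpow_add hz, ← mul_assoc, show (2 : ℝ) * k = ((2 * k : ℕ) : ℝ) by push_cast; ring,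
    Real.rpow_natCast]
  push_cast
  ring

lemma integrable_pow_mul_exp_neg_sq_nu {a : ℝ} (ha : -1 < a) (k : ℕ) {r : ℝ} (hr : 0 < r) :
    Integrable (fun z => z ^ (2 * k) * Real.exp (-r * z ^ 2)) (nu a) := by
  have hk : -1 < a + 2 * k := by linarith [(Nat.cast_nonneg k : (0 : ℝ) ≤ k)]
  have h := integrable_exp_neg_sq_nu hk hr
  rw [integrable_nu_iff] at h ⊢
  refine h.congr_fun (fun z hz => ?_) measurableSet_Ioi
  simp only [smul_eq_mul]
  rw [Real.rpow_add hz, show (2 : ℝ) * k = ((2 * k : ℕ) : ℝ) by push_cast; ring,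
    Real.rpow_natCast]
  ring

lemma integral_pow_mul_exp_neg_sq_nu {a : ℝ} (ha : -1 < a) (k : ℕ) {r : ℝ} (hr : 0 < r) :
    ∫ z : ℝ, z ^ (2 * k) * Real.exp (-r * z ^ 2) ∂(nu a)
      = Real.Gamma (k + (a + 1) / 2) / 2 * r ^ (-(k + (a + 1) / 2)) := by
  have h := integral_pow_mul_cexp_neg_sq_nu ha k (P := r) (by simpa using hr)
  rw [← Complex.ofReal_neg (k + (a + 1) / 2), ← Complex.ofReal_cpow hr.le,
    ← Complex.ofReal_mul] at h
  rw [← Complex.ofReal_inj, ← h, ← integral_complex_ofReal]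
  push_cast
  rfl

/-! ### The entire Bessel function -/

/-- `∑ (-v) ^ k / (k! Γ(k + s))`, so that `J_ν(x) = (x / 2) ^ ν * bes (ν + 1) (x ^ 2 / 4)`. -/
def bes (s v : ℝ) : ℝ := ∑' k : ℕ, (-v) ^ k / ((k.factorial : ℝ) * Real.Gamma (k + s))

lemma exists_inv_Gamma_le {s : ℝ} (hs : 0 < s) :
    ∃ C, 0 < C ∧ ∀ k : ℕ, (Real.Gamma (k + s))⁻¹ ≤ C := by
  refine ⟨(Real.Gamma s)⁻¹ + (Real.Gamma (1 + s))⁻¹, ?_, fun k => ?_⟩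
  · have := Real.Gamma_pos_of_pos hs
    have := Real.Gamma_pos_of_pos (show 0 < 1 + s by linarith)
    positivity
  have h0 := Real.Gamma_pos_of_pos hs
  have h1 := Real.Gamma_pos_of_pos (show 0 < 1 + s by linarith)
  have key : ∀ k : ℕ, Real.Gamma (1 + s) ≤ Real.Gamma ((k + 1 : ℕ) + s) := by
    intro k
    induction k with
    | zero => simp
    | succ k ih =>
      refine ih.trans ?_
      have hp : (0 : ℝ) < (k + 1 : ℕ) + s := by positivity
      have e : ((k + 1 + 1 : ℕ) : ℝ) + s = ((k + 1 : ℕ) + s) + 1 := by push_cast; ring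
      rw [e, Real.Gamma_add_one hp.ne']
      have := Real.Gamma_pos_of_pos hp
      have h1 : (1 : ℝ) ≤ (k + 1 : ℕ) + s := by
        push_cast; linarith [(Nat.cast_nonneg k : (0 : ℝ) ≤ k)]
      nlinarith
  rcases k with _ | k
  · simp only [Nat.cast_zero, zero_add]
    linarith [inv_pos.mpr h1]
  · have := inv_anti₀ h1 (key k)
    linarith [inv_pos.mpr h0]

lemma summable_bes {s : ℝ} (hs : 0 < s) (v : ℝ) :
    Summable fun k : ℕ => v ^ k / ((k.factorial : ℝ) * Real.Gamma (k + s)) := by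
  obtain ⟨C, hC, h⟩ := exists_inv_Gamma_le hs
  refine Summable.of_norm_bounded (g := fun k : ℕ => C * (|v| ^ k / (k.factorial : ℝ)))
    ((Real.summable_pow_div_factorial |v|).mul_left C) fun k => ?_
  have hG := Real.Gamma_pos_of_pos (show (0 : ℝ) < k + s by positivity)
  rw [Real.norm_eq_abs, abs_div, abs_pow, abs_of_pos (a := _ * _) (by positivity),
    div_mul_eq_div_div,
    div_eq_mul_inv _ (Real.Gamma _), mul_comm]
  gcongr
  exact h k

lemma hasDerivAt_bes {s : ℝ} (hs : 0 < s) (v : ℝ) : HasDerivAt (bes s) (-bes (s + 1) v) v := by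
  obtain ⟨C, hC, h⟩ := exists_inv_Gamma_le hs
  let g : ℕ → ℝ → ℝ := fun k v => (-v) ^ k / ((k.factorial : ℝ) * Real.Gamma (k + s))
  let g' : ℕ → ℝ → ℝ := fun k v => -(k * (-v) ^ (k - 1) / ((k.factorial : ℝ) * Real.Gamma (k + s)))
  have hR : 0 < |v| + 1 := by positivity
  have hu : Summable fun k : ℕ => C * (k * (|v| + 1) ^ (k - 1) / (k.factorial : ℝ)) := by
    refine Summable.mul_left C ?_
    rw [← summable_nat_add_iff 1]
    refine (Real.summable_pow_div_factorial (|v| + 1)).congr fun k => ?_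
    rw [Nat.factorial_succ]
    push_cast
    have : (k.factorial : ℝ) ≠ 0 := by positivity
    have : (k : ℝ) + 1 ≠ 0 := by positivity
    field_simp
  have hg' : ∀ k, ∀ y ∈ Metric.ball (0 : ℝ) (|v| + 1), ‖g' k y‖
      ≤ C * (k * (|v| + 1) ^ (k - 1) / (k.factorial : ℝ)) := by
    intro k y hy
    have hy' : |y| ≤ |v| + 1 := by simpa using (mem_ball_zero_iff.mp hy).le
    have hG := Real.Gamma_pos_of_pos (show (0 : ℝ) < k + s by positivity)
    have hGC := h k
    simp only [g', Real.norm_eq_abs, abs_neg, abs_div, abs_mul, abs_pow, Nat.abs_cast,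
      abs_of_pos hG]
    rw [div_mul_eq_div_div, div_eq_mul_inv _ (Real.Gamma _), mul_comm]
    gcongr
  have hd := hasDerivAt_tsum_of_isPreconnected (g := g) (g' := g') (t := Metric.ball 0 (|v| + 1))
    (y₀ := v) (y := v) hu Metric.isOpen_ball (convex_ball _ _).isPreconnected ?_ hg'
    (by simp) ?_ (by simp)
  · convert! hd using 1
    rw [(Summable.tsum_eq_zero_add (f := fun k => g' k v) ?_)]
    · simp only [g', bes, CharP.cast_eq_zero, zero_mul, zero_div, neg_zero, zero_add]
      rw [← tsum_neg]
      congr 1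
      ext k
      rw [Nat.factorial_succ]
      push_cast
      have : (k.factorial : ℝ) ≠ 0 := by positivity
      have : (k : ℝ) + 1 ≠ 0 := by positivity
      rw [show (k : ℝ) + (s + 1) = k + 1 + s by ring]
      field_simp
    · exact Summable.of_norm_bounded hu fun k => hg' k v (by simp)
  · intro k y hy
    have h1 := ((hasDerivAt_id y).neg.pow k).div_const ((k.factorial : ℝ) * Real.Gamma (k + s))
    convert! h1 using 1
    simp only [g', Pi.neg_apply, id]
    ring
  · have := summable_bes hs (-v)
    exact this

lemma bes_recurrence {s : ℝ} (hs : 0 < s) (v : ℝ) :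
    bes s v = s * bes (s + 1) v - v * bes (s + 2) v := by
  have h1 : ∀ k : ℕ, (-v) ^ k / ((k.factorial : ℝ) * Real.Gamma (k + s))
      = s * ((-v) ^ k / ((k.factorial : ℝ) * Real.Gamma (k + (s + 1))))
        + k * ((-v) ^ k / ((k.factorial : ℝ) * Real.Gamma (k + (s + 1)))) := by
    intro k
    have hp : (0 : ℝ) < k + s := by positivity
    have := Real.Gamma_pos_of_pos hp
    rw [← add_assoc, Real.Gamma_add_one hp.ne']
    field_simp
    ring
  have hs1 := summable_bes (show 0 < s + 1 by linarith) (-v)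
  have hs2 := summable_bes (show 0 < s + 2 by linarith) (-v)
  have h2 : ∀ k : ℕ, ((k + 1 : ℕ) : ℝ) * ((-v) ^ (k + 1)
      / (((k + 1).factorial : ℝ) * Real.Gamma ((k + 1 : ℕ) + (s + 1))))
      = -v * ((-v) ^ k / ((k.factorial : ℝ) * Real.Gamma (k + (s + 2)))) := by
    intro k
    rw [Nat.factorial_succ]
    push_cast
    have : (k.factorial : ℝ) ≠ 0 := by positivity
    have : (k : ℝ) + 1 ≠ 0 := by positivity
    rw [show (k : ℝ) + (s + 2) = k + 1 + (s + 1) by ring, pow_succ]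
    field_simp
  have hs3 : Summable fun k : ℕ =>
      (k : ℝ) * ((-v) ^ k / ((k.factorial : ℝ) * Real.Gamma (k + (s + 1)))) := by
    rw [← summable_nat_add_iff 1]
    simp_rw [h2]
    exact hs2.mul_left _
  rw [bes]
  simp_rw [h1]
  rw [(hs1.mul_left s).tsum_add hs3, tsum_mul_left, hs3.tsum_eq_zero_add]
  simp_rw [h2]
  rw [tsum_mul_left]
  simp only [bes, CharP.cast_eq_zero, zero_mul, zero_add]
  ring

lemma continuous_bes {s : ℝ} (hs : 0 < s) : Continuous (bes s) :=
  continuous_iff_continuousAt.mpr fun v => (hasDerivAt_bes hs v).continuousAt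

/-- Polynomial growth on the half-line. With `f = bes s`, which solves `v f'' + s f' + f = 0`, the
function `(f ^ 2 + v f' ^ 2) / v` is nonincreasing on `v > 0`. -/
lemma exists_abs_bes_le {s : ℝ} (hs : 0 < s) :
    ∃ C, 0 < C ∧ ∀ v, 0 ≤ v → |bes s v| ≤ C * (1 + v) := by
  let f := bes s
  let g := bes (s + 1)
  let D : ℝ → ℝ := fun v => (f v ^ 2 + v * g v ^ 2) / v
  have hD : ∀ v, 0 < v → HasDerivAt D (-(f v ^ 2 + 2 * s * v * g v ^ 2) / v ^ 2) v := by
    intro v hv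
    have hf := hasDerivAt_bes hs v
    have hg := hasDerivAt_bes (show 0 < s + 1 by linarith) v
    have hr := bes_recurrence hs v
    have h := ((hf.pow 2).add ((hasDerivAt_id v).mul (hg.pow 2))).div (hasDerivAt_id v) hv.ne'
    convert! h using 1
    simp only [id, f, g, Pi.add_apply, Pi.pow_apply, Pi.mul_apply]
    rw [show s + 1 + 1 = s + 2 by ring, hr]
    field_simp
    ring
  have hanti : AntitoneOn D (Ici 1) := by
    refine antitoneOn_of_deriv_nonpos (convex_Ici 1)
      (fun v hv => (hD v (lt_of_lt_of_le one_pos hv)).continuousAt.continuousWithinAt) ?_ ?_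
    · intro v hv
      rw [interior_Ici] at hv
      exact (hD v (lt_trans one_pos hv)).differentiableAt.differentiableWithinAt
    · intro v hv
      rw [interior_Ici] at hv
      have hv0 : 0 < v := lt_trans one_pos hv
      rw [(hD v hv0).deriv, neg_div]
      have : 0 ≤ (f v ^ 2 + 2 * s * v * g v ^ 2) / v ^ 2 := by positivity
      linarith
  obtain ⟨M, hM⟩ := isCompact_Icc.exists_bound_of_continuousOn
    (s := Icc (0 : ℝ) 1) (continuous_bes hs).continuousOn
  have hM0 : 0 ≤ M := (norm_nonneg _).trans (hM 0 (by simp))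
  refine ⟨M + D 1 + 1, ?_, fun v hv => ?_⟩
  · have : 0 ≤ D 1 := by positivity
    positivity
  have hD1 : 0 ≤ D 1 := by positivity
  rcases le_total v 1 with h | h
  · have h1 := hM v ⟨hv, h⟩
    rw [Real.norm_eq_abs] at h1
    nlinarith
  · have h1 : D v ≤ D 1 := hanti (by simp) h h
    have hv0 : 0 < v := lt_of_lt_of_le one_pos h
    have h2 : f v ^ 2 + v * g v ^ 2 ≤ D 1 * v := (div_le_iff₀ hv0).mp h1
    have h3 : f v ^ 2 ≤ D 1 * v := by nlinarith [mul_nonneg hv (sq_nonneg (g v))]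
    refine abs_le_of_sq_le_sq (h3.trans ?_) (by positivity)
    have h4 : 0 ≤ D 1 * M := by positivity
    calc D 1 * v ≤ (D 1 + 1) ^ 2 * (1 + v) ^ 2 := by
          have : v ≤ (1 + v) ^ 2 := by nlinarith
          have : D 1 ≤ (D 1 + 1) ^ 2 := by nlinarith
          gcongr
      _ = ((D 1 + 1) * (1 + v)) ^ 2 := by ring
      _ ≤ _ := by gcongr; linarith

lemma bes_zero (s : ℝ) : bes s 0 = (Real.Gamma s)⁻¹ := by
  rw [bes, tsum_eq_single 0]
  · simp
  · intro k hk
    simp [hk]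

/-! ### Gaussians -/

/-- The normal factor `q ^ {-(a+1)/2} e ^ {-z² / q}` of a Gaussian. -/
def gaussZ (a : ℝ) (q : ℂ) (z : ℝ) : ℂ :=
  q ^ (-(((a + 1) / 2 : ℝ) : ℂ)) * Complex.exp (-(z : ℂ) ^ 2 / q)

/-- The tangential factor `q ^ {-d/2} e ^ {-(x-b)² / q}` of a Gaussian. The centre `b` may be
complex, so that the factor `e ^ {i ξ · x}` is allowed. -/
def gaussX {d : ℕ} (q : ℂ) (b : Fin d → ℂ) (x : EuclideanSpace ℝ (Fin d)) : ℂ :=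
  q ^ (-((d / 2 : ℝ) : ℂ)) * Complex.exp (-(∑ i, ((x i : ℂ) - b i) ^ 2) / q)

/-- The Gaussian of complex width `q` and centre `(b, 0)`. The normalization makes it a solution of
the heat equation in `q / 4`. -/
def gauss {d : ℕ} (a : ℝ) (q : ℂ) (b : Fin d → ℂ) (X : Pt d) : ℂ :=
  gaussX q b X.1 * gaussZ a q X.2

lemma re_inv_add_inv_pos {q₀ q : ℂ} (h₀ : 0 ≤ q₀.re) (hq : 0 < q.re) : 0 < (q₀⁻¹ + q⁻¹).re := by
  rw [Complex.add_re]; linarith [re_inv_nonneg h₀, re_inv_pos hq]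

lemma ne_zero_of_re_pos {q : ℂ} (hq : 0 < q.re) : q ≠ 0 := by rintro rfl; simp at hq

/-- Gaussian integral of a product of two tangential factors. -/
lemma integral_gaussX_mul {d : ℕ} {q₀ q : ℂ} (h₀ : 0 ≤ q₀.re) (h₀' : q₀ ≠ 0) (hq : 0 < q.re)
    (b₀ b : Fin d → ℂ) :
    ∫ x : EuclideanSpace ℝ (Fin d), gaussX q₀ b₀ x * gaussX q b x
      = (Real.pi : ℂ) ^ ((d / 2 : ℝ) : ℂ) * ((q₀ + q) ^ (-((d / 2 : ℝ) : ℂ))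
        * Complex.exp (-(∑ i, (b₀ i - b i) ^ 2) / (q₀ + q))) := by
  have hq0 := ne_zero_of_re_pos hq
  set P := q₀⁻¹ + q⁻¹ with hPdef
  have hP : 0 < P.re := re_inv_add_inv_pos h₀ hq
  have hP0 := ne_zero_of_re_pos hP
  have hs : 0 < (q₀ + q).re := by rw [Complex.add_re]; linarith
  have hs0 := ne_zero_of_re_pos hs
  have hPe : P = (q₀ + q) / (q₀ * q) := by rw [hPdef]; field_simp; ring
  let c : Fin d → ℂ := fun i => 2 * b₀ i / q₀ + 2 * b i / q
  let K : ℂ := Complex.exp (-(∑ i, (b₀ i ^ 2 / q₀ + b i ^ 2 / q)))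
  have h1 : ∀ x : EuclideanSpace ℝ (Fin d), gaussX q₀ b₀ x * gaussX q b x
      = q₀ ^ (-((d / 2 : ℝ) : ℂ)) * q ^ (-((d / 2 : ℝ) : ℂ)) * K *
        Complex.exp (-P * ∑ i, (x i : ℂ) ^ 2 + ∑ i, c i * x i) := by
    intro x
    rw [gaussX, gaussX]
    calc _ = q₀ ^ (-((d / 2 : ℝ) : ℂ)) * q ^ (-((d / 2 : ℝ) : ℂ)) *
        (Complex.exp (-(∑ i, ((x i : ℂ) - b₀ i) ^ 2) / q₀)
          * Complex.exp (-(∑ i, ((x i : ℂ) - b i) ^ 2) / q)) := by ring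
      _ = _ := by
        rw [← Complex.exp_add, mul_assoc _ K, ← Complex.exp_add]
        congr 2
        simp only [neg_div, neg_mul, Finset.sum_div, Finset.mul_sum, ← Finset.sum_neg_distrib,
          ← Finset.sum_add_distrib]
        refine Finset.sum_congr rfl fun i _ => ?_
        simp only [c, hPdef]
        field_simp
        ring
  simp_rw [h1]
  rw [integral_const_mul, ← (PiLp.volume_preserving_toLp (Fin d)).integral_comp
    (MeasurableEquiv.toLp 2 _).measurableEmbedding]
  have h2 := GaussianFourier.integral_cexp_neg_mul_sum_add hP c
  simp only [Fintype.card_fin] at h2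
  rw [h2]
  have h3 : ((Real.pi : ℂ) / P) ^ (d / 2 : ℂ)
      = (Real.pi : ℂ) ^ ((d / 2 : ℝ) : ℂ) * P ^ (-((d / 2 : ℝ) : ℂ)) := by
    push_cast
    rw [div_eq_mul_inv, mul_comm, mul_cpow_of_re_pos (re_inv_pos hP) (by simpa using Real.pi_pos.le)
      (by simp), Complex.inv_cpow, Complex.cpow_neg, mul_comm]
    intro h
    have := Complex.abs_arg_lt_pi_div_two_iff.mpr (Or.inl hP)
    rw [h, abs_of_pos Real.pi_pos] at this
    linarith [Real.pi_pos]
  rw [h3, ← cpow_mul_cpow_mul_inv_add_inv h₀ h₀' hq]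
  have h4 : K * Complex.exp ((∑ i, c i ^ 2) / (4 * P))
      = Complex.exp (-(∑ i, (b₀ i - b i) ^ 2) / (q₀ + q)) := by
    rw [← Complex.exp_add]
    congr 1
    simp only [neg_div, Finset.sum_div, ← Finset.sum_neg_distrib, ← Finset.sum_add_distrib]
    refine Finset.sum_congr rfl fun i _ => ?_
    simp only [c]
    rw [hPe]
    field_simp
    ring
  rw [← h4]
  ring

/-- Weber's exponential integral, by integrating the power series term by term. -/
lemma integral_bes_mul_cexp {a : ℝ} (ha : -1 < a) {P : ℂ} (hP : 0 < P.re) {r : ℝ} (hr : 0 ≤ r) :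
    ∫ z : ℝ, (bes ((a + 1) / 2) (r * z ^ 2) : ℂ) * Complex.exp (-P * (z : ℂ) ^ 2) ∂(nu a)
      = 1 / 2 * P ^ (-(((a + 1) / 2 : ℝ) : ℂ)) * Complex.exp (-r / P) := by
  set s := (a + 1) / 2 with hs'
  have hs : 0 < s := by rw [hs']; linarith
  have hP0 := ne_zero_of_re_pos hP
  let G : ℕ → ℝ → ℂ := fun k z => (((-r) ^ k / ((k.factorial : ℝ) * Real.Gamma (k + s)) : ℝ) : ℂ)
    * ((z : ℂ) ^ (2 * k) * Complex.exp (-P * (z : ℂ) ^ 2))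
  have hGn : ∀ k (z : ℝ), ‖G k z‖ = (r ^ k / ((k.factorial : ℝ) * Real.Gamma (k + s)))
      * (z ^ (2 * k) * Real.exp (-P.re * z ^ 2)) := by
    intro k z
    have hG := Real.Gamma_pos_of_pos (show (0 : ℝ) < k + s by positivity)
    have h3 : (-P * (z : ℂ) ^ 2).re = -P.re * z ^ 2 := by simp [← Complex.ofReal_pow]
    simp only [G, norm_mul, Complex.norm_exp, h3, norm_pow, Complex.norm_real, Real.norm_eq_abs,
      abs_div, abs_mul, abs_pow, abs_neg, abs_of_nonneg hr, abs_of_pos hG, Nat.abs_cast]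
    rw [pow_mul |z|, sq_abs, ← pow_mul]
  have hint : ∀ k, Integrable (G k) (nu a) := by
    intro k
    refine ((integrable_pow_mul_exp_neg_sq_nu ha k hP).const_mul
      (r ^ k / ((k.factorial : ℝ) * Real.Gamma (k + s)))).mono' (by fun_prop)
      (ae_of_all _ fun z => (hGn k z).le)
  have hsumn : Summable fun k => ∫ z, ‖G k z‖ ∂(nu a) := by
    have h4 : ∀ k : ℕ, ∫ z, ‖G k z‖ ∂(nu a)
        = 1 / 2 * P.re ^ (-s) * ((r / P.re) ^ k / (k.factorial : ℝ)) := by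
      intro k
      have hG := Real.Gamma_pos_of_pos (show (0 : ℝ) < k + s by positivity)
      simp_rw [hGn]
      rw [integral_const_mul, integral_pow_mul_exp_neg_sq_nu ha k hP, ← hs', neg_add,
        Real.rpow_add hP, Real.rpow_neg hP.le, Real.rpow_natCast, div_pow]
      field_simp
    simp_rw [h4]
    exact (Real.summable_pow_div_factorial _).mul_left _
  have h5 := integral_tsum_of_summable_integral_norm hint hsumn
  have h6 : ∀ z : ℝ, ∑' k, G k z = (bes s (r * z ^ 2) : ℂ) * Complex.exp (-P * (z : ℂ) ^ 2) := by
    intro z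
    rw [bes, Complex.ofReal_tsum, ← tsum_mul_right]
    refine tsum_congr fun k => ?_
    simp only [G]
    push_cast
    rw [neg_pow (_ * _), mul_pow, ← pow_mul, neg_pow (r : ℂ)]
    ring
  simp_rw [h6] at h5
  rw [← h5]
  have h7 : ∀ k : ℕ, ∫ z, G k z ∂(nu a)
      = 1 / 2 * P ^ (-(s : ℂ)) * ((-r / P) ^ k / (k.factorial : ℂ)) := by
    intro k
    have hG := Real.Gamma_pos_of_pos (show (0 : ℝ) < k + s by positivity)
    have hG' : (Real.Gamma (k + s) : ℂ) ≠ 0 := by exact_mod_cast hG.ne'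
    simp only [G]
    rw [integral_const_mul, integral_pow_mul_cexp_neg_sq_nu ha k hP, ← hs']
    push_cast
    rw [neg_add, Complex.cpow_add _ _ hP0, Complex.cpow_neg _ (k : ℂ), Complex.cpow_natCast,
      div_pow]
    field_simp
  simp_rw [h7]
  rw [tsum_mul_left, Complex.exp_eq_exp_ℂ, NormedSpace.exp_eq_tsum_div]

/-! ### The kernels as heat kernels at imaginary time -/

lemma re_four_I_mul (t : ℝ) : (4 * Complex.I * t : ℂ).re = 0 := by simp

lemma four_I_mul_ne_zero {t : ℝ} (ht : t ≠ 0) : (4 * Complex.I * t : ℂ) ≠ 0 := by simp [ht]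

/-- The principal power of a purely imaginary number. -/
lemma cpow_I_mul {t : ℝ} (ht : t ≠ 0) (c : ℝ) {r : ℝ} (hr : 0 < r) :
    (r * Complex.I * t : ℂ) ^ (-(c : ℂ))
      = Complex.exp (-Complex.I * ((Real.sign t * c * Real.pi / 2 : ℝ) : ℂ))
        / (((r * |t|) ^ c : ℝ) : ℂ) := by
  have hrt : 0 < r * |t| := by positivity
  have hlog : Complex.log (r * Complex.I * t)
      = ((Real.log (r * |t|) : ℝ) : ℂ) + Complex.I * ((Real.sign t * Real.pi / 2 : ℝ) : ℂ) := by
    rcases lt_or_gt_of_ne ht with h | h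
    · have e : (r * Complex.I * t : ℂ) = ((r * |t| : ℝ) : ℂ) * (-Complex.I) := by
        rw [abs_of_neg h]; push_cast; ring
      rw [e, Complex.log_ofReal_mul hrt (by simp), Complex.log_neg_I, Real.sign_of_neg h]
      push_cast
      ring
    · have e : (r * Complex.I * t : ℂ) = ((r * |t| : ℝ) : ℂ) * Complex.I := by
        rw [abs_of_pos h]; push_cast; ring
      rw [e, Complex.log_ofReal_mul hrt (by simp), Complex.log_I, Real.sign_of_pos h]
      push_cast
      ring
  rw [Complex.cpow_def_of_ne_zero (by simp [ht, hr.ne']), hlog, Real.rpow_def_of_pos hrt,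
    Complex.ofReal_exp, ← Complex.exp_sub]
  congr 1
  push_cast
  ring

lemma kerX_eq {d : ℕ} (x y : EuclideanSpace ℝ (Fin d)) {t : ℝ} (ht : t ≠ 0) :
    kerX x y t = (Real.pi : ℂ) ^ (-((d / 2 : ℝ) : ℂ))
      * gaussX (4 * Complex.I * t) (fun i => (x i : ℂ)) y := by
  have ht' : (t : ℂ) ≠ 0 := by exact_mod_cast ht
  rw [kerX, gaussX, ← mul_assoc]
  congr 1
  · have h1 := cpow_I_mul ht (d / 2) (r := 4 * Real.pi) (by positivity)
    have h2 := cpow_I_mul ht (d / 2) (r := 4) (by positivity)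
    push_cast at h1 h2 ⊢
    rw [h1, h2, ← Complex.ofReal_natCast, ← Complex.ofReal_ofNat, ← Complex.ofReal_div,
      ← Complex.ofReal_neg, ← Complex.ofReal_cpow Real.pi_pos.le, Real.rpow_neg Real.pi_pos.le,
      show 4 * Real.pi * |t| = Real.pi * (4 * |t|) by ring,
      Real.mul_rpow Real.pi_pos.le (by positivity)]
    push_cast
    field_simp
  · congr 1
    rw [EuclideanSpace.norm_sq_eq]
    push_cast
    simp only [PiLp.sub_apply, Real.norm_eq_abs, sq_abs, ← Complex.ofReal_pow]
    push_cast
    have : ∀ i, ((y i : ℂ) - x i) ^ 2 = ((x i : ℂ) - y i) ^ 2 := fun i => by ring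
    simp_rw [this]
    field_simp
    rw [Complex.I_sq]
    ring

lemma kerX_comm {d : ℕ} (x y : EuclideanSpace ℝ (Fin d)) (t : ℝ) : kerX x y t = kerX y x t := by
  simp only [kerX, norm_sub_rev]

/-- The normal kernel, as an expression that makes sense for all real `z, ζ`. -/
def heatZ (a z ζ t : ℝ) : ℂ :=
  2 * (4 * Complex.I * t : ℂ) ^ (-(((a + 1) / 2 : ℝ) : ℂ))
    * (bes ((a + 1) / 2) ((z / (4 * t)) ^ 2 * ζ ^ 2) : ℂ)
    * Complex.exp (-((z : ℂ) ^ 2 + (ζ : ℂ) ^ 2) / (4 * Complex.I * t))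

lemma heatZ_comm (a z ζ t : ℝ) : heatZ a z ζ t = heatZ a ζ z t := by
  rw [heatZ, heatZ, add_comm ((z : ℂ) ^ 2)]
  congr 4
  ring

lemma rpow_mul_besselJ (a : ℝ) {w : ℝ} (hw : 0 < w) :
    w ^ ((1 - a) / 2) * besselJ ((a - 1) / 2) w
      = 2 ^ ((1 - a) / 2) * bes ((a + 1) / 2) (w ^ 2 / 4) := by
  rw [besselJ, bes, ← tsum_mul_left, ← tsum_mul_left]
  refine tsum_congr fun k => ?_
  have e : w ^ ((1 - a) / 2) * (w / 2) ^ (2 * (k : ℝ) + (a - 1) / 2)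
      = 2 ^ ((1 - a) / 2) * (w ^ 2 / 4) ^ k := by
    have h2 : (w / 2) ^ ((a - 1) / 2) = 2 ^ ((1 - a) / 2) / w ^ ((1 - a) / 2) := by
      rw [show (a - 1) / 2 = -((1 - a) / 2) by ring, Real.rpow_neg (by positivity),
        Real.div_rpow hw.le (by norm_num), inv_div]
    have h3 : (w / 2) ^ (2 * (k : ℝ)) = (w ^ 2 / 4) ^ k := by
      rw [Real.rpow_mul (by positivity), Real.rpow_two, Real.rpow_natCast]
      congr 1
      ring
    have := Real.rpow_pos_of_pos hw ((1 - a) / 2)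
    rw [Real.rpow_add (by positivity), h2, h3]
    field_simp
  rw [show (k : ℝ) + (a - 1) / 2 + 1 = k + (a + 1) / 2 by ring, neg_pow (_ / _)]
  calc _ = (-1) ^ k / ((k.factorial : ℝ) * Real.Gamma (k + (a + 1) / 2))
        * (w ^ ((1 - a) / 2) * (w / 2) ^ (2 * (k : ℝ) + (a - 1) / 2)) := by ring
    _ = _ := by rw [e]; ring

lemma exp_sign_div_rpow (a : ℝ) {t : ℝ} (ht : t ≠ 0) :
    Complex.exp (-Complex.I * ((Real.sign t * (a + 1) * Real.pi / 4 : ℝ) : ℂ))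
      = (4 * Complex.I * t : ℂ) ^ (-(((a + 1) / 2 : ℝ) : ℂ))
        * (((4 * |t|) ^ ((a + 1) / 2) : ℝ) : ℂ) := by
  have h2 := cpow_I_mul ht ((a + 1) / 2) (r := 4) (by positivity)
  have h3 : (((4 * |t|) ^ ((a + 1) / 2) : ℝ) : ℂ) ≠ 0 := by
    have : 0 < 4 * |t| := by positivity
    exact_mod_cast (Real.rpow_pos_of_pos this _).ne'
  rw [Complex.ofReal_ofNat] at h2
  rw [h2, div_mul_cancel₀ _ h3]
  congr 3
  ring

lemma exp_I_div {r t : ℝ} :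
    Complex.exp (Complex.I * ((r / (4 * t) : ℝ) : ℂ))
      = Complex.exp (-(r : ℂ) / (4 * Complex.I * t)) := by
  congr 1
  rcases eq_or_ne t 0 with rfl | ht
  · simp
  have ht' : (t : ℂ) ≠ 0 := by exact_mod_cast ht
  push_cast
  field_simp
  rw [Complex.I_sq]
  ring

lemma kerZ_eq {a z ζ t : ℝ} (ht : t ≠ 0) (hz : 0 < z) (hζ : 0 < ζ) :
    kerZ a z ζ t = heatZ a z ζ t := by
  have h2t : 0 < 2 * |t| := by positivity
  have hw : 0 < z * ζ / (2 * |t|) := by positivity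
  rw [kerZ, heatZ, rpow_mul_besselJ a hw, exp_sign_div_rpow a ht, exp_I_div]
  have e1 : (z * ζ / (2 * |t|)) ^ 2 / 4 = (z / (4 * t)) ^ 2 * ζ ^ 2 := by
    rw [div_pow, mul_pow 2 |t|, sq_abs]
    field_simp
    ring
  have e2 : (4 * |t|) ^ ((a + 1) / 2) / (2 * |t|) ^ ((a + 1) / 2) * 2 ^ ((1 - a) / 2) = 2 := by
    rw [← Real.div_rpow (by positivity) (by positivity),
      show 4 * |t| / (2 * |t|) = 2 by field_simp; norm_num, ← Real.rpow_add two_pos]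
    ring_nf
    simp
  have e2' : (((4 * |t|) ^ ((a + 1) / 2) : ℝ) : ℂ) / (((2 * |t|) ^ ((a + 1) / 2) : ℝ) : ℂ)
      * ((2 ^ ((1 - a) / 2) : ℝ) : ℂ) = 2 := by exact_mod_cast e2
  rw [e1]
  push_cast at e2' ⊢
  rw [← e2']
  ring

lemma kerZ0_eq {a : ℝ} (z : ℝ) {t : ℝ} (ht : t ≠ 0) : kerZ0 a z t = heatZ a z 0 t := by
  have htp : 0 < |t| := by positivity
  rw [kerZ0, heatZ, exp_sign_div_rpow a ht, exp_I_div]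
  simp only [ne_eq, OfNat.ofNat_ne_zero, not_false_eq_true, zero_pow, mul_zero, bes_zero,
    Complex.ofReal_zero, add_zero]
  have e2 : (2 : ℝ) ^ (-a) * ((4 * |t|) ^ ((a + 1) / 2) / |t| ^ ((a + 1) / 2)) = 2 := by
    rw [← Real.div_rpow (by positivity) (by positivity), mul_div_cancel_right₀ _ htp.ne',
      show (4 : ℝ) = 2 ^ (2 : ℝ) by norm_num, ← Real.rpow_mul two_pos.le, ← Real.rpow_add two_pos]
    ring_nf
    simp
  have e2' : (((2 : ℝ) ^ (-a) : ℝ) : ℂ) * ((((4 * |t|) ^ ((a + 1) / 2) : ℝ) : ℂ)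
      / ((|t| ^ ((a + 1) / 2) : ℝ) : ℂ)) = 2 := by exact_mod_cast e2
  push_cast at e2' ⊢
  rw [← e2']
  ring

lemma integral_heatZ_mul_gaussZ {a : ℝ} (ha : -1 < a) (z : ℝ) {t : ℝ} (ht : t ≠ 0) {q : ℂ}
    (hq : 0 < q.re) :
    ∫ ζ, heatZ a z ζ t * gaussZ a q ζ ∂(nu a) = gaussZ a (q + 4 * Complex.I * t) z := by
  set q₀ : ℂ := 4 * Complex.I * t with hq₀
  have h₀ : 0 ≤ q₀.re := by rw [hq₀, re_four_I_mul]
  have h₀' : q₀ ≠ 0 := four_I_mul_ne_zero ht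
  have hq0 := ne_zero_of_re_pos hq
  have hP : 0 < (q₀⁻¹ + q⁻¹).re := re_inv_add_inv_pos h₀ hq
  have hP0 := ne_zero_of_re_pos hP
  have hs0 : q₀ + q ≠ 0 := ne_zero_of_re_pos (by rw [Complex.add_re]; linarith)
  have h1 : ∀ ζ : ℝ, heatZ a z ζ t * gaussZ a q ζ
      = 2 * (q₀ ^ (-(((a + 1) / 2 : ℝ) : ℂ)) * q ^ (-(((a + 1) / 2 : ℝ) : ℂ)))
        * Complex.exp (-(z : ℂ) ^ 2 / q₀)
        * ((bes ((a + 1) / 2) ((z / (4 * t)) ^ 2 * ζ ^ 2) : ℂ)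
          * Complex.exp (-(q₀⁻¹ + q⁻¹) * (ζ : ℂ) ^ 2)) := by
    intro ζ
    rw [heatZ, gaussZ, ← hq₀]
    have : Complex.exp (-((z : ℂ) ^ 2 + (ζ : ℂ) ^ 2) / q₀) * Complex.exp (-(ζ : ℂ) ^ 2 / q)
        = Complex.exp (-(z : ℂ) ^ 2 / q₀) * Complex.exp (-(q₀⁻¹ + q⁻¹) * (ζ : ℂ) ^ 2) := by
      rw [← Complex.exp_add, ← Complex.exp_add]
      congr 1
      field_simp
      ring
    linear_combination (2 * q₀ ^ (-(((a + 1) / 2 : ℝ) : ℂ)) * q ^ (-(((a + 1) / 2 : ℝ) : ℂ)) *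
      (bes ((a + 1) / 2) ((z / (4 * t)) ^ 2 * ζ ^ 2) : ℂ)) * this
  simp_rw [h1]
  rw [integral_const_mul, integral_bes_mul_cexp ha hP (by positivity), gaussZ, add_comm q,
    ← cpow_mul_cpow_mul_inv_add_inv h₀ h₀' hq]
  have h2 : Complex.exp (-(z : ℂ) ^ 2 / q₀)
      * Complex.exp (-(((z / (4 * t)) ^ 2 : ℝ) : ℂ) / (q₀⁻¹ + q⁻¹))
      = Complex.exp (-(z : ℂ) ^ 2 / (q₀ + q)) := by
    rw [← Complex.exp_add]
    congr 1
    have e : (((z / (4 * t)) ^ 2 : ℝ) : ℂ) = -(z : ℂ) ^ 2 / q₀ ^ 2 := by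
      rw [hq₀]
      have ht' : (t : ℂ) ≠ 0 := by exact_mod_cast ht
      push_cast
      rw [mul_pow, mul_pow, Complex.I_sq]
      field_simp
    have hP' : q₀⁻¹ + q⁻¹ = (q₀ + q) / (q₀ * q) := by field_simp; ring
    rw [e, hP']
    field_simp
    ring
  rw [← h2]
  ring

lemma integral_gaussZ_mul {a : ℝ} (ha : -1 < a) {q₁ q₂ : ℂ} (h₁ : 0 < q₁.re) (h₂ : 0 < q₂.re) :
    ∫ ζ, gaussZ a q₁ ζ * gaussZ a q₂ ζ ∂(nu a)
      = (Real.Gamma ((a + 1) / 2) / 2 : ℝ) * (q₁ + q₂) ^ (-(((a + 1) / 2 : ℝ) : ℂ)) := by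
  have hP : 0 < (q₁⁻¹ + q₂⁻¹).re := re_inv_add_inv_pos h₁.le h₂
  have n₁ := ne_zero_of_re_pos h₁
  have n₂ := ne_zero_of_re_pos h₂
  have h1 : ∀ ζ : ℝ, gaussZ a q₁ ζ * gaussZ a q₂ ζ
      = (q₁ ^ (-(((a + 1) / 2 : ℝ) : ℂ)) * q₂ ^ (-(((a + 1) / 2 : ℝ) : ℂ)))
        * Complex.exp (-(q₁⁻¹ + q₂⁻¹) * (ζ : ℂ) ^ 2) := by
    intro ζ
    have : Complex.exp (-(q₁⁻¹ + q₂⁻¹) * (ζ : ℂ) ^ 2)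
        = Complex.exp (-(ζ : ℂ) ^ 2 / q₁) * Complex.exp (-(ζ : ℂ) ^ 2 / q₂) := by
      rw [← Complex.exp_add]
      congr 1
      field_simp
      ring
    rw [this, gaussZ, gaussZ]
    ring
  simp_rw [h1]
  rw [integral_const_mul, integral_cexp_neg_sq_nu ha hP,
    ← cpow_mul_cpow_mul_inv_add_inv h₁.le n₁ h₂]
  ring

/-- The Gram matrix of the Gaussians with respect to the bilinear pairing depends on the widths only
through their sum. -/
lemma integral_gauss_mul {d : ℕ} {a : ℝ} (ha : -1 < a) {q₁ q₂ : ℂ} (h₁ : 0 < q₁.re)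
    (h₂ : 0 < q₂.re) (b₁ b₂ : Fin d → ℂ) :
    ∫ X, gauss a q₁ b₁ X * gauss a q₂ b₂ X ∂(omega d a)
      = (Real.pi : ℂ) ^ ((d / 2 : ℝ) : ℂ) * (Real.Gamma ((a + 1) / 2) / 2 : ℝ)
        * ((q₁ + q₂) ^ (-((d / 2 : ℝ) : ℂ)) * (q₁ + q₂) ^ (-(((a + 1) / 2 : ℝ) : ℂ))
          * Complex.exp (-(∑ i, (b₁ i - b₂ i) ^ 2) / (q₁ + q₂))) := by
  have h : ∀ X : Pt d, gauss a q₁ b₁ X * gauss a q₂ b₂ X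
      = (gaussX q₁ b₁ X.1 * gaussX q₂ b₂ X.1) * (gaussZ a q₁ X.2 * gaussZ a q₂ X.2) :=
    fun X => by simp only [gauss]; ring
  simp_rw [h]
  rw [omega_eq_prod, integral_prod_mul (fun x => gaussX q₁ b₁ x * gaussX q₂ b₂ x)
    (fun z => gaussZ a q₁ z * gaussZ a q₂ z),
    integral_gaussX_mul h₁.le (ne_zero_of_re_pos h₁) h₂, integral_gaussZ_mul ha h₁ h₂]
  ring

lemma integral_kerX_mul_gaussX {d : ℕ} (x : EuclideanSpace ℝ (Fin d)) {t : ℝ} (ht : t ≠ 0) {q : ℂ}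
    (hq : 0 < q.re) (b : Fin d → ℂ) :
    ∫ y, kerX x y t * gaussX q b y = gaussX (q + 4 * Complex.I * t) b x := by
  have h : ∀ y, kerX x y t * gaussX q b y = (Real.pi : ℂ) ^ (-((d / 2 : ℝ) : ℂ))
      * (gaussX (4 * Complex.I * t) (fun i => (x i : ℂ)) y * gaussX q b y) := fun y => by
    rw [kerX_eq x _ ht, mul_assoc]
  simp_rw [h]
  rw [integral_const_mul, integral_gaussX_mul (by rw [re_four_I_mul]) (four_I_mul_ne_zero ht) hq,
    ← mul_assoc, ← Complex.cpow_add _ _ (by simp), neg_add_cancel, Complex.cpow_zero, one_mul,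
    add_comm q, gaussX]

/-- `ker`, as an expression that makes sense on the whole space. -/
def heatKer {d : ℕ} (a : ℝ) (X Y : Pt d) (t : ℝ) : ℂ := heatZ a X.2 Y.2 t * kerX X.1 Y.1 t

lemma heatKer_comm {d : ℕ} (a : ℝ) (X Y : Pt d) (t : ℝ) : heatKer a X Y t = heatKer a Y X t := by
  rw [heatKer, heatKer, heatZ_comm, kerX_comm]

lemma ker_eq {d : ℕ} {a : ℝ} {X Y : Pt d} {t : ℝ} (ht : t ≠ 0) (hX : 0 < X.2) (hY : 0 < Y.2) :
    ker a X Y t = heatKer a X Y t := by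
  rw [ker, heatKer, kerZ_eq ht hX hY]

lemma kerBdry_eq {d : ℕ} {a : ℝ} (X : Pt d) (y : EuclideanSpace ℝ (Fin d)) {t : ℝ} (ht : t ≠ 0) :
    kerBdry a X y t = heatKer a X (y, 0) t := by
  rw [kerBdry, heatKer, kerZ0_eq _ ht]

lemma integral_heatKer_mul_gauss {d : ℕ} {a : ℝ} (ha : -1 < a) (X : Pt d) {t : ℝ} (ht : t ≠ 0)
    {q : ℂ} (hq : 0 < q.re) (b : Fin d → ℂ) :
    ∫ Y, heatKer a X Y t * gauss a q b Y ∂(omega d a) = gauss a (q + 4 * Complex.I * t) b X := by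
  have h : ∀ Y : Pt d, heatKer a X Y t * gauss a q b Y
      = (kerX X.1 Y.1 t * gaussX q b Y.1) * (heatZ a X.2 Y.2 t * gaussZ a q Y.2) :=
    fun Y => by simp only [gauss, heatKer]; ring
  simp_rw [h]
  rw [omega_eq_prod, integral_prod_mul (fun y => kerX X.1 y t * gaussX q b y)
    (fun ζ => heatZ a X.2 ζ t * gaussZ a q ζ), integral_kerX_mul_gaussX _ ht hq,
    integral_heatZ_mul_gaussZ ha _ ht hq, gauss]

/-! ### Decay and integrability -/

lemma norm_sq_le {d : ℕ} (X : Pt d) : ‖X‖ ^ 2 ≤ ‖X.1‖ ^ 2 + X.2 ^ 2 := by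
  rw [Prod.norm_def]
  rcases le_total ‖X.1‖ ‖X.2‖ with h | h
  · rw [max_eq_right h, Real.norm_eq_abs, sq_abs]; nlinarith [sq_nonneg ‖X.1‖]
  · rw [max_eq_left h]; nlinarith [sq_nonneg X.2]

lemma integrable_one_add_pow_nu {a : ℝ} (ha : -1 < a) (ha' : a < 1) :
    Integrable (fun z : ℝ => ((1 + |z|) ^ 3)⁻¹) (nu a) := by
  rw [integrable_nu_iff, ← Ioc_union_Ioi_eq_Ioi zero_le_one]
  have hmeas : ∀ s : Set ℝ, AEStronglyMeasurable (fun z : ℝ => z ^ a • ((1 + |z|) ^ 3)⁻¹)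
      (volume.restrict s) := fun s => by
    have : Measurable fun z : ℝ => z ^ a • ((1 + |z|) ^ 3)⁻¹ := by fun_prop
    exact this.aestronglyMeasurable
  refine IntegrableOn.union ?_ ?_
  · have h := (intervalIntegrable_iff_integrableOn_Ioc_of_le zero_le_one).mp
      (intervalIntegral.intervalIntegrable_rpow' (a := 0) (b := 1) ha)
    refine Integrable.mono' h (hmeas _) ?_
    filter_upwards [ae_restrict_mem measurableSet_Ioc] with z hz
    have h1 : ((1 + |z|) ^ 3)⁻¹ ≤ 1 :=
      inv_le_one_of_one_le₀ (one_le_pow₀ (by linarith [abs_nonneg z]))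
    have h2 := Real.rpow_nonneg hz.1.le a
    rw [smul_eq_mul, Real.norm_eq_abs, abs_of_nonneg (by positivity)]
    exact mul_le_of_le_one_right h2 h1
  · have h := integrableOn_Ioi_rpow_of_lt (a := a - 3) (by linarith) one_pos
    refine Integrable.mono' h (hmeas _) ?_
    filter_upwards [ae_restrict_mem measurableSet_Ioi] with z hz
    have hz0 : 0 < z := lt_trans one_pos hz
    have h2 := Real.rpow_nonneg hz0.le a
    rw [smul_eq_mul, Real.norm_eq_abs, abs_of_nonneg (by positivity), Real.rpow_sub hz0,
      div_eq_mul_inv]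
    have h3 : z ^ (3 : ℝ) = z ^ 3 := by norm_cast
    rw [h3, abs_of_pos hz0]
    gcongr
    linarith

lemma integrable_one_add_norm_pow_euclidean (d : ℕ) :
    Integrable fun x : EuclideanSpace ℝ (Fin d) => ((1 + ‖x‖) ^ (d + 1))⁻¹ := by
  have h := integrable_one_add_norm (E := EuclideanSpace ℝ (Fin d)) (μ := volume) (r := d + 1)
    (by simp)
  refine h.congr (ae_of_all _ fun x => ?_)
  dsimp only
  rw [Real.rpow_neg (by positivity)]
  norm_cast

/-- An exponent for which `(1 + ‖X‖) ^ {-N}` is integrable with respect to `omega d a`. -/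
def decayExp (d : ℕ) : ℕ := d + 1 + 3

lemma integrable_one_add_norm_pow {d : ℕ} {a : ℝ} (ha : -1 < a) (ha' : a < 1) :
    Integrable (fun X : Pt d => ((1 + ‖X‖) ^ decayExp d)⁻¹) (omega d a) := by
  rw [omega_eq_prod]
  refine ((integrable_one_add_norm_pow_euclidean d).mul_prod
    (integrable_one_add_pow_nu ha ha')).mono' ?_
    (ae_of_all _ fun X => ?_)
  · have : Measurable fun X : Pt d => ((1 + ‖X‖) ^ decayExp d)⁻¹ := by fun_prop
    exact this.aestronglyMeasurable
  · rw [Real.norm_eq_abs, abs_of_pos (by positivity), ← mul_inv, decayExp, pow_add]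
    have := norm_fst_le X
    have h2 : |X.2| ≤ ‖X‖ := norm_snd_le X
    gcongr

lemma exists_norm_schwartz_le {E : Type*} [NormedAddCommGroup E] [NormedSpace ℝ E] (V : 𝓢(E, ℂ))
    (N : ℕ) : ∃ C, 0 ≤ C ∧ ∀ x, ‖V x‖ ≤ C * ((1 + ‖x‖) ^ N)⁻¹ := by
  refine ⟨2 ^ N * ((Finset.Iic (N, 0)).sup fun m => SchwartzMap.seminorm ℝ m.1 m.2) V,
    by positivity, fun X => ?_⟩
  have h := SchwartzMap.one_add_le_sup_seminorm_apply (𝕜 := ℝ) (m := (N, 0)) (k := N) (n := 0)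
    le_rfl le_rfl V X
  rw [norm_iteratedFDeriv_zero] at h
  rw [← div_eq_mul_inv, le_div_iff₀ (by positivity), mul_comm]
  exact h

/-- Rapid decrease on the half-space: measurability and decay faster than any power, without any
condition on derivatives. -/
structure IsRapid {d : ℕ} (a : ℝ) (u : Pt d → ℂ) : Prop where
  meas : AEStronglyMeasurable u (omega d a)
  decay : ∀ N : ℕ, ∃ C, 0 ≤ C ∧ ∀ X, 0 < X.2 → ‖u X‖ ≤ C * ((1 + ‖X‖) ^ N)⁻¹

section IsRapid

variable {d : ℕ} {a : ℝ} {u v : Pt d → ℂ}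

lemma IsRapid.add (hu : IsRapid a u) (hv : IsRapid a v) : IsRapid a fun X => u X + v X := by
  refine ⟨hu.meas.add hv.meas, fun N => ?_⟩
  obtain ⟨C, hC, h⟩ := hu.decay N
  obtain ⟨D, hD, h'⟩ := hv.decay N
  refine ⟨C + D, by positivity, fun X hX => ?_⟩
  rw [add_mul]
  exact (norm_add_le _ _).trans (add_le_add (h X hX) (h' X hX))

lemma IsRapid.const_mul (hu : IsRapid a u) (c : ℂ) : IsRapid a fun X => c * u X := by
  refine ⟨hu.meas.const_mul c, fun N => ?_⟩
  obtain ⟨C, hC, h⟩ := hu.decay N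
  refine ⟨‖c‖ * C, by positivity, fun X hX => ?_⟩
  rw [norm_mul, mul_assoc]
  exact mul_le_mul_of_nonneg_left (h X hX) (norm_nonneg c)

lemma IsRapid.sub (hu : IsRapid a u) (hv : IsRapid a v) : IsRapid a fun X => u X - v X := by
  simpa [sub_eq_add_neg] using hu.add (hv.const_mul (-1))

lemma IsRapid.of_schwartz (V : 𝓢(Pt d, ℂ)) : IsRapid a V := by
  refine ⟨V.continuous.aestronglyMeasurable, fun N => ?_⟩
  obtain ⟨C, hC, h⟩ := exists_norm_schwartz_le V N
  exact ⟨C, hC, fun X _ => h X⟩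

/-- A rapidly decreasing function is integrable against any weight of polynomial growth. -/
lemma IsRapid.integrable_of_le (hu : IsRapid a u) (ha : -1 < a) (ha' : a < 1) {w : Pt d → ℂ}
    (hw : AEStronglyMeasurable w (omega d a)) {C : ℝ} {N : ℕ}
    (h : ∀ X, 0 < X.2 → ‖w X‖ ≤ C * (1 + ‖X‖) ^ N * ‖u X‖) : Integrable w (omega d a) := by
  obtain ⟨D, hD, h'⟩ := hu.decay (N + decayExp d)
  refine ((integrable_one_add_norm_pow ha ha').const_mul (|C| * D)).mono' hw ?_
  filter_upwards [ae_omega_pos d a] with X hX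
  calc ‖w X‖ ≤ C * (1 + ‖X‖) ^ N * ‖u X‖ := h X hX
    _ ≤ |C| * (1 + ‖X‖) ^ N * (D * ((1 + ‖X‖) ^ (N + decayExp d))⁻¹) := by
      gcongr
      · exact le_abs_self C
      · exact h' X hX
    _ = |C| * D * ((1 + ‖X‖) ^ decayExp d)⁻¹ := by
      rw [pow_add]
      field_simp

lemma IsRapid.integrable_weight (hu : IsRapid a u) (ha : -1 < a) (ha' : a < 1) :
    Integrable (fun X => (1 + ‖X‖) ^ 2 * ‖u X‖) (omega d a) := by
  have hm : AEStronglyMeasurable (fun X => (((1 + ‖X‖) ^ 2 : ℝ) : ℂ) * u X) (omega d a) :=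
    AEStronglyMeasurable.mul (Continuous.aestronglyMeasurable (by fun_prop)) hu.meas
  refine (hu.integrable_of_le ha ha' (C := 1) (N := 2) hm fun X _ => ?_).norm.congr
    (ae_of_all _ fun X => ?_)
  · rw [norm_mul, Complex.norm_real, one_mul, Real.norm_eq_abs, abs_of_nonneg (by positivity)]
  · simp only [norm_mul, Complex.norm_real, Real.norm_eq_abs]
    rw [abs_of_nonneg (by positivity)]

lemma IsRapid.memLp (hu : IsRapid a u) (ha : -1 < a) (ha' : a < 1) : MemLp u 2 (omega d a) := by
  rw [memLp_two_iff_integrable_sq_norm hu.meas]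
  obtain ⟨C, hC, h⟩ := hu.decay 0
  have h1 : Integrable (fun X => ((‖u X‖ ^ 2 : ℝ) : ℂ)) (omega d a) := by
    refine hu.integrable_of_le ha ha' (C := C) (N := 0) ?_ fun X hX => ?_
    · exact (Complex.continuous_ofReal.comp_aestronglyMeasurable (hu.meas.norm.pow 2))
    · have := h X hX
      simp only [Complex.norm_real, norm_pow, norm_norm, pow_zero, mul_one, inv_one] at this ⊢
      rw [sq]
      gcongr
  exact_mod_cast h1.re

end IsRapid

/-! ### Bounds for Gaussians -/

lemma integrable_exp_neg_sq {d : ℕ} {a : ℝ} (ha : -1 < a) {ρ : ℝ} (hρ : 0 < ρ) :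
    Integrable (fun X : Pt d => Real.exp (-ρ * (‖X.1‖ ^ 2 + X.2 ^ 2))) (omega d a) := by
  have h1 : Integrable fun x : EuclideanSpace ℝ (Fin d) => Real.exp (-ρ * ‖x‖ ^ 2) := by
    have h := (GaussianFourier.integrable_cexp_neg_mul_sq_norm_add (V := EuclideanSpace ℝ (Fin d))
      (b := ρ) (by simpa using hρ) 0 0).norm
    refine h.congr (ae_of_all _ fun x => ?_)
    simp [Complex.norm_exp, ← Complex.ofReal_pow]
  refine (h1.mul_prod (integrable_exp_neg_sq_nu ha hρ)).congr (ae_of_all _ fun X => ?_)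
  dsimp only
  rw [← Real.exp_add]
  ring_nf

lemma exists_pow_mul_exp_le (N : ℕ) {ρ : ℝ} (hρ : 0 < ρ) :
    ∃ C, 0 ≤ C ∧ ∀ v, 0 ≤ v → (1 + v) ^ N * Real.exp (-ρ * v) ≤ C := by
  refine ⟨N.factorial / ρ ^ N * Real.exp ρ, by positivity, fun v hv => ?_⟩
  have h := Real.pow_div_factorial_le_exp (ρ * (1 + v)) (by positivity) N
  rw [div_le_iff₀ (by positivity), mul_pow, show ρ * (1 + v) = ρ + ρ * v by ring, Real.exp_add] at h
  have h2 : (1 + v) ^ N ≤ N.factorial / ρ ^ N * Real.exp ρ * Real.exp (ρ * v) := by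
    rw [div_mul_eq_mul_div, div_mul_eq_mul_div, le_div_iff₀ (by positivity)]
    linarith
  rw [neg_mul, Real.exp_neg, ← div_eq_mul_inv, div_le_iff₀ (Real.exp_pos _)]
  exact h2

lemma exists_one_add_norm_pow_mul_exp_le {d : ℕ} (N : ℕ) {ρ : ℝ} (hρ : 0 < ρ) :
    ∃ C, 0 ≤ C ∧ ∀ X : Pt d, (1 + ‖X‖) ^ N * Real.exp (-ρ * (‖X.1‖ ^ 2 + X.2 ^ 2)) ≤ C := by
  obtain ⟨C, hC, h⟩ := exists_pow_mul_exp_le N hρ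
  refine ⟨2 ^ N * C, by positivity, fun X => ?_⟩
  have h1 : 1 + ‖X‖ ≤ 2 * (1 + (‖X.1‖ ^ 2 + X.2 ^ 2)) := by
    nlinarith [norm_sq_le X, sq_nonneg (‖X‖ - 1)]
  calc _ ≤ (2 * (1 + (‖X.1‖ ^ 2 + X.2 ^ 2))) ^ N * Real.exp (-ρ * (‖X.1‖ ^ 2 + X.2 ^ 2)) := by
          gcongr
    _ = 2 ^ N * ((1 + (‖X.1‖ ^ 2 + X.2 ^ 2)) ^ N * Real.exp (-ρ * (‖X.1‖ ^ 2 + X.2 ^ 2))) := by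
      rw [mul_pow]; ring
    _ ≤ _ := by gcongr; exact h _ (by positivity)

lemma isRapid_of_le_exp {d : ℕ} {a : ℝ} {u : Pt d → ℂ} (hu : AEStronglyMeasurable u (omega d a))
    {C ρ : ℝ} (hC : 0 ≤ C) (hρ : 0 < ρ)
    (h : ∀ X, 0 < X.2 → ‖u X‖ ≤ C * Real.exp (-ρ * (‖X.1‖ ^ 2 + X.2 ^ 2))) : IsRapid a u := by
  refine ⟨hu, fun N => ?_⟩
  obtain ⟨D, hD, h'⟩ := exists_one_add_norm_pow_mul_exp_le (d := d) N hρ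
  refine ⟨C * D, by positivity, fun X hX => (h X hX).trans ?_⟩
  rw [mul_assoc, ← div_eq_mul_inv]
  gcongr
  rw [le_div_iff₀ (by positivity), mul_comm]
  exact h' X

lemma continuous_gauss {d : ℕ} (a : ℝ) (q : ℂ) (b : Fin d → ℂ) : Continuous (gauss a q b) := by
  unfold gauss gaussX gaussZ
  fun_prop

/-- Gaussian decay, uniformly along bounded pieces of the orbit `q + 4iσ`. -/
lemma exists_norm_gauss_le {d : ℕ} {a : ℝ} (ha : -1 < a) {q : ℂ} (hq : 0 < q.re) (b : Fin d → ℂ)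
    {S : ℝ} (hS : 0 ≤ S) :
    ∃ C ρ, 0 ≤ C ∧ 0 < ρ ∧ ∀ σ : ℝ, |σ| ≤ S → ∀ X : Pt d,
      ‖gauss a (q + 4 * Complex.I * σ) b X‖ ≤ C * Real.exp (-ρ * (‖X.1‖ ^ 2 + X.2 ^ 2)) := by
  set M := q.re⁻¹ with hM
  have hM0 : 0 < M := inv_pos.mpr hq
  set α := q.re / (‖q‖ + 4 * S) ^ 2 with hα
  have hqn : 0 < ‖q‖ := norm_pos_iff.mpr (ne_zero_of_re_pos hq)
  have hα0 : 0 < α := by positivity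
  set B := ∑ i, ‖b i‖ with hB
  have hB0 : 0 ≤ B := by positivity
  set B2 := ∑ i, ‖b i‖ ^ 2 with hB2
  refine ⟨q.re ^ (-(d / 2 : ℝ)) * q.re ^ (-((a + 1) / 2)) *
      Real.exp (2 * M ^ 2 * B ^ 2 / α + M * B2),
    α / 2, by positivity, by positivity, fun σ hσ X => ?_⟩
  set q' : ℂ := q + 4 * Complex.I * σ with hq'
  have hre : q'.re = q.re := by simp [hq']
  have hre' : 0 < q'.re := by rw [hre]; exact hq
  have hn : q.re ≤ ‖q'‖ := by rw [← hre]; exact Complex.re_le_norm q'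
  have hn' : ‖q'‖ ≤ ‖q‖ + 4 * S := by
    refine (norm_add_le _ _).trans ?_
    simp only [norm_mul, Complex.norm_I, Complex.norm_real, Real.norm_eq_abs, mul_one]
    norm_num
    linarith
  have hpow : ∀ c : ℝ, 0 ≤ c → ‖q' ^ (-(c : ℂ))‖ ≤ q.re ^ (-c) := by
    intro c hc
    rw [← Complex.ofReal_neg, Complex.norm_cpow_real]
    exact Real.rpow_le_rpow_of_nonpos hq hn (by linarith)
  set w := q'⁻¹ with hw
  have hwre : α ≤ w.re := by
    rw [hw, Complex.inv_re, hre, Complex.normSq_eq_norm_sq]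
    have : 0 < ‖q'‖ := lt_of_lt_of_le hq hn
    exact div_le_div_of_nonneg_left hq.le (by positivity) (by gcongr)
  have hwn : ‖w‖ ≤ M := by
    rw [hw, norm_inv, hM]
    gcongr
  have hexp : (-(∑ i, ((X.1 i : ℂ) - b i) ^ 2) / q' + -(X.2 : ℂ) ^ 2 / q').re
      ≤ -(α / 2) * (‖X.1‖ ^ 2 + X.2 ^ 2) + (2 * M ^ 2 * B ^ 2 / α + M * B2) := by
    have e1 : -(∑ i, ((X.1 i : ℂ) - b i) ^ 2) / q' + -(X.2 : ℂ) ^ 2 / q'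
        = -((‖X.1‖ ^ 2 + X.2 ^ 2 : ℝ) : ℂ) * w + 2 * (∑ i, (X.1 i : ℂ) * b i) * w
          - (∑ i, b i ^ 2) * w := by
      rw [EuclideanSpace.norm_sq_eq]
      simp only [Real.norm_eq_abs, sq_abs]
      push_cast
      rw [div_eq_mul_inv, div_eq_mul_inv, ← hw, Finset.mul_sum]
      have : ∀ i, ((X.1 i : ℂ) - b i) ^ 2 = (X.1 i : ℂ) ^ 2 - 2 * ((X.1 i : ℂ) * b i) + b i ^ 2 :=
        fun i => by ring
      simp_rw [this]
      rw [Finset.sum_add_distrib, Finset.sum_sub_distrib]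
      ring
    have e2 : ‖2 * (∑ i, (X.1 i : ℂ) * b i) * w‖ ≤ 2 * (‖X.1‖ * B) * M := by
      rw [norm_mul, norm_mul, Complex.norm_two]
      gcongr
      refine (norm_sum_le _ _).trans ?_
      rw [hB, Finset.mul_sum]
      refine Finset.sum_le_sum fun i _ => ?_
      rw [norm_mul, Complex.norm_real]
      gcongr
      exact PiLp.norm_apply_le X.1 i
    have e3 : ‖(∑ i, b i ^ 2) * w‖ ≤ M * B2 := by
      rw [norm_mul, mul_comm]
      gcongr
      refine (norm_sum_le _ _).trans (Finset.sum_le_sum fun i _ => by rw [norm_pow])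
    rw [e1, Complex.sub_re, Complex.add_re, ← Complex.ofReal_neg, Complex.re_ofReal_mul]
    have e4 := (Complex.re_le_norm _).trans e2
    have e5 := (neg_le_abs _).trans ((Complex.abs_re_le_norm _).trans e3)
    have e6 : 2 * (‖X.1‖ * B) * M ≤ α / 2 * ‖X.1‖ ^ 2 + 2 * M ^ 2 * B ^ 2 / α := by
      have : 0 ≤ (α * ‖X.1‖ - 2 * M * B) ^ 2 / (2 * α) := by positivity
      have h7 : (α * ‖X.1‖ - 2 * M * B) ^ 2 / (2 * α)
          = α / 2 * ‖X.1‖ ^ 2 + 2 * M ^ 2 * B ^ 2 / α - 2 * (‖X.1‖ * B) * M := by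
        field_simp
        ring
      linarith
    have e7 : α * (‖X.1‖ ^ 2 + X.2 ^ 2) ≤ w.re * (‖X.1‖ ^ 2 + X.2 ^ 2) := by gcongr
    nlinarith [sq_nonneg X.2]
  have h8 : gauss a q' b X = q' ^ (-((d / 2 : ℝ) : ℂ)) * q' ^ (-(((a + 1) / 2 : ℝ) : ℂ))
      * Complex.exp (-(∑ i, ((X.1 i : ℂ) - b i) ^ 2) / q' + -(X.2 : ℂ) ^ 2 / q') := by
    rw [gauss, gaussX, gaussZ, Complex.exp_add]
    ring
  rw [h8, norm_mul, norm_mul, Complex.norm_exp]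
  calc _ ≤ q.re ^ (-(d / 2 : ℝ)) * q.re ^ (-((a + 1) / 2))
        * Real.exp (-(α / 2) * (‖X.1‖ ^ 2 + X.2 ^ 2) + (2 * M ^ 2 * B ^ 2 / α + M * B2)) := by
        gcongr
        · exact hpow _ (by positivity)
        · exact hpow _ (by linarith)
    _ = _ := by rw [Real.exp_add]; ring

lemma isRapid_gauss {d : ℕ} {a : ℝ} (ha : -1 < a) {q : ℂ} (hq : 0 < q.re) (b : Fin d → ℂ) :
    IsRapid a (gauss a q b) := by
  obtain ⟨C, ρ, hC, hρ, h⟩ := exists_norm_gauss_le ha hq b le_rfl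
  exact isRapid_of_le_exp (continuous_gauss a q b).aestronglyMeasurable hC hρ
    fun X _ => by simpa using h 0 (by simp) X

/-! ### Gaussians separate functions -/

/-- For a suitable Gaussian, the integrand of the characteristic function on the graph of
`X ↦ |X|²` is, up to a constant factor, the Gaussian times `e ^ {|X|²}`. -/
lemma exists_gauss_eq_char {d : ℕ} (a : ℝ) (L : StrongDual ℝ (Pt d)) :
    ∃ (q : ℂ) (b : Fin d → ℂ) (K : ℂ), 0 < q.re ∧ ∀ X : Pt d,
      (Real.exp (-(‖X.1‖ ^ 2 + X.2 ^ 2)) : ℂ)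
        * Complex.exp (L (X.1, ‖X.1‖ ^ 2 + X.2 ^ 2) * Complex.I) = K * gauss a q b X := by
  let c : ℝ := L (0, 1)
  let β : Fin d → ℝ := fun i => L (EuclideanSpace.single i 1, 0)
  let p : ℂ := 1 - Complex.I * c
  have hp : 0 < p.re := by simp [p]
  have hp0 := ne_zero_of_re_pos hp
  let q : ℂ := p⁻¹
  have hq : 0 < q.re := re_inv_pos hp
  have hq0 := ne_zero_of_re_pos hq
  let b : Fin d → ℂ := fun i => Complex.I * β i * q / 2
  have hL : ∀ x : EuclideanSpace ℝ (Fin d), ∀ w : ℝ, L (x, w) = ∑ i, x i * β i + w * c := by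
    intro x w
    have h1 : (x, w) = (∑ i, x i • ((EuclideanSpace.single i (1 : ℝ), (0 : ℝ)) : Pt d))
        + w • ((0, 1) : Pt d) := by
      ext i
      · simp [Prod.fst_sum, WithLp.ofLp_sum, Finset.sum_apply, Pi.single_apply]
      · simp [Prod.snd_sum]
    rw [h1, map_add, map_sum, map_smul]
    simp only [map_smul, smul_eq_mul]
    rfl
  let N : ℂ := q ^ (-((d / 2 : ℝ) : ℂ)) * q ^ (-(((a + 1) / 2 : ℝ) : ℂ))
  have hN : N ≠ 0 := by simp [N, Complex.cpow_eq_zero_iff, hq0]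
  refine ⟨q, b, N⁻¹ * Complex.exp ((∑ i, b i ^ 2) * p), hq, fun X => ?_⟩
  have h8 : gauss a q b X
      = N * Complex.exp (-(∑ i, ((X.1 i : ℂ) - b i) ^ 2) / q + -(X.2 : ℂ) ^ 2 / q) := by
    rw [gauss, gaussX, gaussZ, Complex.exp_add]
    ring
  rw [h8, show N⁻¹ * Complex.exp ((∑ i, b i ^ 2) * p)
      * (N * Complex.exp (-(∑ i, ((X.1 i : ℂ) - b i) ^ 2) / q + -(X.2 : ℂ) ^ 2 / q))
      = Complex.exp ((∑ i, b i ^ 2) * p)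
        * Complex.exp (-(∑ i, ((X.1 i : ℂ) - b i) ^ 2) / q + -(X.2 : ℂ) ^ 2 / q) by
      field_simp, ← Complex.exp_add, Complex.ofReal_exp, ← Complex.exp_add, hL,
    EuclideanSpace.norm_sq_eq]
  congr 1
  have h9 : ∀ i, ((X.1 i : ℂ) - b i) ^ 2
      = (X.1 i : ℂ) ^ 2 - Complex.I * q * ((X.1 i : ℂ) * β i) + b i ^ 2 := fun i => by
    simp only [b]; ring
  simp_rw [h9]
  rw [Finset.sum_add_distrib, Finset.sum_sub_distrib, ← Finset.mul_sum]
  simp only [Real.norm_eq_abs, sq_abs]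
  push_cast
  have hqp : q⁻¹ = p := inv_inv p
  rw [div_eq_mul_inv, div_eq_mul_inv, hqp]
  have hqp' : q * p = 1 := inv_mul_cancel₀ hp0
  have hpc : p = 1 - Complex.I * c := rfl
  linear_combination (-((∑ i, (X.1 i : ℂ) ^ 2) + (X.2 : ℂ) ^ 2)) * hpc.symm
    - Complex.I * (∑ i, (X.1 i : ℂ) * β i) * hqp'

lemma ae_eq_zero_of_forall_gauss_real {d : ℕ} {a : ℝ} {f : Pt d → ℝ}
    (hf : Integrable (fun X => f X * Real.exp (-(‖X.1‖ ^ 2 + X.2 ^ 2))) (omega d a))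
    (h : ∀ (q : ℂ) (b : Fin d → ℂ), 0 < q.re → ∫ X, (f X : ℂ) * gauss a q b X ∂(omega d a) = 0) :
    f =ᵐ[omega d a] 0 := by
  -- `μ₁` and `μ₂` are the positive and the negative part of the signed measure `φ dω`.
  let φ : Pt d → ℝ := fun X => f X * Real.exp (-(‖X.1‖ ^ 2 + X.2 ^ 2))
  let μ₁ := (omega d a).withDensity fun X => ENNReal.ofReal (φ X)
  let μ₂ := (omega d a).withDensity fun X => ENNReal.ofReal (-φ X)
  have : IsFiniteMeasure μ₁ := isFiniteMeasure_withDensity_ofReal hf.2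
  have : IsFiniteMeasure μ₂ := isFiniteMeasure_withDensity_ofReal hf.neg.2
  have hm₁ : AEMeasurable (fun X => ENNReal.ofReal (φ X)) (omega d a) :=
    hf.aestronglyMeasurable.aemeasurable.ennreal_ofReal
  have hm₂ : AEMeasurable (fun X => ENNReal.ofReal (-φ X)) (omega d a) :=
    hf.aestronglyMeasurable.aemeasurable.neg.ennreal_ofReal
  -- The graph map recovers `X` from `(x, |X|²)` on the half-space, so nothing is lost by pushing
  -- the measures forward along it.
  let ι : Pt d → Pt d := fun X => (X.1, ‖X.1‖ ^ 2 + X.2 ^ 2)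
  let κ : Pt d → Pt d := fun X => (X.1, Real.sqrt (X.2 - ‖X.1‖ ^ 2))
  have hι : Measurable ι := by fun_prop
  have hκ : Measurable κ := by fun_prop
  have hκι : ∀ μ : Measure (Pt d), μ ≪ omega d a → (μ.map ι).map κ = μ := by
    intro μ hμ
    rw [Measure.map_map hκ hι]
    conv_rhs => rw [← Measure.map_id (μ := μ)]
    refine Measure.map_congr ?_
    filter_upwards [hμ.ae_le (ae_omega_pos d a)] with X hX
    simp [κ, ι, Real.sqrt_sq hX.le]
  have hmap : μ₁.map ι = μ₂.map ι := by
    refine Measure.ext_of_charFunDual ?_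
    ext L
    rw [charFunDual_apply, charFunDual_apply, integral_map hι.aemeasurable (by fun_prop),
      integral_map hι.aemeasurable (by fun_prop),
      integral_withDensity_eq_integral_toReal_smul₀ hm₁
        (ae_of_all _ fun _ => ENNReal.ofReal_lt_top),
      integral_withDensity_eq_integral_toReal_smul₀ hm₂
        (ae_of_all _ fun _ => ENNReal.ofReal_lt_top),
      ← sub_eq_zero, ← integral_sub]
    · obtain ⟨q, b, K, hq, hK⟩ := exists_gauss_eq_char a L
      calc _ = ∫ X, K * ((f X : ℂ) * gauss a q b X) ∂(omega d a) := by
            refine integral_congr_ae (ae_of_all _ fun X => ?_)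
            dsimp only
            rw [mul_left_comm, ← hK X, ← sub_smul, ENNReal.toReal_ofReal', ENNReal.toReal_ofReal']
            have : max (φ X) 0 - max (-φ X) 0 = φ X := by
              rcases le_total 0 (φ X) with h0 | h0
              · rw [max_eq_left h0, max_eq_right (by linarith), sub_zero]
              · rw [max_eq_right h0, max_eq_left (by linarith)]; ring
            rw [this, Complex.real_smul]
            simp only [φ, ι]
            push_cast
            ring
        _ = 0 := by rw [integral_const_mul, h q b hq, mul_zero]
    all_goals
      refine Integrable.mono' hf.norm ?_ (ae_of_all _ fun X => ?_)
      · refine AEStronglyMeasurable.smul ?_ (Measurable.aestronglyMeasurable (by fun_prop))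
        first
        | exact Complex.continuous_ofReal.comp_aestronglyMeasurable
            hm₁.ennreal_toReal.aestronglyMeasurable
        | exact Complex.continuous_ofReal.comp_aestronglyMeasurable
            hm₂.ennreal_toReal.aestronglyMeasurable
      · rw [norm_smul, Complex.norm_exp_ofReal_mul_I, mul_one, ENNReal.toReal_ofReal',
          Real.norm_eq_abs, Real.norm_eq_abs, abs_of_nonneg (le_max_right _ _)]
        exact max_le (by first | exact le_abs_self _ | exact neg_le_abs _) (abs_nonneg _)
  have h12 : μ₁ = μ₂ := by
    rw [← hκι μ₁ (withDensity_absolutelyContinuous _ _),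
      ← hκι μ₂ (withDensity_absolutelyContinuous _ _), hmap]
  have hfin : ∫⁻ X, ENNReal.ofReal (φ X) ∂(omega d a) ≠ ⊤ := hf.lintegral_lt_top.ne
  have h3 := (withDensity_eq_iff hm₁ hm₂ hfin).mp h12
  filter_upwards [h3] with X hX
  have h4 : φ X = 0 := by
    rcases le_total 0 (φ X) with h0 | h0
    · rw [ENNReal.ofReal_of_nonpos (show -φ X ≤ 0 by linarith), ENNReal.ofReal_eq_zero] at hX
      linarith
    · rw [ENNReal.ofReal_of_nonpos h0, eq_comm, ENNReal.ofReal_eq_zero] at hX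
      linarith
  simpa [φ, Real.exp_ne_zero] using h4

lemma star_cpow_neg {q : ℂ} (hq : 0 < q.re) (c : ℝ) :
    (starRingEnd ℂ) (q ^ (-(c : ℂ))) = ((starRingEnd ℂ) q) ^ (-(c : ℂ)) := by
  have harg : q.arg ≠ Real.pi := by
    have := Complex.abs_arg_lt_pi_div_two_iff.mpr (Or.inl hq)
    intro h
    rw [h, abs_of_pos Real.pi_pos] at this
    linarith [Real.pi_pos]
  rw [← Complex.ofReal_neg, Complex.conj_cpow _ _ harg, Complex.conj_ofReal]

lemma star_gauss {d : ℕ} (a : ℝ) {q : ℂ} (hq : 0 < q.re) (b : Fin d → ℂ) (X : Pt d) :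
    (starRingEnd ℂ) (gauss a q b X)
      = gauss a ((starRingEnd ℂ) q) (fun i => (starRingEnd ℂ) (b i)) X := by
  simp only [gauss, gaussX, gaussZ, map_mul, star_cpow_neg hq, ← Complex.exp_conj, map_div₀,
    map_neg, map_pow, map_sum, map_sub, Complex.conj_ofReal]

/-- A function is determined by its integrals against Gaussians: these contain the characteristic
function of the measure `f e ^ {-|X|²} dω` transported by `X ↦ (x, |X|²)`. -/
lemma ae_eq_zero_of_forall_gauss {d : ℕ} {a : ℝ} {f : Pt d → ℂ}
    (hf : ∀ (q : ℂ) (b : Fin d → ℂ), 0 < q.re →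
      Integrable (fun X => f X * gauss a q b X) (omega d a))
    (h : ∀ (q : ℂ) (b : Fin d → ℂ), 0 < q.re → ∫ X, f X * gauss a q b X ∂(omega d a) = 0) :
    f =ᵐ[omega d a] 0 := by
  have hexp : Integrable (fun X => f X * Real.exp (-(‖X.1‖ ^ 2 + X.2 ^ 2))) (omega d a) := by
    obtain ⟨q, b, K, hq, hK⟩ := exists_gauss_eq_char (d := d) a 0
    refine ((hf q b hq).const_mul K).congr (ae_of_all _ fun X => ?_)
    have := hK X
    simp only [_root_.zero_apply, Complex.ofReal_zero, zero_mul, Complex.exp_zero,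
      mul_one] at this
    dsimp only
    rw [this]
    ring
  have hstar : ∀ (q : ℂ) (b : Fin d → ℂ), 0 < q.re →
      Integrable (fun X => (starRingEnd ℂ) (f X) * gauss a q b X) (omega d a) ∧
      ∫ X, (starRingEnd ℂ) (f X) * gauss a q b X ∂(omega d a) = 0 := by
    intro q b hq
    have hq' : 0 < ((starRingEnd ℂ) q).re := by simpa using hq
    have e : ∀ X, (starRingEnd ℂ) (f X) * gauss a q b X = (starRingEnd ℂ)
        (f X * gauss a ((starRingEnd ℂ) q) (fun i => (starRingEnd ℂ) (b i)) X) := by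
      intro X
      rw [map_mul, star_gauss a hq']
      simp
    simp_rw [e]
    refine ⟨?_, ?_⟩
    · exact Complex.conjLIE.toContinuousLinearEquiv.toContinuousLinearMap.integrable_comp
        (hf _ (fun i => (starRingEnd ℂ) (b i)) hq')
    · rw [integral_conj, h _ _ hq', map_zero]
  have hre : (fun X => (f X).re) =ᵐ[omega d a] 0 := by
    refine ae_eq_zero_of_forall_gauss_real ?_ fun q b hq => ?_
    · exact hexp.re.congr (ae_of_all _ fun X => Complex.re_mul_ofReal _ _)
    · have e : ∀ X, ((f X).re : ℂ) * gauss a q b X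
          = 1 / 2 * (f X * gauss a q b X + (starRingEnd ℂ) (f X) * gauss a q b X) := by
        intro X
        rw [Complex.re_eq_add_conj]
        ring
      simp_rw [e]
      rw [integral_const_mul, integral_add (hf q b hq) (hstar q b hq).1, h q b hq,
        (hstar q b hq).2]
      simp
  have him : (fun X => (f X).im) =ᵐ[omega d a] 0 := by
    refine ae_eq_zero_of_forall_gauss_real ?_ fun q b hq => ?_
    · exact hexp.im.congr (ae_of_all _ fun X => Complex.im_mul_ofReal _ _)
    · have e : ∀ X, ((f X).im : ℂ) * gauss a q b X
          = 1 / (2 * Complex.I)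
            * (f X * gauss a q b X - (starRingEnd ℂ) (f X) * gauss a q b X) := by
        intro X
        rw [Complex.im_eq_sub_conj]
        ring
      simp_rw [e]
      rw [integral_const_mul, integral_sub (hf q b hq) (hstar q b hq).1, h q b hq,
        (hstar q b hq).2]
      simp
  filter_upwards [hre, him] with X h1 h2
  exact Complex.ext h1 h2

/-! ### The group -/

/-- Parameters `(q, b)` of a Gaussian: a width in the right half-plane and a complex centre. -/
abbrev GaussParam (d : ℕ) : Type := {q : ℂ // 0 < q.re} × (Fin d → ℂ)

/-- The Schrödinger flow on the parameters: the centre is fixed, the width moves vertically. -/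
def shift {d : ℕ} (t : ℝ) (p : GaussParam d) : GaussParam d :=
  (⟨p.1 + 4 * Complex.I * t, by simpa using p.1.2⟩, p.2)

/-- The parameters of the complex conjugate Gaussian. -/
def conjParam {d : ℕ} (p : GaussParam d) : GaussParam d :=
  (⟨(starRingEnd ℂ) p.1, by simpa using p.1.2⟩, fun i => (starRingEnd ℂ) (p.2 i))

lemma conjParam_conjParam {d : ℕ} (p : GaussParam d) : conjParam (conjParam p) = p := by
  simp [conjParam]

lemma shift_zero {d : ℕ} (p : GaussParam d) : shift 0 p = p := by
  simp [shift]

lemma shift_shift {d : ℕ} (s t : ℝ) (p : GaussParam d) : shift s (shift t p) = shift (s + t) p := by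
  simp only [shift, Prod.mk.injEq, and_true, Subtype.mk.injEq]
  push_cast
  ring

lemma conjParam_shift {d : ℕ} (t : ℝ) (p : GaussParam d) :
    conjParam (shift t p) = shift (-t) (conjParam p) := by
  have h4 : (starRingEnd ℂ) 4 = 4 := Complex.conj_ofNat 4
  simp [conjParam, shift, h4]

/-- The Gaussian with parameters `p`. -/
abbrev gaussP {d : ℕ} (a : ℝ) (p : GaussParam d) : Pt d → ℂ := gauss a p.1 p.2

lemma star_gaussP {d : ℕ} (a : ℝ) (p : GaussParam d) (X : Pt d) :
    (starRingEnd ℂ) (gaussP a p X) = gaussP a (conjParam p) X := star_gauss a p.1.2 p.2 X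

/-- The bilinear pairing of a function with a Gaussian. -/
def pair {d : ℕ} {a : ℝ} (f : Pt d → ℂ) (p : GaussParam d) : ℂ :=
  ∫ X, f X * gaussP a p X ∂(omega d a)

section Group

variable {d : ℕ} {a : ℝ} (ha : -1 < a) (ha' : a < 1)

include ha ha' in
lemma memLp_gaussP (p : GaussParam d) : MemLp (gaussP a p) 2 (omega d a) :=
  (isRapid_gauss ha p.1.2 p.2).memLp ha ha'

/-- A Gaussian as an element of `L²_a`. -/
def gaussL2 (p : GaussParam d) : L2 d a := (memLp_gaussP ha ha' p).toLp

lemma coeFn_gaussL2 (p : GaussParam d) : gaussL2 ha ha' p =ᵐ[omega d a] gaussP a p :=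
  MemLp.coeFn_toLp _

lemma inner_gaussL2 (p : GaussParam d) (v : L2 d a) :
    inner ℂ (gaussL2 ha ha' p) v = pair (a := a) v (conjParam p) := by
  rw [L2.inner_def, pair]
  refine integral_congr_ae ?_
  filter_upwards [coeFn_gaussL2 ha ha' p] with X hX
  rw [hX, RCLike.inner_apply, ← star_gaussP]

lemma pair_eq_inner (p : GaussParam d) (v : L2 d a) :
    pair (a := a) v p = inner ℂ (gaussL2 ha ha' (conjParam p)) v := by
  rw [inner_gaussL2, conjParam_conjParam]

include ha ha' in
lemma integrable_mul_gaussP {f : Pt d → ℂ} (hf : MemLp f 2 (omega d a)) (p : GaussParam d) :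
    Integrable (fun X => f X * gaussP a p X) (omega d a) :=
  hf.integrable_mul (memLp_gaussP ha ha' p)

include ha ha' in
lemma eq_of_forall_pair {v w : L2 d a}
    (h : ∀ p : GaussParam d, pair (a := a) v p = pair (a := a) w p) : v = w := by
  have h0 : v - w =ᵐ[omega d a] 0 := by
    refine ae_eq_zero_of_forall_gauss (fun q b hq => ?_) fun q b hq => ?_
    · exact integrable_mul_gaussP ha ha' (Lp.memLp _) (⟨q, hq⟩, b)
    · have h1 := h (⟨q, hq⟩, b)
      rw [pair_eq_inner ha ha', pair_eq_inner ha ha', ← sub_eq_zero, ← inner_sub_right,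
        ← pair_eq_inner] at h1
      exact h1
  rw [← sub_eq_zero]
  exact Lp.ext (h0.trans (Lp.coeFn_zero _ _ _).symm)

lemma gram_shift (t : ℝ) (p p' : GaussParam d) :
    inner ℂ (gaussL2 ha ha' (shift t p)) (gaussL2 ha ha' (shift t p'))
      = (inner ℂ (gaussL2 ha ha' p) (gaussL2 ha ha' p') : ℂ) := by
  have h : ∀ p p' : GaussParam d, (inner ℂ (gaussL2 ha ha' p) (gaussL2 ha ha' p') : ℂ)
      = ∫ X, gaussP a (conjParam p) X * gaussP a p' X ∂(omega d a) := by
    intro p p'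
    rw [inner_gaussL2, pair]
    refine integral_congr_ae ?_
    filter_upwards [coeFn_gaussL2 ha ha' p'] with X hX
    rw [hX, mul_comm]
  rw [h, h, integral_gauss_mul ha (conjParam (shift t p)).1.2 (shift t p').1.2,
    integral_gauss_mul ha (conjParam p).1.2 p'.1.2]
  have e : ((conjParam (shift t p)).1 : ℂ) + (shift t p').1 = (conjParam p).1 + p'.1 := by
    have h4 : (starRingEnd ℂ) 4 = 4 := Complex.conj_ofNat 4
    simp [conjParam, shift, h4]
    ring
  rw [e]
  rfl

/-- Finite linear combinations of Gaussians. -/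
def gaussComb : (GaussParam d →₀ ℂ) →ₗ[ℂ] L2 d a := Finsupp.linearCombination ℂ (gaussL2 ha ha')

/-- Finite linear combinations of Gaussians, evolved for the time `t`. -/
def gaussCombShift (t : ℝ) : (GaussParam d →₀ ℂ) →ₗ[ℂ] L2 d a :=
  Finsupp.linearCombination ℂ fun p => gaussL2 ha ha' (shift t p)

lemma norm_gaussCombShift (t : ℝ) (x : GaussParam d →₀ ℂ) :
    ‖gaussCombShift ha ha' t x‖ = ‖gaussComb ha ha' x‖ := by
  have h : (inner ℂ (gaussCombShift ha ha' t x) (gaussCombShift ha ha' t x) : ℂ)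
      = inner ℂ (gaussComb ha ha' x) (gaussComb ha ha' x) := by
    simp only [gaussCombShift, gaussComb, Finsupp.linearCombination_apply, Finsupp.sum, sum_inner,
      inner_sum, inner_smul_left, inner_smul_right, gram_shift]
  rw [@norm_eq_sqrt_re_inner ℂ, @norm_eq_sqrt_re_inner ℂ, h]

lemma denseRange_gaussComb : DenseRange (gaussComb (d := d) ha ha') := by
  have h : (LinearMap.range (gaussComb (d := d) ha ha')).topologicalClosure = ⊤ := by
    rw [Submodule.topologicalClosure_eq_top_iff, Submodule.eq_bot_iff]
    intro v hv
    refine eq_of_forall_pair ha ha' fun p => ?_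
    rw [pair_eq_inner ha ha', pair_eq_inner ha ha', inner_zero_right]
    refine (Submodule.mem_orthogonal _ _).mp hv _ ⟨Finsupp.single (conjParam p) 1, ?_⟩
    simp [gaussComb]
  rw [DenseRange, ← LinearMap.coe_range]
  exact Submodule.dense_iff_topologicalClosure_eq_top.mpr h

/-- The Schrödinger group, as the isometric extension of the flow of the Gaussians. -/
def evol (t : ℝ) : L2 d a →L[ℂ] L2 d a :=
  (gaussCombShift ha ha' t).extendOfNorm (gaussComb ha ha')

lemma evol_gaussComb (t : ℝ) (x : GaussParam d →₀ ℂ) :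
    evol ha ha' t (gaussComb ha ha' x) = gaussCombShift ha ha' t x :=
  LinearMap.extendOfNorm_eq (denseRange_gaussComb ha ha')
    ⟨1, fun x => by rw [one_mul, norm_gaussCombShift]⟩ x

lemma evol_gaussL2 (t : ℝ) (p : GaussParam d) :
    evol ha ha' t (gaussL2 ha ha' p) = gaussL2 ha ha' (shift t p) := by
  simpa [gaussComb, gaussCombShift] using evol_gaussComb ha ha' t (Finsupp.single p 1)

lemma ext_gaussL2 {E : Type*} [NormedAddCommGroup E] [NormedSpace ℂ E] {A B : L2 d a →L[ℂ] E}
    (h : ∀ p, A (gaussL2 ha ha' p) = B (gaussL2 ha ha' p)) : A = B := by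
  refine DFunLike.coe_injective ((denseRange_gaussComb ha ha').equalizer
    A.continuous B.continuous ?_)
  ext x
  simp [gaussComb, Finsupp.linearCombination_apply, Finsupp.sum, h]

lemma evol_zero : evol ha ha' 0 = ContinuousLinearMap.id ℂ (L2 d a) :=
  ext_gaussL2 ha ha' fun p => by rw [evol_gaussL2, shift_zero]; rfl

lemma evol_add (s t : ℝ) : evol (d := d) ha ha' (s + t) = (evol ha ha' s).comp (evol ha ha' t) :=
  ext_gaussL2 ha ha' fun p => by
    rw [ContinuousLinearMap.comp_apply, evol_gaussL2, evol_gaussL2, evol_gaussL2, shift_shift]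

lemma norm_evol (t : ℝ) (v : L2 d a) : ‖evol ha ha' t v‖ = ‖v‖ := by
  have h := (denseRange_gaussComb (d := d) ha ha').equalizer
    (evol ha ha' t).continuous.norm continuous_norm (by
      ext x
      simp only [Function.comp_apply, evol_gaussComb, norm_gaussCombShift])
  exact congr_fun h v

/-- The group is symmetric for the bilinear pairing. -/
lemma pair_evol (t : ℝ) (v : L2 d a) (p : GaussParam d) :
    pair (a := a) (evol ha ha' t v) p = pair (a := a) v (shift t p) := by
  let U : L2 d a →ₗᵢ[ℂ] L2 d a := ⟨(evol ha ha' t).toLinearMap, norm_evol ha ha' t⟩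
  have h := U.inner_map_map (gaussL2 ha ha' (conjParam (shift t p))) v
  have e : U (gaussL2 ha ha' (conjParam (shift t p))) = gaussL2 ha ha' (conjParam p) := by
    change evol ha ha' t _ = _
    rw [evol_gaussL2, conjParam_shift, shift_shift, add_neg_cancel, shift_zero]
  rw [e] at h
  rw [pair_eq_inner ha ha', pair_eq_inner ha ha']
  exact h

lemma continuous_gaussL2_shift (p : GaussParam d) :
    Continuous fun t => gaussL2 ha ha' (shift t p) := by
  let G : ℝ → ℂ := fun r => inner ℂ (gaussL2 ha ha' p) (gaussL2 ha ha' (shift r p))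
  have hG : Continuous G := by
    have e : G = fun r : ℝ => ∫ X, gauss a (conjParam p).1 (conjParam p).2 X
        * gauss a (p.1 + 4 * Complex.I * r) p.2 X ∂(omega d a) := by
      ext r
      simp only [G]
      rw [inner_gaussL2, pair]
      refine integral_congr_ae ?_
      filter_upwards [coeFn_gaussL2 ha ha' (shift r p)] with X hX
      rw [hX, mul_comm]
      rfl
    rw [e]
    have hre : ∀ r : ℝ, 0 < (((conjParam p).1 : ℂ) + (p.1 + 4 * Complex.I * r)).re := fun r => by
      simpa using add_pos (conjParam p).1.2 p.1.2
    have e2 : ∀ r : ℝ, _ := fun r => integral_gauss_mul ha (conjParam p).1.2 (shift r p).1.2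
      (conjParam p).2 p.2
    have e3 : ∀ r : ℝ, ((shift r p).1 : ℂ) = p.1 + 4 * Complex.I * r := fun r => rfl
    simp_rw [e3] at e2
    simp_rw [e2]
    have hc : Continuous fun r : ℝ => ((conjParam p).1 : ℂ) + (p.1 + 4 * Complex.I * r) := by
      fun_prop
    have hpow : ∀ c : ℂ, Continuous fun r : ℝ =>
        (((conjParam p).1 : ℂ) + (p.1 + 4 * Complex.I * r)) ^ c := fun c =>
      hc.cpow continuous_const fun r => Or.inl (hre r)
    exact continuous_const.mul (((hpow _).mul (hpow _)).mul (Complex.continuous_exp.comp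
      (continuous_const.div hc fun r => ne_zero_of_re_pos (hre r))))
  have hn : ∀ s t : ℝ, ‖gaussL2 ha ha' (shift t p) - gaussL2 ha ha' (shift s p)‖ ^ 2
      = 2 * ‖gaussL2 ha ha' p‖ ^ 2 - 2 * (G (t - s)).re := by
    intro s t
    rw [@norm_sub_sq ℂ, ← evol_gaussL2, ← evol_gaussL2 ha ha' s, norm_evol, norm_evol,
      evol_gaussL2, evol_gaussL2, ← gram_shift ha ha' (-s), shift_shift, shift_shift,
      neg_add_cancel,
      shift_zero, ← inner_conj_symm, RCLike.conj_re, neg_add_eq_sub]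
    simp only [G, RCLike.re_to_complex]
    ring
  refine continuous_iff_continuousAt.mpr fun s => ?_
  rw [ContinuousAt, tendsto_iff_norm_sub_tendsto_zero]
  have h1 : Tendsto (fun t => Real.sqrt (2 * ‖gaussL2 ha ha' p‖ ^ 2 - 2 * (G (t - s)).re)) (𝓝 s)
      (𝓝 (Real.sqrt (2 * ‖gaussL2 ha ha' p‖ ^ 2 - 2 * (G (s - s)).re))) := by
    refine Continuous.tendsto ?_ s
    have := Complex.continuous_re.comp (hG.comp (continuous_sub_right s))
    exact Real.continuous_sqrt.comp (continuous_const.sub (continuous_const.mul this))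
  rw [← hn, sub_self, norm_zero] at h1
  simp_rw [← hn, Real.sqrt_sq (norm_nonneg _)] at h1
  simpa using h1

lemma continuous_evol (v : L2 d a) : Continuous fun t => evol ha ha' t v := by
  have hK : ∀ x : GaussParam d →₀ ℂ, Continuous fun t => evol ha ha' t (gaussComb ha ha' x) := by
    intro x
    simp_rw [evol_gaussComb]
    simp only [gaussCombShift, Finsupp.linearCombination_apply, Finsupp.sum]
    exact continuous_finsetSum _ fun p _ => (continuous_const_smul (x p)).comp
      (continuous_gaussL2_shift ha ha' p)
  rw [Metric.continuous_iff]
  intro t ε hε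
  obtain ⟨x, hx⟩ := (denseRange_gaussComb ha ha').exists_dist_lt v (show 0 < ε / 3 by positivity)
  obtain ⟨δ, hδ, h⟩ := Metric.continuous_iff.mp (hK x) t (ε / 3) (by positivity)
  have hd : ∀ s, dist (evol ha ha' s v) (evol ha ha' s (gaussComb ha ha' x)) < ε / 3 := fun s => by
    rw [dist_eq_norm, ← map_sub, norm_evol, ← dist_eq_norm]
    exact hx
  refine ⟨δ, hδ, fun s hs => ?_⟩
  have h1 := h s hs
  have h2 := dist_triangle4 (evol ha ha' s v) (evol ha ha' s (gaussComb ha ha' x))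
    (evol ha ha' t (gaussComb ha ha' x)) (evol ha ha' t v)
  have h3 := hd s
  have h4 := hd t
  rw [dist_comm] at h4
  linarith

end Group

/-! ### Gaussians as Schwartz functions -/

lemma iteratedFDeriv_cexp (n : ℕ) (w : ℂ) :
    iteratedFDeriv ℝ n Complex.exp w = Complex.exp w • iteratedFDeriv ℝ n Complex.exp 0 := by
  have h1 := iteratedFDeriv_comp_add_left (𝕜 := ℝ) (f := Complex.exp) n w 0
  rw [add_zero] at h1
  rw [← h1]
  have h2 : (fun z => Complex.exp (w + z)) = Complex.exp w • Complex.exp := by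
    ext z
    simp [Complex.exp_add]
  rw [h2, iteratedFDeriv_const_smul_apply (Complex.contDiff_exp.contDiffAt)]

/-- The exponential of a function of temperate growth is a Schwartz function as soon as it decays
rapidly itself. -/
def expSchwartz {E : Type*} [NormedAddCommGroup E] [NormedSpace ℝ E] (Q : E → ℂ)
    (hQ : Q.HasTemperateGrowth)
    (h : ∀ N : ℕ, ∃ C, ∀ X, (1 + ‖X‖) ^ N * ‖Complex.exp (Q X)‖ ≤ C) : 𝓢(E, ℂ) where
  toFun X := Complex.exp (Q X)
  smooth' := Complex.contDiff_exp.comp hQ.1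
  decay' := by
    intro k n
    obtain ⟨l, C, hC, hl⟩ := hQ.norm_iteratedFDeriv_le_uniform n
    obtain ⟨D, hD⟩ := h (k + l * n)
    let M : ℝ := ∑ i ∈ Finset.range (n + 1), ‖iteratedFDeriv ℝ i Complex.exp 0‖
    have hM : ∀ i, i ≤ n → ‖iteratedFDeriv ℝ i Complex.exp 0‖ ≤ M := fun i hi =>
      Finset.single_le_sum (f := fun i => ‖iteratedFDeriv ℝ i Complex.exp 0‖)
        (fun _ _ => norm_nonneg _) (Finset.mem_range.mpr (by omega))
    refine ⟨n.factorial * M * (C + 1) ^ n * D, fun X => ?_⟩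
    have hb := norm_iteratedFDeriv_comp_le (𝕜 := ℝ) (g := Complex.exp) (f := Q) (n := n) (N := ∞)
      Complex.contDiff_exp hQ.1 (by exact_mod_cast le_top) X
      (C := ‖Complex.exp (Q X)‖ * M) (D := (C + 1) * (1 + ‖X‖) ^ l) ?_ ?_
    · have hM0 : 0 ≤ M := by positivity
      have h1 : ‖X‖ ≤ 1 + ‖X‖ := by linarith
      calc ‖X‖ ^ k * ‖iteratedFDeriv ℝ n (fun X => Complex.exp (Q X)) X‖
          ≤ (1 + ‖X‖) ^ k * (n.factorial * (‖Complex.exp (Q X)‖ * M)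
            * ((C + 1) * (1 + ‖X‖) ^ l) ^ n) := by
            gcongr
            exact hb
        _ = n.factorial * M * (C + 1) ^ n * ((1 + ‖X‖) ^ (k + l * n) * ‖Complex.exp (Q X)‖) := by
            rw [mul_pow, ← pow_mul, pow_add]; ring
        _ ≤ _ := by gcongr; exact hD X
    · intro i hi
      rw [iteratedFDeriv_cexp, norm_smul]
      gcongr
      exact hM i hi
    · intro i hi1 hi
      have h1 : 1 ≤ (C + 1) * (1 + ‖X‖) ^ l := by
        have : 1 ≤ (1 + ‖X‖) ^ l := one_le_pow₀ (by linarith [norm_nonneg X])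
        nlinarith
      calc _ ≤ C * (1 + ‖X‖) ^ l := hl i hi X
        _ ≤ (C + 1) * (1 + ‖X‖) ^ l := by gcongr; linarith
        _ ≤ _ := le_self_pow₀ h1 (by omega)

/-- The exponent of a Gaussian. -/
def gaussExponent {d : ℕ} (q : ℂ) (b : Fin d → ℂ) (X : Pt d) : ℂ :=
  (∑ i, ((X.1 i : ℂ) - b i) ^ 2 + (X.2 : ℂ) ^ 2) * (-q⁻¹)

lemma gaussExponent_hasTemperateGrowth {d : ℕ} (q : ℂ) (b : Fin d → ℂ) :
    (gaussExponent q b).HasTemperateGrowth := by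
  have h1 : ∀ i, (fun X : Pt d => (X.1 i : ℂ)).HasTemperateGrowth := fun i =>
    (Complex.ofRealCLM.comp ((EuclideanSpace.proj i : EuclideanSpace ℝ (Fin d) →L[ℝ] ℝ).comp
      (ContinuousLinearMap.fst ℝ _ ℝ))).hasTemperateGrowth
  have h2 : (fun X : Pt d => (X.2 : ℂ)).HasTemperateGrowth :=
    (Complex.ofRealCLM.comp
      (ContinuousLinearMap.snd ℝ (EuclideanSpace ℝ (Fin d)) ℝ)).hasTemperateGrowth
  unfold gaussExponent
  fun_prop

lemma gaussP_eq_exp {d : ℕ} (a : ℝ) (p : GaussParam d) (X : Pt d) :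
    gaussP a p X = ((p.1 : ℂ) ^ (-((d / 2 : ℝ) : ℂ)) * (p.1 : ℂ) ^ (-(((a + 1) / 2 : ℝ) : ℂ)))
      * Complex.exp (gaussExponent p.1 p.2 X) := by
  rw [gaussP, gauss, gaussX, gaussZ, gaussExponent,
    show (∑ i, ((X.1 i : ℂ) - p.2 i) ^ 2 + (X.2 : ℂ) ^ 2) * (-(p.1 : ℂ)⁻¹)
      = -(∑ i, ((X.1 i : ℂ) - p.2 i) ^ 2) / p.1 + -(X.2 : ℂ) ^ 2 / p.1 by ring, Complex.exp_add]
  ring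

lemma gaussP_factor_ne_zero {d : ℕ} (a : ℝ) (p : GaussParam d) :
    (p.1 : ℂ) ^ (-((d / 2 : ℝ) : ℂ)) * (p.1 : ℂ) ^ (-(((a + 1) / 2 : ℝ) : ℂ)) ≠ 0 := by
  simp [Complex.cpow_eq_zero_iff, ne_zero_of_re_pos p.1.2]

/-- A Gaussian as a Schwartz function on the whole space; it is even in `z`. -/
def gaussS {d : ℕ} {a : ℝ} (ha : -1 < a) (p : GaussParam d) : 𝓢(Pt d, ℂ) :=
  ((p.1 : ℂ) ^ (-((d / 2 : ℝ) : ℂ)) * (p.1 : ℂ) ^ (-(((a + 1) / 2 : ℝ) : ℂ))) •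
    expSchwartz (gaussExponent p.1 p.2) (gaussExponent_hasTemperateGrowth _ _) (by
      intro N
      obtain ⟨C, ρ, hC, hρ, h⟩ := exists_norm_gauss_le ha p.1.2 p.2 le_rfl
      obtain ⟨D, hD, h'⟩ := exists_one_add_norm_pow_mul_exp_le (d := d) N hρ
      set K := (p.1 : ℂ) ^ (-((d / 2 : ℝ) : ℂ)) * (p.1 : ℂ) ^ (-(((a + 1) / 2 : ℝ) : ℂ)) with hK
      have hK0 : 0 < ‖K‖ := norm_pos_iff.mpr (gaussP_factor_ne_zero a p)
      refine ⟨‖K‖⁻¹ * (C * D), fun X => ?_⟩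
      have h1 := h 0 (by simp) X
      rw [Complex.ofReal_zero, mul_zero, add_zero] at h1
      have h2 := gaussP_eq_exp a p X
      rw [← hK] at h2
      rw [gaussP] at h2
      rw [h2, norm_mul] at h1
      rw [inv_mul_eq_div, le_div_iff₀ hK0]
      calc _ = (1 + ‖X‖) ^ N * (‖K‖ * ‖Complex.exp (gaussExponent p.1 p.2 X)‖) := by ring
        _ ≤ (1 + ‖X‖) ^ N * (C * Real.exp (-ρ * (‖X.1‖ ^ 2 + X.2 ^ 2))) := by gcongr
        _ = C * ((1 + ‖X‖) ^ N * Real.exp (-ρ * (‖X.1‖ ^ 2 + X.2 ^ 2))) := by ring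
        _ ≤ _ := by gcongr; exact h' X)

lemma gaussS_apply {d : ℕ} {a : ℝ} (ha : -1 < a) (p : GaussParam d) (X : Pt d) :
    gaussS ha p X = gaussP a p X := by
  rw [gaussP_eq_exp]
  rfl

lemma gaussS_even {d : ℕ} {a : ℝ} (ha : -1 < a) (p : GaussParam d) (x : EuclideanSpace ℝ (Fin d))
    (z : ℝ) : gaussS ha p (x, -z) = gaussS ha p (x, z) := by
  simp [gaussS_apply, gauss, gaussZ]

/-! ### The operator on Schwartz functions -/

/-- The normal derivative of a Schwartz function. -/
def dz {d : ℕ} (V : 𝓢(Pt d, ℂ)) : 𝓢(Pt d, ℂ) := LineDeriv.lineDerivOp ((0, 1) : Pt d) V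

/-- A tangential derivative of a Schwartz function. -/
def dx {d : ℕ} (i : Fin d) (V : 𝓢(Pt d, ℂ)) : 𝓢(Pt d, ℂ) :=
  LineDeriv.lineDerivOp ((EuclideanSpace.single i 1, 0) : Pt d) V

/-- The tangential Laplacian of a Schwartz function. -/
def lapX {d : ℕ} (V : 𝓢(Pt d, ℂ)) : 𝓢(Pt d, ℂ) := ∑ i, dx i (dx i V)

/-- The Bessel part of `halfOp` on a Schwartz function. -/
def besselS {d : ℕ} (a : ℝ) (V : 𝓢(Pt d, ℂ)) (X : Pt d) : ℂ :=
  dz (dz V) X + ((a / X.2 : ℝ) : ℂ) * dz V X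

lemma hasDerivAt_line {d : ℕ} (V : 𝓢(Pt d, ℂ)) (m X : Pt d) (s : ℝ) :
    HasDerivAt (fun s : ℝ => V (X + s • m)) (LineDeriv.lineDerivOp m V (X + s • m)) s := by
  rw [SchwartzMap.lineDerivOp_apply_eq_fderiv]
  have h1 : HasDerivAt (fun s : ℝ => X + s • m) m s := by
    simpa using ((hasDerivAt_id s).smul_const m).const_add X
  exact (V.hasFDerivAt _).comp_hasDerivAt s h1

lemma hasDerivAt_dz {d : ℕ} (V : 𝓢(Pt d, ℂ)) (x : EuclideanSpace ℝ (Fin d)) (z : ℝ) :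
    HasDerivAt (fun z => V (x, z)) (dz V (x, z)) z := by
  have h := hasDerivAt_line V (0, 1) (x, 0) z
  simpa [dz] using h

/-- The restriction of a Schwartz function to a horizontal slice. -/
def slice {d : ℕ} (z : ℝ) (V : 𝓢(Pt d, ℂ)) : 𝓢(EuclideanSpace ℝ (Fin d), ℂ) :=
  SchwartzMap.compCLMOfAntilipschitz (K := 1) (g := fun x => (x, z)) ℂ
    (by
      have h : (fun x : EuclideanSpace ℝ (Fin d) => (x, z)) = fun x =>
          ContinuousLinearMap.inl ℝ (EuclideanSpace ℝ (Fin d)) ℝ x + (0, z) := by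
        ext x <;> simp
      rw [h]
      fun_prop)
    (fun x y => by simp [Prod.edist_eq]) V

lemma slice_apply {d : ℕ} (z : ℝ) (V : 𝓢(Pt d, ℂ)) (x : EuclideanSpace ℝ (Fin d)) :
    slice z V x = V (x, z) := rfl

lemma lineDerivOp_slice {d : ℕ} (z : ℝ) (V : 𝓢(Pt d, ℂ)) (i : Fin d) :
    LineDeriv.lineDerivOp (EuclideanSpace.single i (1 : ℝ)) (slice z V) = slice z (dx i V) := by
  ext x
  rw [slice_apply, dx, SchwartzMap.lineDerivOp_apply, SchwartzMap.lineDerivOp_apply, lineDeriv,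
    lineDeriv]
  congr 1
  ext t
  simp [slice_apply]

lemma laplacian_slice {d : ℕ} (z : ℝ) (V : 𝓢(Pt d, ℂ)) :
    Laplacian.laplacian (slice z V) = slice z (lapX V) := by
  rw [SchwartzMap.laplacian_eq_sum (EuclideanSpace.basisFun (Fin d) ℝ)]
  ext x
  rw [slice_apply, lapX]
  simp only [EuclideanSpace.basisFun_apply, lineDerivOp_slice, _root_.sum_apply]
  rfl

lemma laplacian_eq_lapX {d : ℕ} (V : 𝓢(Pt d, ℂ)) (X : Pt d) :
    Laplacian.laplacian (fun x : EuclideanSpace ℝ (Fin d) => V (x, X.2)) X.1 = lapX V X := by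
  have h := SchwartzMap.laplacian_apply (slice X.2 V) X.1
  rw [laplacian_slice] at h
  exact h.symm

lemma halfOp_schwartz {d : ℕ} (a : ℝ) (V : 𝓢(Pt d, ℂ)) (X : Pt d) :
    halfOp a V X = lapX V X + besselS a V X := by
  have h1 : deriv (fun z => V (X.1, z)) = fun z => dz V (X.1, z) :=
    funext fun z => (hasDerivAt_dz V X.1 z).deriv
  rw [halfOp, laplacian_eq_lapX, besselOp, h1, (hasDerivAt_dz (dz V) X.1 X.2).deriv, besselS]

/-- An even Schwartz function has a normal derivative vanishing at the boundary; this compensates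
the singular coefficient of the Bessel operator. -/
lemma exists_norm_dz_le {d : ℕ} (V : 𝓢(Pt d, ℂ)) (hV : ∀ x z, V (x, -z) = V (x, z)) (N : ℕ) :
    ∃ C, 0 ≤ C ∧ ∀ X : Pt d, 0 < X.2 → ‖dz V X‖ ≤ C * X.2 * ((1 + ‖X‖) ^ N)⁻¹ := by
  have h0 : ∀ x, dz V (x, 0) = 0 := by
    intro x
    have h1 := hasDerivAt_dz V x 0
    have h2 : HasDerivAt (fun z => V (x, z)) (-dz V (x, 0)) 0 := by
      have h3 : HasDerivAt (fun z : ℝ => V (x, -z)) (-dz V (x, -0)) 0 := by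
        have := (hasDerivAt_dz V x (-0)).scomp (0 : ℝ) (hasDerivAt_neg (0 : ℝ))
        simpa [Function.comp_def] using this
      simpa [hV] using h3
    have h4 := h1.unique h2
    linear_combination h4 / 2
  obtain ⟨C, hC, h⟩ := (IsRapid.of_schwartz (a := 0) (dz V)).decay N
  obtain ⟨D, hD, h'⟩ := (IsRapid.of_schwartz (a := 0) (dz (dz V))).decay N
  refine ⟨C + D * 2 ^ N, by positivity, fun X hX => ?_⟩
  obtain ⟨x, z⟩ := X
  simp only at hX
  have hP : 0 ≤ ((1 + ‖((x, z) : Pt d)‖) ^ N)⁻¹ := by positivity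
  rcases le_total z 1 with hz | hz
  · have hx : (1 + ‖((x, z) : Pt d)‖) ≤ 2 * (1 + ‖x‖) := by
      have : ‖((x, z) : Pt d)‖ ≤ ‖x‖ + 1 := by
        rw [Prod.norm_def]
        refine max_le (by linarith) ?_
        rw [Real.norm_eq_abs, abs_of_pos hX]
        linarith [norm_nonneg x]
      linarith [norm_nonneg x]
    have hbd : ∀ y ∈ Ioc 0 z, ‖dz (dz V) (x, y)‖
        ≤ D * 2 ^ N * ((1 + ‖((x, z) : Pt d)‖) ^ N)⁻¹ := by
      intro y hy
      refine (h' (x, y) hy.1).trans ?_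
      rw [mul_assoc]
      gcongr
      rw [← div_eq_mul_inv, le_div_iff₀ (by positivity), inv_mul_le_iff₀ (by positivity), mul_comm,
        ← mul_pow]
      have : ‖x‖ ≤ ‖((x, y) : Pt d)‖ := norm_fst_le (x, y)
      gcongr
      linarith
    have h1 := fun y (hy : y ∈ Ioc 0 z) =>
      Convex.norm_image_sub_le_of_norm_hasDerivWithin_le (f := fun z => dz V (x, z))
      (f' := fun z => dz (dz V) (x, z)) (s := Ioc 0 z) (x := z) (C := D * 2 ^ N
        * ((1 + ‖((x, z) : Pt d)‖) ^ N)⁻¹)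
      (fun y _ => (hasDerivAt_dz (dz V) x y).hasDerivWithinAt) hbd (convex_Ioc _ _)
      (right_mem_Ioc.mpr hX) hy
    · have h2 : Tendsto (fun y => ‖dz V (x, y) - dz V (x, z)‖) (𝓝[>] 0)
          (𝓝 ‖dz V (x, 0) - dz V (x, z)‖) := by
        have : Continuous fun y : ℝ => ‖dz V (x, y) - dz V (x, z)‖ := by
          have := (dz V).continuous
          fun_prop
        exact this.continuousWithinAt
      have h3 : Tendsto (fun y => D * 2 ^ N * ((1 + ‖((x, z) : Pt d)‖) ^ N)⁻¹ * ‖y - z‖) (𝓝[>] 0)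
          (𝓝 (D * 2 ^ N * ((1 + ‖((x, z) : Pt d)‖) ^ N)⁻¹ * ‖0 - z‖)) := by
        have : Continuous fun y : ℝ => D * 2 ^ N * ((1 + ‖((x, z) : Pt d)‖) ^ N)⁻¹ * ‖y - z‖ := by
          fun_prop
        exact this.continuousWithinAt
      have h4 := le_of_tendsto_of_tendsto h2 h3 (by
        filter_upwards [Ioc_mem_nhdsGT hX] with y hy
        exact h1 y hy)
      rw [h0, zero_sub, zero_sub, norm_neg, norm_neg, Real.norm_eq_abs, abs_of_pos hX] at h4
      refine h4.trans ?_
      have : 0 ≤ C * z * ((1 + ‖((x, z) : Pt d)‖) ^ N)⁻¹ := by positivity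
      simp only
      nlinarith
  · refine (h (x, z) hX).trans ?_
    simp only
    gcongr
    nlinarith [show 0 ≤ D * 2 ^ N by positivity]

lemma isRapid_besselS {d : ℕ} (a : ℝ) (V : 𝓢(Pt d, ℂ)) (hV : ∀ x z, V (x, -z) = V (x, z)) :
    IsRapid a (besselS a V) := by
  refine (IsRapid.of_schwartz (dz (dz V))).add ⟨?_, fun N => ?_⟩
  · refine AEStronglyMeasurable.mul ?_ (dz V).continuous.aestronglyMeasurable
    have : Measurable fun X : Pt d => ((a / X.2 : ℝ) : ℂ) := by fun_prop
    exact this.aestronglyMeasurable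
  · obtain ⟨C, hC, h⟩ := exists_norm_dz_le V hV N
    refine ⟨|a| * C, by positivity, fun X hX => ?_⟩
    rw [norm_mul, Complex.norm_real, Real.norm_eq_abs, abs_div, abs_of_pos hX]
    calc _ ≤ |a| / X.2 * (C * X.2 * ((1 + ‖X‖) ^ N)⁻¹) := by gcongr; exact h X hX
      _ = _ := by field_simp

lemma isRapid_halfOp {d : ℕ} (a : ℝ) (V : 𝓢(Pt d, ℂ)) (hV : ∀ x z, V (x, -z) = V (x, z)) :
    IsRapid a (halfOp a V) := by
  rw [show halfOp a V = fun X => lapX V X + besselS a V X from funext (halfOp_schwartz a V)]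
  exact (IsRapid.of_schwartz _).add (isRapid_besselS a V hV)

/-! ### Green's formula -/

/-- Green's formula for the Bessel operator on the half-line; `L` is the boundary value at `0` of
the weighted Wronskian. -/
lemma green_half_line {a : ℝ} {f f₁ f₂ g g₁ g₂ : ℝ → ℂ} {L : ℂ}
    (hf : ∀ z, 0 < z → HasDerivAt f (f₁ z) z) (hf₁ : ∀ z, 0 < z → HasDerivAt f₁ (f₂ z) z)
    (hg : ∀ z, 0 < z → HasDerivAt g (g₁ z) z) (hg₁ : ∀ z, 0 < z → HasDerivAt g₁ (g₂ z) z)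
    (i₁ : Integrable (fun z => (f₂ z + ((a / z : ℝ) : ℂ) * f₁ z) * g z) (nu a))
    (i₂ : Integrable (fun z => f z * (g₂ z + ((a / z : ℝ) : ℂ) * g₁ z)) (nu a))
    (h0 : Tendsto (fun z : ℝ => ((z ^ a : ℝ) : ℂ) * (f₁ z * g z - f z * g₁ z)) (𝓝[>] 0) (𝓝 L))
    (hinf : Tendsto (fun z : ℝ => ((z ^ a : ℝ) : ℂ) * (f₁ z * g z - f z * g₁ z)) atTop (𝓝 0)) :
    ∫ z, (f₂ z + ((a / z : ℝ) : ℂ) * f₁ z) * g z ∂(nu a)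
      = (∫ z, f z * (g₂ z + ((a / z : ℝ) : ℂ) * g₁ z) ∂(nu a)) - L := by
  let u : ℝ → ℂ := fun z => ((z ^ a : ℝ) : ℂ) * (f₁ z * g z - f z * g₁ z)
  let u' : ℝ → ℂ := fun z => z ^ a • ((f₂ z + ((a / z : ℝ) : ℂ) * f₁ z) * g z)
    - z ^ a • (f z * (g₂ z + ((a / z : ℝ) : ℂ) * g₁ z))
  have hu : ∀ z ∈ Ioi (0 : ℝ), HasDerivAt u (u' z) z := by
    intro z hz
    have hz0 : 0 < z := hz
    have h1 : HasDerivAt (fun z : ℝ => ((z ^ a : ℝ) : ℂ)) ((a * z ^ (a - 1) : ℝ) : ℂ) z :=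
      (Real.hasDerivAt_rpow_const (Or.inl hz0.ne')).ofReal_comp
    have h2 := h1.mul (((hf₁ z hz0).mul (hg z hz0)).sub ((hf z hz0).mul (hg₁ z hz0)))
    convert! h2 using 1
    simp only [u', Complex.real_smul, Real.rpow_sub hz0, Real.rpow_one, Pi.sub_apply, Pi.mul_apply]
    push_cast
    ring
  have j₁ := integrable_nu_iff.mp i₁
  have j₂ := integrable_nu_iff.mp i₂
  have h := integral_Ioi_deriv_mul_eq_sub (u := u) (v := fun _ => (1 : ℂ)) (u' := u')
    (v' := fun _ => 0) (a := 0) (a' := L) (b' := 0) hu (fun z _ => hasDerivAt_const z (1 : ℂ)) ?_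
    ?_ ?_
  · simp only [mul_one, mul_zero, add_zero, zero_sub, u'] at h
    rw [integral_sub j₁ j₂, ← integral_nu, ← integral_nu] at h
    linear_combination h
  · have h := j₁.sub j₂
    simp only [Pi.mul_def, Pi.add_def, mul_one, mul_zero, add_zero]
    exact h
  · simpa [Pi.mul_def] using h0
  · simpa [Pi.mul_def] using hinf

lemma IsRapid.integrable_mul {d : ℕ} {a : ℝ} (ha : -1 < a) (ha' : a < 1) {u v : Pt d → ℂ}
    (hu : IsRapid a u) (hv : IsRapid a v) : Integrable (fun X => u X * v X) (omega d a) :=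
  (hu.memLp ha ha').integrable_mul (hv.memLp ha ha')

/-- Green's formula on the half-space, assembled from its tangential part on horizontal slices and
its normal part on vertical lines. -/
lemma green_half_space {d : ℕ} {a : ℝ} (ha : -1 < a) (ha' : a < 1) {f fX fZ : Pt d → ℂ}
    {L : EuclideanSpace ℝ (Fin d) → ℂ} (hf : IsRapid a f) (hfX : IsRapid a fX) (hfZ : IsRapid a fZ)
    (V : 𝓢(Pt d, ℂ)) (hV : ∀ x z, V (x, -z) = V (x, z))
    (hX : ∀ z, 0 < z → ∫ x, fX (x, z) * V (x, z) = ∫ x, f (x, z) * lapX V (x, z))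
    (hZ : ∀ x, Integrable (fun z => fZ (x, z) * V (x, z)) (nu a) →
      Integrable (fun z => f (x, z) * besselS a V (x, z)) (nu a) →
      ∫ z, fZ (x, z) * V (x, z) ∂(nu a) = (∫ z, f (x, z) * besselS a V (x, z) ∂(nu a)) - L x) :
    ∫ X, (fX X + fZ X) * V X ∂(omega d a) = (∫ X, f X * halfOp a V X ∂(omega d a)) - ∫ x, L x := by
  have rV : IsRapid a V := IsRapid.of_schwartz V
  have rΔ : IsRapid a (lapX V) := IsRapid.of_schwartz (lapX V)
  have rB := isRapid_besselS a V hV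
  have k1 := hfX.integrable_mul ha ha' rV
  have k2 := hf.integrable_mul ha ha' rΔ
  have k3 := hfZ.integrable_mul ha ha' rV
  have k4 := hf.integrable_mul ha ha' rB
  have e1 : ∫ X, fX X * V X ∂(omega d a) = ∫ X, f X * lapX V X ∂(omega d a) := by
    rw [omega_eq_prod] at k1 k2 ⊢
    rw [integral_prod_symm _ k1, integral_prod_symm _ k2]
    refine integral_congr_ae ?_
    filter_upwards [ae_nu_pos a] with z hz using hX z hz
  have e2 : ∫ X, fZ X * V X ∂(omega d a)
      = (∫ X, f X * besselS a V X ∂(omega d a)) - ∫ x, L x := by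
    rw [omega_eq_prod] at k3 k4 ⊢
    have hae : ∀ᵐ x, ∫ z, fZ (x, z) * V (x, z) ∂(nu a)
        = (∫ z, f (x, z) * besselS a V (x, z) ∂(nu a)) - L x := by
      filter_upwards [k3.prod_right_ae, k4.prod_right_ae] with x h3 h4 using hZ x h3 h4
    have hL : ∫ x, L x = ∫ x, ((∫ z, f (x, z) * besselS a V (x, z) ∂(nu a))
        - ∫ z, fZ (x, z) * V (x, z) ∂(nu a)) := by
      refine integral_congr_ae ?_
      filter_upwards [hae] with x hx
      rw [hx]
      ring
    rw [hL, integral_sub k4.integral_prod_left k3.integral_prod_left, integral_prod _ k3,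
      integral_prod _ k4]
    ring
  simp_rw [add_mul, halfOp_schwartz, mul_add]
  rw [integral_add k1 k3, integral_add k2 k4, e1, e2]
  ring

lemma integral_lapX_mul {d : ℕ} (U V : 𝓢(Pt d, ℂ)) (z : ℝ) :
    ∫ x, lapX U (x, z) * V (x, z) = ∫ x, U (x, z) * lapX V (x, z) := by
  have h := SchwartzMap.integral_mul_laplacian_right_eq_left (μ := volume) (slice z U) (slice z V)
  rw [laplacian_slice, laplacian_slice] at h
  simpa only [slice_apply] using h.symm

/-- The operator is symmetric on even Schwartz functions. -/
lemma integral_halfOp_mul {d : ℕ} {a : ℝ} (ha : -1 < a) (ha' : a < 1) (U V : 𝓢(Pt d, ℂ))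
    (hU : ∀ x z, U (x, -z) = U (x, z)) (hV : ∀ x z, V (x, -z) = V (x, z)) :
    ∫ X, halfOp a U X * V X ∂(omega d a) = ∫ X, U X * halfOp a V X ∂(omega d a) := by
  have h := green_half_space ha ha' (L := fun _ => 0) (IsRapid.of_schwartz (a := a) U)
    (IsRapid.of_schwartz (lapX U)) (isRapid_besselS a U hU) V hV
    (fun z _ => integral_lapX_mul U V z) ?_
  · simpa only [← halfOp_schwartz, integral_zero, sub_zero] using h
  intro x i₁ i₂
  obtain ⟨C, hC, h1⟩ := exists_norm_dz_le U hU 2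
  obtain ⟨D, hD, h2⟩ := exists_norm_dz_le V hV 2
  obtain ⟨C', hC', h1'⟩ := (IsRapid.of_schwartz (a := a) U).decay 0
  obtain ⟨D', hD', h2'⟩ := (IsRapid.of_schwartz (a := a) V).decay 0
  simp only [pow_zero, inv_one, mul_one] at h1' h2'
  have hb : ∀ z : ℝ, 0 < z → ‖((z ^ a : ℝ) : ℂ) * (dz U (x, z) * V (x, z) - U (x, z) * dz V (x, z))‖
      ≤ (C * D' + C' * D) * (z ^ (a + 1) * ((1 + z) ^ 2)⁻¹) := by
    intro z hz
    have hz' : (1 + z) ≤ 1 + ‖((x, z) : Pt d)‖ := by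
      have : ‖z‖ ≤ ‖((x, z) : Pt d)‖ := norm_snd_le (x, z)
      rw [Real.norm_eq_abs, abs_of_pos hz] at this
      linarith
    rw [norm_mul, Complex.norm_real, Real.norm_eq_abs, abs_of_pos (Real.rpow_pos_of_pos hz a)]
    have hza := Real.rpow_pos_of_pos hz a
    have e1 : ‖dz U (x, z)‖ ≤ C * z * ((1 + z) ^ 2)⁻¹ := (h1 (x, z) hz).trans (by
      simp only; gcongr)
    have e2 : ‖dz V (x, z)‖ ≤ D * z * ((1 + z) ^ 2)⁻¹ := (h2 (x, z) hz).trans (by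
      simp only; gcongr)
    calc _ ≤ z ^ a * (‖dz U (x, z)‖ * ‖V (x, z)‖ + ‖U (x, z)‖ * ‖dz V (x, z)‖) := by
          gcongr
          exact (norm_sub_le _ _).trans (by rw [norm_mul, norm_mul])
      _ ≤ z ^ a * (C * z * ((1 + z) ^ 2)⁻¹ * D' + C' * (D * z * ((1 + z) ^ 2)⁻¹)) := by
          gcongr
          · exact h2' (x, z) hz
          · exact h1' (x, z) hz
      _ = _ := by rw [Real.rpow_add hz, Real.rpow_one]; ring
  have key := green_half_line (L := 0) (fun z _ => hasDerivAt_dz U x z)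
    (fun z _ => hasDerivAt_dz (dz U) x z) (fun z _ => hasDerivAt_dz V x z)
    (fun z _ => hasDerivAt_dz (dz V) x z) i₁ i₂ ?_ ?_
  · exact key
  · have ht : Tendsto (fun z : ℝ => (C * D' + C' * D) * (z ^ (a + 1) * ((1 + z) ^ 2)⁻¹)) (𝓝[>] 0)
        (𝓝 ((C * D' + C' * D) * (0 ^ (a + 1) * ((1 + 0) ^ 2)⁻¹))) := by
      refine Tendsto.mono_left ?_ nhdsWithin_le_nhds
      refine tendsto_const_nhds.mul (Tendsto.mul ?_ ?_)
      · exact (Real.continuousAt_rpow_const 0 (a + 1) (Or.inr (by linarith))).tendsto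
      · have : ContinuousAt (fun z : ℝ => ((1 + z) ^ 2)⁻¹) 0 :=
          ContinuousAt.inv₀ (by fun_prop) (by norm_num)
        exact this.tendsto
    rw [Real.zero_rpow (by linarith), zero_mul, mul_zero] at ht
    refine squeeze_zero_norm' ?_ ht
    filter_upwards [self_mem_nhdsWithin] with z hz using hb z hz
  · have ht : Tendsto (fun z : ℝ => (C * D' + C' * D) * z ^ (-(1 - a))) atTop
        (𝓝 ((C * D' + C' * D) * 0)) :=
      tendsto_const_nhds.mul (tendsto_rpow_neg_atTop (by linarith))
    rw [mul_zero] at ht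
    refine squeeze_zero_norm' ?_ ht
    filter_upwards [eventually_gt_atTop 0] with z hz
    refine (hb z hz).trans ?_
    have hza := Real.rpow_pos_of_pos hz a
    have e : z ^ (-(1 - a)) = z ^ (a + 1) * (z ^ 2)⁻¹ := by
      rw [show -(1 - a) = a + 1 - 2 by ring, Real.rpow_sub hz, Real.rpow_two, div_eq_mul_inv]
    rw [e]
    gcongr
    linarith

/-! ### The evolution equation for Gaussians -/

/-- The value of `halfOp` on a Gaussian. -/
def gaussOp {d : ℕ} (a : ℝ) (q : ℂ) (b : Fin d → ℂ) (X : Pt d) : ℂ :=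
  4 * ((∑ i, ((X.1 i : ℂ) - b i) ^ 2 + (X.2 : ℂ) ^ 2) / q ^ 2 - ((d + a + 1) / 2 : ℝ) / q)
    * gauss a q b X

lemma hasDerivAt_gauss_line {d : ℕ} (a : ℝ) (q : ℂ) (b : Fin d → ℂ) (X m : Pt d) (s : ℝ) :
    HasDerivAt (fun s : ℝ => gauss a q b (X + s • m))
      (-2 * (∑ i, ((X.1 i : ℂ) + s * m.1 i - b i) * m.1 i + (X.2 + s * m.2) * m.2) / q
        * gauss a q b (X + s • m)) s := by
  have h1 : ∀ c e f : ℂ, HasDerivAt (fun s : ℝ => (c + s * e - f) ^ 2)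
      (2 * (c + s * e - f) * e) s := by
    intro c e f
    have h := (((Complex.ofRealCLM.hasDerivAt (x := s)).mul_const e).const_add c).sub_const f
    have h' := h.pow 2
    convert! h' using 1
    simp
  have h2 := HasDerivAt.fun_sum (u := Finset.univ) fun i (_ : i ∈ Finset.univ) =>
    h1 (X.1 i) (m.1 i) (b i)
  have h3 := h1 X.2 m.2 0
  have h4 := ((h2.neg.div_const q).cexp.const_mul (q ^ (-((d / 2 : ℝ) : ℂ)))).mul
    ((h3.neg.div_const q).cexp.const_mul (q ^ (-(((a + 1) / 2 : ℝ) : ℂ))))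
  convert! h4 using 1
  · ext s
    simp [gauss, gaussX, gaussZ]
  · simp only [gauss, gaussX, gaussZ, Prod.fst_add, Prod.smul_fst, Prod.snd_add, Prod.smul_snd,
      PiLp.add_apply, PiLp.smul_apply, smul_eq_mul, sub_zero, Pi.neg_apply]
    push_cast
    simp only [mul_assoc, ← Finset.mul_sum]
    ring

lemma lineDerivOp_gaussS {d : ℕ} {a : ℝ} (ha : -1 < a) (p : GaussParam d) (m X : Pt d) :
    LineDeriv.lineDerivOp m (gaussS ha p) X
      = -2 * (∑ i, ((X.1 i : ℂ) - p.2 i) * m.1 i + X.2 * m.2) / p.1 * gaussP a p X := by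
  have h1 := hasDerivAt_line (gaussS ha p) m X 0
  have h2 := hasDerivAt_gauss_line a p.1 p.2 X m 0
  simp only [gaussS_apply] at h1
  have := h1.unique h2
  simpa using this

lemma lineDerivOp_lineDerivOp_gaussS {d : ℕ} {a : ℝ} (ha : -1 < a) (p : GaussParam d) (m X : Pt d) :
    LineDeriv.lineDerivOp m (LineDeriv.lineDerivOp m (gaussS ha p)) X
      = (-2 * (∑ i, (m.1 i : ℂ) * m.1 i + m.2 * m.2) / p.1
        + (2 * (∑ i, ((X.1 i : ℂ) - p.2 i) * m.1 i + X.2 * m.2) / p.1) ^ 2) * gaussP a p X := by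
  have h1 := hasDerivAt_line (LineDeriv.lineDerivOp m (gaussS ha p)) m X 0
  simp only [lineDerivOp_gaussS] at h1
  have h2 := hasDerivAt_gauss_line a p.1 p.2 X m 0
  have h3 : HasDerivAt (fun s : ℝ => -2 * (∑ i, (((X + s • m).1 i : ℂ) - p.2 i) * m.1 i
      + ((X + s • m).2 : ℂ) * m.2) / p.1)
      (-2 * (∑ i, (m.1 i : ℂ) * m.1 i + m.2 * m.2) / p.1) 0 := by
    have h4 : ∀ c e f g : ℂ, HasDerivAt (fun s : ℝ => (c + s * e - f) * g) (e * g) 0 := by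
      intro c e f g
      have h := ((((Complex.ofRealCLM.hasDerivAt (x := (0 : ℝ))).mul_const e).const_add c).sub_const
        f).mul_const g
      convert! h using 1
      simp
    have h5 := HasDerivAt.fun_sum (u := Finset.univ) fun i (_ : i ∈ Finset.univ) =>
      h4 (X.1 i) (m.1 i) (p.2 i) (m.1 i)
    have h6 := ((h5.add (h4 X.2 m.2 0 m.2)).const_mul (-2)).div_const (p.1 : ℂ)
    convert! h6 using 1
    ext s
    simp
  have h7 := h1.unique (h3.mul h2)
  simp only [zero_smul, add_zero, Complex.ofReal_zero, zero_mul] at h7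
  rw [h7]
  ring

lemma halfOp_gaussS {d : ℕ} {a : ℝ} (ha : -1 < a) (p : GaussParam d) {X : Pt d} (hX : X.2 ≠ 0) :
    halfOp a (gaussS ha p) X = gaussOp a p.1 p.2 X := by
  have hq := ne_zero_of_re_pos p.1.2
  have hX' : (X.2 : ℂ) ≠ 0 := by exact_mod_cast hX
  rw [halfOp_schwartz, lapX, besselS]
  simp only [dx, dz, _root_.sum_apply, lineDerivOp_lineDerivOp_gaussS, lineDerivOp_gaussS]
  simp only [PiLp.single_apply, Complex.ofReal_zero, mul_zero, add_zero,
    PiLp.zero_apply, Finset.sum_const_zero, zero_add, Complex.ofReal_one, mul_one]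
  simp only [apply_ite Complex.ofReal, Complex.ofReal_one, Complex.ofReal_zero, mul_ite, mul_one,
    mul_zero, Finset.sum_ite_eq', Finset.mem_univ, if_true]
  rw [← Finset.sum_mul, Finset.sum_add_distrib, gaussOp, Finset.sum_const, Finset.card_univ,
    Fintype.card_fin]
  simp only [div_pow, mul_pow, ← Finset.mul_sum, ← Finset.sum_div]
  push_cast
  simp only [nsmul_eq_mul]
  field_simp
  ring

/-- The Gaussians solve the Schrödinger equation as their width moves vertically. -/
lemma hasDerivAt_gauss_shift {d : ℕ} (a : ℝ) (p : GaussParam d) (X : Pt d) (σ : ℝ) :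
    HasDerivAt (fun s => gaussP a (shift s p) X)
      (Complex.I * gaussOp a (shift σ p).1 (shift σ p).2 X) σ := by
  have hq := (shift σ p).1.2
  have hq0 := ne_zero_of_re_pos hq
  set q : ℂ := ((shift σ p).1 : ℂ) with hqdef
  have h1 : HasDerivAt (fun s : ℝ => ((shift s p).1 : ℂ)) (4 * Complex.I) σ := by
    have h := ((Complex.ofRealCLM.hasDerivAt (x := σ)).const_mul (4 * Complex.I)).const_add
      (p.1 : ℂ)
    convert! h using 1
    simp
  have hpow : ∀ c : ℂ, HasDerivAt (fun s : ℝ => ((shift s p).1 : ℂ) ^ (-c))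
      (-c * q ^ (-c) * q⁻¹ * (4 * Complex.I)) σ := by
    intro c
    have h0 : HasDerivAt (fun w : ℂ => w ^ (-c)) (-c * q ^ (-c - 1)) ((shift σ p).1 : ℂ) := by
      simpa using (hasDerivAt_id q).cpow_const (c := -c) (Or.inl hq)
    refine (HasDerivAt.scomp σ h0 h1).congr_deriv ?_
    rw [Complex.cpow_sub _ _ hq0, Complex.cpow_one, smul_eq_mul]
    ring
  have hexp : ∀ e : ℂ, HasDerivAt (fun s : ℝ => Complex.exp (-e / ((shift s p).1 : ℂ)))
      (Complex.exp (-e / q) * (e / q ^ 2 * (4 * Complex.I))) σ := by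
    intro e
    refine ((hasDerivAt_const σ (-e)).fun_div h1 hq0).cexp.congr_deriv ?_
    rw [← hqdef]
    ring
  have h := ((hpow (d / 2 : ℝ)).fun_mul (hexp (∑ i, ((X.1 i : ℂ) - p.2 i) ^ 2))).fun_mul
    ((hpow ((a + 1) / 2 : ℝ)).fun_mul (hexp ((X.2 : ℂ) ^ 2)))
  refine h.congr_deriv ?_
  simp only [gaussOp, gauss, gaussX, gaussZ, ← hqdef]
  rw [show (shift σ p).2 = p.2 from rfl]
  push_cast
  ring

lemma continuous_gaussOp {d : ℕ} (a : ℝ) (q : ℂ) (b : Fin d → ℂ) : Continuous (gaussOp a q b) := by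
  have := continuous_gauss a q b
  unfold gaussOp
  fun_prop

/-- Gaussian decay of `gaussOp`, uniformly along bounded pieces of the orbit `q + 4iσ`. -/
lemma exists_norm_gaussOp_le {d : ℕ} {a : ℝ} (ha : -1 < a) (p : GaussParam d) {S : ℝ} (hS : 0 ≤ S) :
    ∃ C ρ, 0 ≤ C ∧ 0 < ρ ∧ ∀ σ : ℝ, |σ| ≤ S → ∀ X : Pt d,
      ‖gaussOp a (shift σ p).1 (shift σ p).2 X‖ ≤ C * Real.exp (-ρ * (‖X.1‖ ^ 2 + X.2 ^ 2)) := by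
  obtain ⟨C, ρ, hC, hρ, h⟩ := exists_norm_gauss_le ha p.1.2 p.2 hS
  obtain ⟨D, hD, h'⟩ := exists_pow_mul_exp_le 1 (half_pos hρ)
  set κ := (p.1 : ℂ).re
  have hκ : 0 < κ := p.1.2
  set β : ℝ := 2 * ∑ i, ‖p.2 i‖ ^ 2
  have hβ : 0 ≤ β := by positivity
  set K : ℝ := 4 * ((2 + β) / κ ^ 2 + ‖(((d + a + 1) / 2 : ℝ) : ℂ)‖ / κ)
  have hK : 0 ≤ K := by positivity
  refine ⟨K * C * D, ρ / 2, by positivity, half_pos hρ, fun σ hσ X => ?_⟩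
  set v : ℝ := ‖X.1‖ ^ 2 + X.2 ^ 2 with hv
  have hv0 : 0 ≤ v := by positivity
  have hq : κ ≤ ‖((shift σ p).1 : ℂ)‖ := by
    refine le_trans ?_ (Complex.re_le_norm _)
    simp [shift, κ]
  have hsum : ‖∑ i, ((X.1 i : ℂ) - p.2 i) ^ 2 + (X.2 : ℂ) ^ 2‖ ≤ (2 + β) * (1 + v) := by
    have h1 : ‖∑ i, ((X.1 i : ℂ) - p.2 i) ^ 2‖ ≤ 2 * ‖X.1‖ ^ 2 + β := by
      simp only [β]
      rw [EuclideanSpace.norm_sq_eq, Finset.mul_sum, Finset.mul_sum, ← Finset.sum_add_distrib]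
      refine (norm_sum_le _ _).trans (Finset.sum_le_sum fun i _ => ?_)
      rw [norm_pow]
      have := norm_sub_le (X.1 i : ℂ) (p.2 i)
      rw [Complex.norm_real] at this
      nlinarith [sq_nonneg (‖X.1 i‖ - ‖p.2 i‖), norm_nonneg ((X.1 i : ℂ) - p.2 i)]
    have h2 : ‖(X.2 : ℂ) ^ 2‖ = X.2 ^ 2 := by
      rw [norm_pow, Complex.norm_real, Real.norm_eq_abs, sq_abs]
    refine (norm_add_le _ _).trans ?_
    rw [h2]
    nlinarith [mul_nonneg hβ hv0, sq_nonneg X.2]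
  have hfac : ‖4 * ((∑ i, ((X.1 i : ℂ) - p.2 i) ^ 2 + (X.2 : ℂ) ^ 2) / ((shift σ p).1 : ℂ) ^ 2
      - (((d + a + 1) / 2 : ℝ) : ℂ) / (shift σ p).1)‖ ≤ K * (1 + v) := by
    rw [norm_mul, show ‖(4 : ℂ)‖ = 4 by simp]
    have h3 : ‖(∑ i, ((X.1 i : ℂ) - p.2 i) ^ 2 + (X.2 : ℂ) ^ 2) / ((shift σ p).1 : ℂ) ^ 2‖
        ≤ (2 + β) * (1 + v) / κ ^ 2 := by
      rw [norm_div, norm_pow]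
      gcongr
    have h4 : ‖(((d + a + 1) / 2 : ℝ) : ℂ) / (shift σ p).1‖
        ≤ ‖(((d + a + 1) / 2 : ℝ) : ℂ)‖ / κ * (1 + v) := by
      rw [norm_div]
      have : ‖(((d + a + 1) / 2 : ℝ) : ℂ)‖ / ‖((shift σ p).1 : ℂ)‖
          ≤ ‖(((d + a + 1) / 2 : ℝ) : ℂ)‖ / κ := by gcongr
      refine this.trans (le_mul_of_one_le_right (by positivity) (by linarith))
    refine (mul_le_mul_of_nonneg_left ((norm_sub_le _ _).trans (add_le_add h3 h4))
      (by norm_num)).trans (le_of_eq ?_)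
    simp only [K]
    ring
  have hexp : Real.exp (-ρ * v) = Real.exp (-(ρ / 2) * v) * Real.exp (-(ρ / 2) * v) := by
    rw [← Real.exp_add]
    ring_nf
  calc _ ≤ K * (1 + v) * (C * Real.exp (-ρ * v)) := by
        rw [gaussOp, norm_mul]
        exact mul_le_mul hfac (h σ hσ X) (norm_nonneg _) (by positivity)
    _ = K * C * ((1 + v) ^ 1 * Real.exp (-(ρ / 2) * v)) * Real.exp (-(ρ / 2) * v) := by
        rw [hexp]; ring
    _ ≤ _ := by
        gcongr
        exact h' v hv0

lemma isRapid_gaussOp {d : ℕ} {a : ℝ} (ha : -1 < a) (p : GaussParam d) :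
    IsRapid a (gaussOp a p.1 p.2) := by
  obtain ⟨C, ρ, hC, hρ, h⟩ := exists_norm_gaussOp_le ha p le_rfl
  refine isRapid_of_le_exp (continuous_gaussOp a _ _).aestronglyMeasurable hC hρ fun X _ => ?_
  have h1 := h 0 (by simp) X
  rwa [shift_zero] at h1

lemma memLp_exp_neg_sq {d : ℕ} {a : ℝ} (ha : -1 < a) (ha' : a < 1) {ρ : ℝ} (hρ : 0 < ρ) :
    MemLp (fun X : Pt d => Real.exp (-ρ * (‖X.1‖ ^ 2 + X.2 ^ 2))) 2 (omega d a) := by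
  have h : IsRapid a fun X : Pt d => ((Real.exp (-ρ * (‖X.1‖ ^ 2 + X.2 ^ 2)) : ℝ) : ℂ) :=
    isRapid_of_le_exp (Continuous.aestronglyMeasurable (by fun_prop)) zero_le_one hρ fun X _ => by
      rw [Complex.norm_real, one_mul, Real.norm_eq_abs, Real.abs_exp]
  simpa only [RCLike.re_to_complex, Complex.ofReal_re] using (h.memLp ha ha').re

lemma hasDerivAt_pair_shift {d : ℕ} {a : ℝ} (ha : -1 < a) (ha' : a < 1) {f : Pt d → ℂ}
    (hf : MemLp f 2 (omega d a)) (p : GaussParam d) (σ : ℝ) :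
    HasDerivAt (fun s => pair (a := a) f (shift s p))
      (Complex.I * ∫ X, f X * gaussOp a (shift σ p).1 (shift σ p).2 X ∂(omega d a)) σ := by
  obtain ⟨C, ρ, hC, hρ, h⟩ := exists_norm_gaussOp_le ha p (S := |σ| + 1) (by positivity)
  have hb : Integrable (fun X => ‖f X‖ * (C * Real.exp (-ρ * (‖X.1‖ ^ 2 + X.2 ^ 2)))) (omega d a) :=
    hf.norm.integrable_mul ((memLp_exp_neg_sq ha ha' hρ).const_mul C)
  have key := hasDerivAt_integral_of_dominated_loc_of_deriv_le (μ := omega d a) (x₀ := σ)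
    (F := fun s X => f X * gaussP a (shift s p) X)
    (F' := fun s X => f X * (Complex.I * gaussOp a (shift s p).1 (shift s p).2 X))
    (s := Metric.ball σ 1) (Metric.ball_mem_nhds σ one_pos)
    (Eventually.of_forall fun s => (integrable_mul_gaussP ha ha' hf (shift s p)).1)
    (integrable_mul_gaussP ha ha' hf (shift σ p))
    (hf.1.mul ((continuous_gaussOp a _ _).aestronglyMeasurable.const_mul _))
    (ae_of_all _ fun X s hs => ?_) hb
    (ae_of_all _ fun X s _ => (hasDerivAt_gauss_shift a p X s).const_mul (f X))
  · refine key.2.congr_deriv ?_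
    rw [← integral_const_mul]
    exact integral_congr_ae (ae_of_all _ fun X => by ring)
  · rw [norm_mul, norm_mul, Complex.norm_I, one_mul]
    refine mul_le_mul_of_nonneg_left (h s ?_ X) (norm_nonneg _)
    have h1 : |s - σ| < 1 := by simpa [Real.dist_eq] using hs
    linarith [abs_sub_abs_le_abs_sub s σ]

/-! ### The generator -/

section RestrictScalars

variable {E F G : Type*} [NormedAddCommGroup E] [NormedSpace ℂ E] [NormedAddCommGroup F]
  [NormedSpace ℂ F] [NormedAddCommGroup G] [NormedSpace ℂ G] {f : ℝ → E} {g : ℝ → F} {f' : E}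
  {g' : F} {t : ℝ}

lemma hasDerivAt_clm_comp (h : HasDerivAt f f' t) (A : E →L[ℂ] F) :
    HasDerivAt (fun s => A (f s)) (A f') t :=
  (A.restrictScalars ℝ).hasFDerivAt.comp_hasDerivAt t h

lemma hasDerivAt_bilin (hf : HasDerivAt f f' t) (B : E →L[ℂ] F →L[ℂ] G)
    (hg : HasDerivAt g g' t) :
    HasDerivAt (fun s => B (f s) (g s)) (B f' (g t) + B (f t) g') t := by
  have h := (B.bilinearRestrictScalars ℝ).hasFDerivAt_of_bilinear hf.hasFDerivAt hg.hasFDerivAt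
  simpa [add_comm] using h.hasDerivAt

lemma hasDerivAt_comp_neg (h : HasDerivAt f f' (-t)) :
    HasDerivAt (fun s => f (-s)) (-f') t := by
  simpa [Function.comp_def] using HasDerivAt.scomp t h (hasDerivAt_neg t)

end RestrictScalars

section Generator

variable {d : ℕ} {a : ℝ}

/-- The bilinear pairing of `L²_a` with itself. -/
def bil (d : ℕ) (a : ℝ) : L2 d a →L[ℂ] L2 d a →L[ℂ] ℂ :=
  (ContinuousLinearMap.mul ℂ ℂ).lpPairing (omega d a) 2 2

lemma bil_apply (v w : L2 d a) : bil d a v w = ∫ X, v X * w X ∂(omega d a) := by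
  rw [bil, ContinuousLinearMap.lpPairing_eq_integral]
  rfl

lemma bil_gaussL2 (ha : -1 < a) (ha' : a < 1) (v : L2 d a) (p : GaussParam d) :
    bil d a v (gaussL2 ha ha' p) = pair (a := a) v p := by
  rw [bil_apply]
  refine integral_congr_ae ?_
  filter_upwards [coeFn_gaussL2 ha ha' p] with X hX
  rw [hX]

lemma bil_evol (ha : -1 < a) (ha' : a < 1) (t : ℝ) (v w : L2 d a) :
    bil d a (evol ha ha' t v) w = bil d a v (evol ha ha' t w) := by
  have h : bil d a (evol ha ha' t v) = (bil d a v).comp (evol ha ha' t) :=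
    ext_gaussL2 ha ha' fun p => by
      rw [ContinuousLinearMap.comp_apply, evol_gaussL2, bil_gaussL2, bil_gaussL2, pair_evol]
  rw [h]
  rfl

/-- The realization with zero Neumann condition, tested against Gaussians. -/
lemma IsNeumannOp.pair_eq (ha : -1 < a) {v g : L2 d a} (h : IsNeumannOp a v g) (p : GaussParam d) :
    pair (a := a) g p = ∫ X, v X * gaussOp a p.1 p.2 X ∂(omega d a) := by
  have h1 := h (gaussS ha p) (gaussS_even ha p)
  simp only [gaussS_apply] at h1
  rw [pair, h1]
  refine integral_congr_ae ?_
  filter_upwards [ae_omega_pos d a] with X hX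
  rw [halfOp_gaussS ha p hX.ne']

lemma IsNeumannOp.unique (ha : -1 < a) (ha' : a < 1) {v g g' : L2 d a} (h : IsNeumannOp a v g)
    (h' : IsNeumannOp a v g') : g = g' :=
  eq_of_forall_pair ha ha' fun p => by rw [h.pair_eq ha, h'.pair_eq ha]

/-- Even Schwartz functions are in the domain of the realization. -/
lemma isNeumannOp_schwartz (ha : -1 < a) (ha' : a < 1) (V : 𝓢(Pt d, ℂ))
    (hV : ∀ x z, V (x, -z) = V (x, z)) :
    IsNeumannOp a ((IsRapid.of_schwartz V).memLp ha ha').toLp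
      ((isRapid_halfOp a V hV).memLp ha ha').toLp := by
  intro W hW
  rw [integral_congr_ae (g := fun X => halfOp a V X * W X) ?_, integral_halfOp_mul ha ha' V W hV hW]
  · refine integral_congr_ae ?_
    filter_upwards [MemLp.coeFn_toLp ((IsRapid.of_schwartz (a := a) V).memLp ha ha')] with X hX
    rw [hX]
  · filter_upwards [MemLp.coeFn_toLp ((isRapid_halfOp a V hV).memLp ha ha')] with X hX
    rw [hX]

/-- `gaussOp` as an element of `L²_a`. -/
def gaussOpL2 (ha : -1 < a) (ha' : a < 1) (p : GaussParam d) : L2 d a :=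
  ((isRapid_gaussOp ha p).memLp ha ha').toLp

lemma isNeumannOp_gaussL2 (ha : -1 < a) (ha' : a < 1) (p : GaussParam d) :
    IsNeumannOp a (gaussL2 ha ha' p) (gaussOpL2 ha ha' p) := by
  have h := isNeumannOp_schwartz ha ha' (gaussS ha p) (gaussS_even ha p)
  convert h using 1
  · refine MemLp.toLp_congr _ _ (ae_of_all _ fun X => (gaussS_apply ha p X).symm)
  · refine MemLp.toLp_congr _ _ ?_
    filter_upwards [ae_omega_pos d a] with X hX
    rw [halfOp_gaussS ha p hX.ne']

/-- Tested against Gaussians, `evol t v - v = ∫₀ᵗ evol s (i g) ds`. -/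
lemma hasDerivAt_evol_of_isNeumannOp (ha : -1 < a) (ha' : a < 1) {v g : L2 d a}
    (h : IsNeumannOp a v g) : HasDerivAt (fun t => evol ha ha' t v) (Complex.I • g) 0 := by
  have hc := continuous_evol ha ha' (Complex.I • g)
  have key : ∀ t, evol ha ha' t v = v + ∫ s in (0 : ℝ)..t, evol ha ha' s (Complex.I • g) := by
    intro t
    refine eq_of_forall_pair ha ha' fun p => ?_
    simp only [← bil_gaussL2 ha ha', map_add, add_apply]
    have e : bil d a (∫ s in (0 : ℝ)..t, evol ha ha' s (Complex.I • g)) (gaussL2 ha ha' p)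
        = ∫ s in (0 : ℝ)..t, bil d a (evol ha ha' s (Complex.I • g)) (gaussL2 ha ha' p) :=
      (((bil d a).flip (gaussL2 ha ha' p)).intervalIntegral_comp_comm
        (hc.intervalIntegrable 0 t)).symm
    have hd : ∀ s, HasDerivAt (fun s => bil d a (evol ha ha' s v) (gaussL2 ha ha' p))
        (bil d a (evol ha ha' s (Complex.I • g)) (gaussL2 ha ha' p)) s := by
      intro s
      simp only [bil_evol, evol_gaussL2, map_smul, smul_apply, smul_eq_mul]
      simp only [bil_gaussL2]
      rw [h.pair_eq ha]
      exact hasDerivAt_pair_shift ha ha' (Lp.memLp v) p s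
    have hi := (((bil d a).flip (gaussL2 ha ha' p)).continuous.comp hc).intervalIntegrable
      (μ := volume) 0 t
    rw [e, intervalIntegral.integral_eq_sub_of_hasDerivAt (fun s _ => hd s) hi, evol_zero]
    simp
  rw [show (fun t => evol ha ha' t v)
    = fun t => v + ∫ s in (0 : ℝ)..t, evol ha ha' s (Complex.I • g) from funext key]
  have h1 := intervalIntegral.integral_hasDerivAt_right (hc.intervalIntegrable 0 0)
    hc.aestronglyMeasurable.stronglyMeasurableAtFilter hc.continuousAt
  rw [evol_zero] at h1
  exact h1.const_add v

lemma isSchrodingerGroup_evol (ha : -1 < a) (ha' : a < 1) :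
    IsSchrodingerGroup a (evol (d := d) ha ha') where
  zero := evol_zero ha ha'
  add := evol_add ha ha'
  cont := continuous_evol ha ha'
  generator v g := by
    refine ⟨fun h V hV => ?_, hasDerivAt_evol_of_isNeumannOp ha ha'⟩
    have hN := hasDerivAt_evol_of_isNeumannOp ha ha' (isNeumannOp_schwartz ha ha' V hV)
    set v' := ((IsRapid.of_schwartz (a := a) V).memLp ha ha').toLp with hv'
    set g' := ((isRapid_halfOp a V hV).memLp ha ha').toLp with hg'
    have h1 : HasDerivAt (fun t => bil d a (evol ha ha' t v) v') (bil d a (Complex.I • g) v') 0 :=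
      hasDerivAt_clm_comp h ((bil d a).flip v')
    have h2 : HasDerivAt (fun t => bil d a v (evol ha ha' t v')) (bil d a v (Complex.I • g')) 0 :=
      hasDerivAt_clm_comp hN (bil d a v)
    simp only [bil_evol] at h1
    have h3 := h1.unique h2
    simp only [map_smul, smul_apply, smul_eq_mul] at h3
    have h4 := mul_left_cancel₀ Complex.I_ne_zero h3
    rw [bil_apply, bil_apply] at h4
    rw [← integral_congr_ae (f := fun X => g X * v' X) ?_, h4]
    · refine integral_congr_ae ?_
      filter_upwards [MemLp.coeFn_toLp ((isRapid_halfOp a V hV).memLp ha ha')] with X hX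
      rw [hX]
    · filter_upwards [MemLp.coeFn_toLp ((IsRapid.of_schwartz (a := a) V).memLp ha ha')] with X hX
      rw [hX]

section Unique

variable {T : ℝ → L2 d a →L[ℂ] L2 d a} (hT : IsSchrodingerGroup a T)

include hT in
lemma IsSchrodingerGroup.hasDerivAt {v g : L2 d a} (h : IsNeumannOp a v g) (t : ℝ) :
    HasDerivAt (fun s => T s v) (T t (Complex.I • g)) t := by
  have h0 := (hT.generator v g).mpr h
  have h1 : HasDerivAt (fun s : ℝ => T (s - t) v) (Complex.I • g) t := by
    rw [← sub_self t] at h0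
    exact h0.comp_sub_const t t
  have h2 := hasDerivAt_clm_comp h1 (T t)
  refine h2.congr_of_eventuallyEq (Eventually.of_forall fun s => ?_)
  have := hT.add t (s - t)
  rw [add_sub_cancel] at this
  simp [this]

include hT in
lemma IsSchrodingerGroup.isNeumannOp {v g : L2 d a} (h : IsNeumannOp a v g) (t : ℝ) :
    IsNeumannOp a (T t v) (T t g) := by
  rw [← hT.generator, ← map_smul]
  have h2 := hasDerivAt_clm_comp ((hT.generator v g).mpr h) (T t)
  refine h2.congr_of_eventuallyEq (Eventually.of_forall fun s => ?_)
  have e1 := hT.add t s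
  have e2 := hT.add s t
  rw [add_comm, e2] at e1
  exact DFunLike.congr_fun e1 v

include hT in
/-- The generator determines the group: for `v` in the domain, `t ↦ ⟨T t v, γ⟩` is constant when the
Gaussian `γ` is evolved backwards. -/
lemma IsSchrodingerGroup.eq_evol (ha : -1 < a) (ha' : a < 1) : T = evol ha ha' := by
  have hE := isSchrodingerGroup_evol (d := d) ha ha'
  funext t
  refine ext_gaussL2 ha ha' fun p => eq_of_forall_pair ha ha' fun r => ?_
  have hv := isNeumannOp_gaussL2 ha ha' p
  set v := gaussL2 ha ha' p
  set g := gaussOpL2 ha ha' p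
  let p' : GaussParam d := shift t r
  have hw := isNeumannOp_gaussL2 ha ha' p'
  let φ : ℝ → ℂ := fun s => bil d a (T s v) (evol ha ha' (-s) (gaussL2 ha ha' p'))
  have hφ : ∀ s, HasDerivAt φ 0 s := by
    intro s
    have h1 := hT.hasDerivAt hv s
    have h2 : HasDerivAt (fun s => evol ha ha' (-s) (gaussL2 ha ha' p'))
        (-(evol ha ha' (-s) (Complex.I • gaussOpL2 ha ha' p'))) s :=
      hasDerivAt_comp_neg (hE.hasDerivAt hw (-s))
    have h3 := hasDerivAt_bilin h1 (bil d a) h2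
    refine h3.congr_deriv ?_
    have e1 := hE.isNeumannOp hw (-s)
    rw [evol_gaussL2] at e1
    have e2 := e1.unique ha ha' (isNeumannOp_gaussL2 ha ha' (shift (-s) p'))
    have e3 := (hT.isNeumannOp hv s).pair_eq ha (shift (-s) p')
    simp only [map_smul, map_neg, smul_apply, evol_gaussL2, e2, bil_gaussL2, e3]
    rw [bil_apply, ← sub_eq_add_neg, sub_eq_zero]
    congr 1
    refine integral_congr_ae ?_
    filter_upwards [MemLp.coeFn_toLp ((isRapid_gaussOp ha (shift (-s) p')).memLp ha ha')] with X hX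
    rw [gaussOpL2, hX]
  have hconst := is_const_of_deriv_eq_zero (fun s => (hφ s).differentiableAt)
    (fun s => (hφ s).deriv) t 0
  simp only [φ, hT.zero, evol_gaussL2, bil_gaussL2, p', shift_shift, neg_zero, neg_add_cancel,
    shift_zero, zero_add] at hconst
  rw [hconst, pair_evol]
  rfl

end Unique

end Generator

/-! ### Rapidly decreasing families -/

section L2

variable {d : ℕ} {a : ℝ}

lemma integral_norm_mul_le {f g : Pt d → ℂ} (hf : MemLp f 2 (omega d a))
    (hg : MemLp g 2 (omega d a)) :
    ∫ X, ‖f X * g X‖ ∂(omega d a) ≤ ‖hf.toLp‖ * ‖hg.toLp‖ := by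
  have h := real_inner_le_norm hf.norm.toLp hg.norm.toLp
  rw [Lp.norm_toLp, Lp.norm_toLp, eLpNorm_norm, eLpNorm_norm, ← Lp.norm_toLp f hf,
    ← Lp.norm_toLp g hg, L2.inner_def] at h
  refine le_trans (le_of_eq (integral_congr_ae ?_)) h
  filter_upwards [MemLp.coeFn_toLp hf.norm, MemLp.coeFn_toLp hg.norm] with X h1 h2
  rw [h1, h2, norm_mul]
  simp [mul_comm]

/-- The `L²_a` norm is controlled by a weighted sup norm. -/
lemma exists_norm_toLp_le (ha : -1 < a) (ha' : a < 1) : ∃ K, 0 ≤ K ∧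
    ∀ (u : Pt d → ℂ) (hu : MemLp u 2 (omega d a)) (C : ℝ),
      (∀ X, 0 < X.2 → ‖u X‖ ≤ C * ((1 + ‖X‖) ^ decayExp d)⁻¹) → ‖hu.toLp‖ ≤ C * K := by
  have hw : MemLp (fun X : Pt d => ((1 + ‖X‖) ^ decayExp d)⁻¹) 2 (omega d a) := by
    have hc : Continuous fun X : Pt d => ((1 + ‖X‖) ^ decayExp d)⁻¹ :=
      Continuous.inv₀ (by fun_prop) fun X => by positivity
    rw [memLp_two_iff_integrable_sq_norm hc.aestronglyMeasurable]
    refine (integrable_one_add_norm_pow (d := d) ha ha').mono' (hc.norm.pow 2).aestronglyMeasurable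
      (ae_of_all _ fun X => ?_)
    have h1 : ((1 + ‖X‖) ^ decayExp d)⁻¹ ≤ 1 :=
      inv_le_one_of_one_le₀ (one_le_pow₀ (by linarith [norm_nonneg X]))
    have h0 : 0 ≤ ((1 + ‖X‖) ^ decayExp d)⁻¹ := by positivity
    rw [norm_pow, norm_norm, Real.norm_eq_abs, abs_of_nonneg h0]
    nlinarith
  refine ⟨‖hw.toLp‖, norm_nonneg _, fun u hu C h => ?_⟩
  refine Lp.norm_le_mul_norm_of_ae_le_mul ?_
  filter_upwards [MemLp.coeFn_toLp hu, MemLp.coeFn_toLp hw, ae_omega_pos d a] with X h1 h2 hX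
  rw [h1, h2, Real.norm_eq_abs, abs_of_nonneg (by positivity)]
  exact h X hX

/-- A family of functions on the half-space that decrease rapidly, uniformly in the parameter, and
depend on it in a Lipschitz way. -/
structure IsRapidFamily {d : ℕ} (v : ℝ → Pt d → ℂ) : Prop where
  meas : Measurable fun P : ℝ × Pt d => v P.1 P.2
  decay : ∀ N : ℕ, ∃ C, 0 ≤ C ∧ ∀ τ X, 0 < X.2 → ‖v τ X‖ ≤ C * ((1 + ‖X‖) ^ N)⁻¹
  lip : ∀ N : ℕ, ∃ C, 0 ≤ C ∧ ∀ τ σ X, 0 < X.2 →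
    ‖v τ X - v σ X‖ ≤ C * |τ - σ| * ((1 + ‖X‖) ^ N)⁻¹

namespace IsRapidFamily

variable {v w : ℝ → Pt d → ℂ}

lemma add (hv : IsRapidFamily v) (hw : IsRapidFamily w) :
    IsRapidFamily fun τ X => v τ X + w τ X := by
  refine ⟨hv.meas.add hw.meas, fun N => ?_, fun N => ?_⟩
  · obtain ⟨C, hC, h⟩ := hv.decay N
    obtain ⟨D, hD, h'⟩ := hw.decay N
    refine ⟨C + D, by positivity, fun τ X hX => (norm_add_le _ _).trans ?_⟩
    rw [add_mul]
    exact add_le_add (h τ X hX) (h' τ X hX)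
  · obtain ⟨C, hC, h⟩ := hv.lip N
    obtain ⟨D, hD, h'⟩ := hw.lip N
    refine ⟨C + D, by positivity, fun τ σ X hX => ?_⟩
    rw [add_sub_add_comm, add_mul, add_mul]
    exact (norm_add_le _ _).trans (add_le_add (h τ σ X hX) (h' τ σ X hX))

lemma const_mul (hv : IsRapidFamily v) (c : ℂ) : IsRapidFamily fun τ X => c * v τ X := by
  refine ⟨hv.meas.const_mul c, fun N => ?_, fun N => ?_⟩
  · obtain ⟨C, hC, h⟩ := hv.decay N
    refine ⟨‖c‖ * C, by positivity, fun τ X hX => ?_⟩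
    rw [norm_mul, mul_assoc]
    exact mul_le_mul_of_nonneg_left (h τ X hX) (norm_nonneg c)
  · obtain ⟨C, hC, h⟩ := hv.lip N
    refine ⟨‖c‖ * C, by positivity, fun τ σ X hX => ?_⟩
    rw [← mul_sub, norm_mul, mul_assoc, mul_assoc, ← mul_assoc C]
    exact mul_le_mul_of_nonneg_left (h τ σ X hX) (norm_nonneg c)

lemma sub (hv : IsRapidFamily v) (hw : IsRapidFamily w) :
    IsRapidFamily fun τ X => v τ X - w τ X := by
  simpa [sub_eq_add_neg] using hv.add (hw.const_mul (-1))

lemma isRapid (hv : IsRapidFamily v) (a τ : ℝ) : IsRapid a (v τ) := by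
  refine ⟨(hv.meas.comp measurable_prodMk_left).aestronglyMeasurable, fun N => ?_⟩
  obtain ⟨C, hC, h⟩ := hv.decay N
  exact ⟨C, hC, fun X hX => h τ X hX⟩

/-- A rapidly decreasing family as a curve in `L²_a`. -/
def toL2 (hv : IsRapidFamily v) (ha : -1 < a) (ha' : a < 1) (τ : ℝ) : L2 d a :=
  ((hv.isRapid a τ).memLp ha ha').toLp

lemma coeFn_toL2 (hv : IsRapidFamily v) (ha : -1 < a) (ha' : a < 1) (τ : ℝ) :
    hv.toL2 ha ha' τ =ᵐ[omega d a] v τ := MemLp.coeFn_toLp _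

lemma exists_norm_toL2_le (hv : IsRapidFamily v) (ha : -1 < a) (ha' : a < 1) :
    ∃ C, 0 ≤ C ∧ ∀ τ, ‖hv.toL2 ha ha' τ‖ ≤ C := by
  obtain ⟨K, hK, h⟩ := exists_norm_toLp_le (d := d) ha ha'
  obtain ⟨C, hC, h'⟩ := hv.decay (decayExp d)
  exact ⟨C * K, by positivity, fun τ => h _ _ C (h' τ)⟩

lemma continuous_toL2 (hv : IsRapidFamily v) (ha : -1 < a) (ha' : a < 1) :
    Continuous (hv.toL2 ha ha') := by
  obtain ⟨K, hK, h⟩ := exists_norm_toLp_le (d := d) ha ha'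
  obtain ⟨C, hC, h'⟩ := hv.lip (decayExp d)
  refine (LipschitzWith.of_dist_le_mul (K := ⟨C * K, by positivity⟩) fun τ σ => ?_).continuous
  rw [dist_eq_norm, Real.dist_eq, toL2, toL2, ← MemLp.toLp_sub]
  refine (h _ _ (C * |τ - σ|) (h' τ σ)).trans (le_of_eq ?_)
  change C * |τ - σ| * K = C * K * |τ - σ|
  ring

end IsRapidFamily

end L2

/-! ### Bounds on the kernel -/

lemma norm_heatZ (a z ζ t : ℝ) : ‖heatZ a z ζ t‖
    = 2 * (4 * |t|) ^ (-((a + 1) / 2)) * |bes ((a + 1) / 2) ((z / (4 * t)) ^ 2 * ζ ^ 2)| := by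
  have h1 := exp_I_div (r := z ^ 2 + ζ ^ 2) (t := t)
  push_cast at h1
  have h2 : ‖(4 * Complex.I * t : ℂ)‖ = 4 * |t| := by simp
  rw [heatZ, ← h1, norm_mul, norm_mul, norm_mul, Complex.norm_real, ← Complex.ofReal_neg,
    Complex.norm_cpow_real, h2, Real.norm_eq_abs]
  have h3 : ‖Complex.exp (Complex.I * (((z : ℂ) ^ 2 + (ζ : ℂ) ^ 2) / (4 * t)))‖ = 1 := by
    have := Complex.norm_exp_I_mul_ofReal ((z ^ 2 + ζ ^ 2) / (4 * t))
    push_cast at this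
    exact this
  rw [h3]
  simp

lemma norm_kerX {d : ℕ} (x y : EuclideanSpace ℝ (Fin d)) (t : ℝ) :
    ‖kerX x y t‖ = ‖(4 * Real.pi * Complex.I * t : ℂ) ^ (-(d / 2 : ℂ))‖ := by
  rw [kerX, norm_mul, Complex.norm_exp_I_mul_ofReal, mul_one]

/-- Polynomial growth of the kernel, inherited from the Bessel function. -/
lemma exists_norm_heatKer_le {d : ℕ} {a : ℝ} (ha : -1 < a) {t : ℝ} (ht : t ≠ 0) : ∃ C, 0 ≤ C ∧
    ∀ X Y : Pt d, ‖heatKer a X Y t‖ ≤ C * (1 + ‖X‖) ^ 2 * (1 + ‖Y‖) ^ 2 := by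
  obtain ⟨C, hC, h⟩ := exists_abs_bes_le (s := (a + 1) / 2) (by linarith)
  set A := ‖(4 * Real.pi * Complex.I * t : ℂ) ^ (-(d / 2 : ℂ))‖
  set B := 2 * (4 * |t|) ^ (-((a + 1) / 2))
  set τ := ((4 * t) ^ 2)⁻¹
  have hτ : 0 ≤ τ := by positivity
  refine ⟨B * (C * (1 + τ)) * A, by positivity, fun X Y => ?_⟩
  have h1 : |bes ((a + 1) / 2) ((X.2 / (4 * t)) ^ 2 * Y.2 ^ 2)|
      ≤ C * (1 + τ) * ((1 + ‖X‖) ^ 2 * (1 + ‖Y‖) ^ 2) := by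
    refine (h _ (by positivity)).trans ?_
    rw [mul_assoc]
    refine mul_le_mul_of_nonneg_left ?_ hC.le
    have e : (X.2 / (4 * t)) ^ 2 * Y.2 ^ 2 = τ * (X.2 ^ 2 * Y.2 ^ 2) := by
      rw [div_pow, div_eq_mul_inv]
      ring
    have hX : X.2 ^ 2 ≤ (1 + ‖X‖) ^ 2 := by
      rw [← sq_abs]
      have := norm_snd_le X
      rw [Real.norm_eq_abs] at this
      gcongr
      linarith
    have hY : Y.2 ^ 2 ≤ (1 + ‖Y‖) ^ 2 := by
      rw [← sq_abs]
      have := norm_snd_le Y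
      rw [Real.norm_eq_abs] at this
      gcongr
      linarith
    have h1' : 1 ≤ (1 + ‖X‖) ^ 2 * (1 + ‖Y‖) ^ 2 :=
      one_le_mul_of_one_le_of_one_le (one_le_pow₀ (by linarith [norm_nonneg X]))
        (one_le_pow₀ (by linarith [norm_nonneg Y]))
    rw [e, add_mul, one_mul]
    gcongr
  rw [heatKer, norm_mul, norm_heatZ, norm_kerX]
  calc _ ≤ B * (C * (1 + τ) * ((1 + ‖X‖) ^ 2 * (1 + ‖Y‖) ^ 2)) * A := by gcongr
    _ = _ := by ring

lemma measurable_heatKer {d : ℕ} {a : ℝ} (ha : -1 < a) :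
    Measurable fun P : (Pt d × Pt d) × ℝ => heatKer a P.1.1 P.1.2 P.2 := by
  have hb := (continuous_bes (s := (a + 1) / 2) (by linarith)).measurable
  have h1 : Measurable fun P : (Pt d × Pt d) × ℝ =>
      bes ((a + 1) / 2) ((P.1.1.2 / (4 * P.2)) ^ 2 * P.1.2.2 ^ 2) := hb.comp (by fun_prop)
  unfold heatKer heatZ kerX
  fun_prop

/-! ### The group as an integral operator -/

section Kernel

variable {d : ℕ} {a : ℝ} {u : Pt d → ℂ}

/-- The integral operator with the kernel `heatKer`. -/
def heatInt (a : ℝ) (u : Pt d → ℂ) (t : ℝ) (X : Pt d) : ℂ :=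
  ∫ Y, heatKer a X Y t * u Y ∂(omega d a)

lemma IsRapid.integrable_heatKer_mul (hu : IsRapid a u) (ha : -1 < a) (ha' : a < 1) {t : ℝ}
    (ht : t ≠ 0) (X : Pt d) : Integrable (fun Y => heatKer a X Y t * u Y) (omega d a) := by
  obtain ⟨C, hC, h⟩ := exists_norm_heatKer_le (d := d) ha ht
  refine hu.integrable_of_le ha ha' (C := C * (1 + ‖X‖) ^ 2) (N := 2)
    (AEStronglyMeasurable.mul ?_ hu.meas)
    fun Y _ => ?_
  · exact ((measurable_heatKer ha).comp
      (show Measurable fun Y : Pt d => ((X, Y), t) by fun_prop)).aestronglyMeasurable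
  · rw [norm_mul]
    gcongr
    exact h X Y

lemma IsRapid.integrable_prod_heatKer (hu : IsRapid a u) (ha : -1 < a) (ha' : a < 1) {t : ℝ}
    (ht : t ≠ 0) (p : GaussParam d) :
    Integrable (fun P : Pt d × Pt d => heatKer a P.1 P.2 t * u P.2 * gaussP a p P.1)
      ((omega d a).prod (omega d a)) := by
  obtain ⟨C, hC, h⟩ := exists_norm_heatKer_le (d := d) ha ht
  have rγ := isRapid_gauss (a := a) ha p.1.2 p.2
  refine (((rγ.integrable_weight ha ha').mul_prod (hu.integrable_weight ha ha')).const_mul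
    C).mono' ?_ (ae_of_all _ fun P => ?_)
  · refine AEStronglyMeasurable.mul (AEStronglyMeasurable.mul ?_ hu.meas.comp_snd) rγ.meas.comp_fst
    exact ((measurable_heatKer ha).comp
      (show Measurable fun P : Pt d × Pt d => (P, t) by fun_prop)).aestronglyMeasurable
  · rw [norm_mul, norm_mul]
    calc _ ≤ C * (1 + ‖P.1‖) ^ 2 * (1 + ‖P.2‖) ^ 2 * ‖u P.2‖ * ‖gaussP a p P.1‖ := by
          gcongr
          exact h P.1 P.2
      _ = _ := by ring

lemma IsRapid.integrable_heatInt_mul (hu : IsRapid a u) (ha : -1 < a) (ha' : a < 1) {t : ℝ}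
    (ht : t ≠ 0) (p : GaussParam d) :
    Integrable (fun X => heatInt a u t X * gaussP a p X) (omega d a) := by
  refine (hu.integrable_prod_heatKer ha ha' ht p).integral_prod_left.congr (ae_of_all _ fun X => ?_)
  simp only [integral_mul_const]
  rfl

/-- The kernel is symmetric and maps Gaussians to Gaussians. -/
lemma IsRapid.pair_heatInt (hu : IsRapid a u) (ha : -1 < a) (ha' : a < 1) {t : ℝ} (ht : t ≠ 0)
    (p : GaussParam d) : pair (a := a) (heatInt a u t) p = pair (a := a) u (shift t p) := by
  have h := integral_integral_swap
    (f := fun X Y => heatKer a X Y t * u Y * gaussP a p X) (hu.integrable_prod_heatKer ha ha' ht p)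
  simp only [integral_mul_const] at h
  refine h.trans (integral_congr_ae (ae_of_all _ fun Y => ?_))
  have h2 := integral_heatKer_mul_gauss ha Y ht p.1.2 p.2
  simp only [gaussP, shift]
  rw [← h2, ← integral_const_mul]
  refine integral_congr_ae (ae_of_all _ fun X => ?_)
  simp only
  rw [heatKer_comm]
  ring

/-- On rapidly decreasing functions the group is the integral operator. -/
lemma IsRapid.evol_eq_heatInt (hu : IsRapid a u) (ha : -1 < a) (ha' : a < 1) {t : ℝ} (ht : t ≠ 0) :
    evol ha ha' t (hu.memLp ha ha').toLp =ᵐ[omega d a] heatInt a u t := by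
  have key : (fun X => evol ha ha' t (hu.memLp ha ha').toLp X - heatInt a u t X)
      =ᵐ[omega d a] 0 := by
    have hi : ∀ p : GaussParam d, _ := fun p =>
      integrable_mul_gaussP ha ha' (Lp.memLp (evol ha ha' t (hu.memLp ha ha').toLp)) p
    refine ae_eq_zero_of_forall_gauss (fun q b hq => ?_) fun q b hq => ?_
    · simp_rw [sub_mul]
      exact (hi (⟨q, hq⟩, b)).sub (hu.integrable_heatInt_mul ha ha' ht (⟨q, hq⟩, b))
    · simp_rw [sub_mul]
      have h1 := hu.integrable_heatInt_mul ha ha' ht (⟨q, hq⟩, b)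
      rw [integral_sub (hi (⟨q, hq⟩, b)) h1, sub_eq_zero]
      refine (pair_evol ha ha' t _ (⟨q, hq⟩, b)).trans
        (Eq.trans ?_ (hu.pair_heatInt ha ha' ht (⟨q, hq⟩, b)).symm)
      refine integral_congr_ae ?_
      filter_upwards [MemLp.coeFn_toLp (hu.memLp ha ha')] with X hX
      rw [hX]
  filter_upwards [key] with X hX
  exact sub_eq_zero.mp hX

end Kernel

/-! ### Integrals over time -/

/-- Integration in time of a family of functions whose products with Gaussians have locally
integrable norms. -/
lemma time_integral {d : ℕ} {a : ℝ} {k : ℝ → Pt d → ℂ} (t : ℝ)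
    (hk : Measurable fun P : ℝ × Pt d => k P.1 P.2)
    (h : ∀ p : GaussParam d, ∃ B : ℝ → ℝ, IntervalIntegrable B volume 0 t ∧ ∀ τ ∈ uIoc 0 t, τ ≠ t →
      Integrable (fun X => k τ X * gaussP a p X) (omega d a) ∧
      ∫ X, ‖k τ X * gaussP a p X‖ ∂(omega d a) ≤ B τ) :
    (∀ᵐ X ∂(omega d a), IntervalIntegrable (fun τ => k τ X) volume 0 t) ∧
    ∀ p : GaussParam d,
      Integrable (fun X => (∫ τ in (0 : ℝ)..t, k τ X) * gaussP a p X) (omega d a) ∧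
      IntervalIntegrable (fun τ => pair (a := a) (k τ) p) volume 0 t ∧
      pair (a := a) (fun X => ∫ τ in (0 : ℝ)..t, k τ X) p
        = ∫ τ in (0 : ℝ)..t, pair (a := a) (k τ) p := by
  have hint : ∀ p : GaussParam d, Integrable (fun P : ℝ × Pt d => k P.1 P.2 * gaussP a p P.2)
      ((volume.restrict (uIoc 0 t)).prod (omega d a)) := by
    intro p
    obtain ⟨B, hB, hB'⟩ := h p
    have hm : Measurable fun P : ℝ × Pt d => k P.1 P.2 * gaussP a p P.2 :=
      hk.mul ((continuous_gauss a _ _).measurable.comp measurable_snd)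
    have hae : ∀ᵐ τ ∂(volume.restrict (uIoc 0 t)), τ ∈ uIoc 0 t ∧ τ ≠ t := by
      refine (ae_restrict_mem measurableSet_uIoc).and ?_
      exact ae_restrict_of_ae (Measure.ae_ne volume t)
    rw [integrable_prod_iff hm.aestronglyMeasurable]
    refine ⟨hae.mono fun τ hτ => (hB' τ hτ.1 hτ.2).1, ?_⟩
    refine (intervalIntegrable_iff.mp hB).mono' ?_ (hae.mono fun τ hτ => ?_)
    · exact hm.aestronglyMeasurable.norm.integral_prod_right'
    · rw [Real.norm_eq_abs, abs_of_nonneg (integral_nonneg fun _ => norm_nonneg _)]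
      exact (hB' τ hτ.1 hτ.2).2
  refine ⟨?_, fun p => ⟨?_, ?_, ?_⟩⟩
  · -- A Gaussian has no zeros, hence can be divided out of an integrability statement in time.
    let p : GaussParam d := (⟨1, by simp⟩, 0)
    filter_upwards [(hint p).prod_left_ae] with X hX
    rw [intervalIntegrable_iff]
    have h0 : gaussP a p X ≠ 0 := by simp [gauss, gaussX, gaussZ, p]
    exact (integrable_mul_const_iff (IsUnit.mk0 _ h0) _).mp hX
  · simp_rw [intervalIntegral.intervalIntegral_eq_integral_uIoc, smul_mul_assoc,
      ← integral_mul_const]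
    exact (hint p).integral_prod_right.smul _
  · rw [intervalIntegrable_iff]
    exact (hint p).integral_prod_left
  · simp only [pair, intervalIntegral.intervalIntegral_eq_integral_uIoc, smul_mul_assoc,
      ← integral_mul_const]
    rw [integral_smul]
    congr 1
    exact (integral_integral_swap (f := fun τ X => k τ X * gaussP a p X) (hint p)).symm

/-! ### Schwartz functions as rapidly decreasing families -/

section SchwartzTime

variable {E : Type*} [NormedAddCommGroup E] [NormedSpace ℝ E]

lemma exists_norm_schwartz_prod_le (V : 𝓢(E × ℝ, ℂ)) (N : ℕ) :
    ∃ C, 0 ≤ C ∧ ∀ x τ, ‖V (x, τ)‖ ≤ C * ((1 + ‖x‖) ^ N)⁻¹ := by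
  obtain ⟨C, hC, h⟩ := exists_norm_schwartz_le V N
  refine ⟨C, hC, fun x τ => (h (x, τ)).trans ?_⟩
  have : ‖x‖ ≤ ‖((x, τ) : E × ℝ)‖ := norm_fst_le (x, τ)
  gcongr

lemma exists_norm_schwartz_sub_le (V : 𝓢(E × ℝ, ℂ)) (N : ℕ) :
    ∃ C, 0 ≤ C ∧ ∀ x τ σ, ‖V (x, τ) - V (x, σ)‖ ≤ C * |τ - σ| * ((1 + ‖x‖) ^ N)⁻¹ := by
  obtain ⟨C, hC, h⟩ := exists_norm_schwartz_prod_le (LineDeriv.lineDerivOp ((0, 1) : E × ℝ) V) N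
  refine ⟨C, hC, fun x τ σ => ?_⟩
  have hd : ∀ s, HasDerivAt (fun s => V (x, s))
      (LineDeriv.lineDerivOp ((0, 1) : E × ℝ) V (x, s)) s := by
    intro s
    rw [SchwartzMap.lineDerivOp_apply_eq_fderiv]
    have h1 : HasDerivAt (fun s : ℝ => (x, s)) ((0, 1) : E × ℝ) s :=
      (hasDerivAt_const s x).prodMk (hasDerivAt_id s)
    exact V.differentiableAt.hasFDerivAt.comp_hasDerivAt s h1
  have := Convex.norm_image_sub_le_of_norm_hasDerivWithin_le (s := univ)
    (fun s _ => (hd s).hasDerivWithinAt) (fun s _ => h x s) convex_univ (mem_univ σ) (mem_univ τ)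
  rw [Real.norm_eq_abs] at this
  linarith

end SchwartzTime

lemma isRapidFamily_schwartz {d : ℕ} (F : 𝓢(Pt d × ℝ, ℂ)) : IsRapidFamily fun τ X => F (X, τ) where
  meas := (F.continuous.comp (by fun_prop : Continuous fun P : ℝ × Pt d => (P.2, P.1))).measurable
  decay N := by
    obtain ⟨C, hC, h⟩ := exists_norm_schwartz_prod_le F N
    exact ⟨C, hC, fun τ X _ => h X τ⟩
  lip N := by
    obtain ⟨C, hC, h⟩ := exists_norm_schwartz_sub_le F N
    exact ⟨C, hC, fun τ σ X _ => h X τ σ⟩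

lemma isRapidFamily_mul_schwartz {d : ℕ} {ψ : ℝ → ℂ} (hψ : Measurable ψ)
    (h : ∀ N : ℕ, ∃ C, 0 ≤ C ∧ ∀ z, 0 < z → ‖ψ z‖ ≤ C * ((1 + |z|) ^ N)⁻¹) (Φ : 𝓢(Pt d, ℂ)) :
    IsRapidFamily fun τ (X : Pt d) => ψ X.2 * Φ (X.1, τ) := by
  have hw : ∀ (N : ℕ) (X : Pt d),
      ((1 + |X.2|) ^ N)⁻¹ * ((1 + ‖X.1‖) ^ N)⁻¹ ≤ ((1 + ‖X‖) ^ N)⁻¹ := by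
    intro N X
    rw [← mul_inv, ← mul_pow]
    have h1 : ‖X‖ ≤ ‖X.1‖ + |X.2| := by
      rw [Prod.norm_def, Real.norm_eq_abs]
      exact max_le (by linarith [abs_nonneg X.2]) (by linarith [norm_nonneg X.1])
    gcongr
    nlinarith [mul_nonneg (abs_nonneg X.2) (norm_nonneg X.1)]
  refine ⟨?_, fun N => ?_, fun N => ?_⟩
  · exact (hψ.comp (by fun_prop)).mul
      (Φ.continuous.comp (by fun_prop : Continuous fun P : ℝ × Pt d => (P.2.1, P.1))).measurable
  · obtain ⟨C, hC, h1⟩ := h N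
    obtain ⟨D, hD, h2⟩ := exists_norm_schwartz_prod_le Φ N
    refine ⟨C * D, by positivity, fun τ X hX => ?_⟩
    rw [norm_mul]
    calc _ ≤ (C * ((1 + |X.2|) ^ N)⁻¹) * (D * ((1 + ‖X.1‖) ^ N)⁻¹) := by
          gcongr
          · exact h1 _ hX
          · exact h2 _ _
      _ = C * D * (((1 + |X.2|) ^ N)⁻¹ * ((1 + ‖X.1‖) ^ N)⁻¹) := by ring
      _ ≤ _ := by
          gcongr
          exact hw N X
  · obtain ⟨C, hC, h1⟩ := h N
    obtain ⟨D, hD, h2⟩ := exists_norm_schwartz_sub_le Φ N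
    refine ⟨C * D, by positivity, fun τ σ X hX => ?_⟩
    rw [← mul_sub, norm_mul]
    calc _ ≤ (C * ((1 + |X.2|) ^ N)⁻¹) * (D * |τ - σ| * ((1 + ‖X.1‖) ^ N)⁻¹) := by
          gcongr
          · exact h1 _ hX
          · exact h2 _ _ _
      _ = C * D * |τ - σ| * (((1 + |X.2|) ^ N)⁻¹ * ((1 + ‖X.1‖) ^ N)⁻¹) := by ring
      _ ≤ _ := by
          gcongr
          exact hw N X

/-! ### The forcing term -/

section Forcing

variable {d : ℕ} {a : ℝ}

/-- The time integral of the forcing term converges, because the group is isometric and hence the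
integrals of `heatInt` against a Gaussian are bounded up to `τ = t`. -/
lemma IsRapidFamily.time_integral_heatInt {v : ℝ → Pt d → ℂ} (hv : IsRapidFamily v) (ha : -1 < a)
    (ha' : a < 1) (t : ℝ) :
    (∀ᵐ X ∂(omega d a), IntervalIntegrable (fun τ => heatInt a (v τ) (t - τ) X) volume 0 t) ∧
    ∀ p : GaussParam d,
      Integrable (fun X => (∫ τ in (0 : ℝ)..t, heatInt a (v τ) (t - τ) X) * gaussP a p X)
        (omega d a) ∧
      pair (a := a) (fun X => ∫ τ in (0 : ℝ)..t, heatInt a (v τ) (t - τ) X) p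
        = ∫ τ in (0 : ℝ)..t, pair (a := a) (v τ) (shift (t - τ) p) := by
  have hm : Measurable fun P : ℝ × Pt d => heatInt a (v P.1) (t - P.1) P.2 := by
    have h1 : Measurable fun Q : (ℝ × Pt d) × Pt d =>
        heatKer a Q.1.2 Q.2 (t - Q.1.1) * v Q.1.1 Q.2 :=
      ((measurable_heatKer ha).comp (show Measurable fun Q : (ℝ × Pt d) × Pt d =>
        ((Q.1.2, Q.2), t - Q.1.1) by fun_prop)).mul
        (hv.meas.comp (show Measurable fun Q : (ℝ × Pt d) × Pt d => (Q.1.1, Q.2) by fun_prop))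
    exact (h1.stronglyMeasurable.integral_prod_right' (ν := omega d a)).measurable
  obtain ⟨C, hC, hn⟩ := hv.exists_norm_toL2_le ha ha'
  obtain ⟨h1, h2⟩ := time_integral (a := a) t hm fun p => by
    refine ⟨fun _ => C * ‖gaussL2 ha ha' p‖, intervalIntegrable_const, fun τ _ hτ => ?_⟩
    have hτ' : t - τ ≠ 0 := sub_ne_zero.mpr hτ.symm
    refine ⟨(hv.isRapid a τ).integrable_heatInt_mul ha ha' hτ' p, ?_⟩
    have e := (hv.isRapid a τ).evol_eq_heatInt ha ha' hτ'
    have e' : evol ha ha' (t - τ) (hv.toL2 ha ha' τ) =ᵐ[omega d a] heatInt a (v τ) (t - τ) := e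
    have h3 := integral_norm_mul_le (Lp.memLp (evol ha ha' (t - τ) (hv.toL2 ha ha' τ)))
      (memLp_gaussP ha ha' p)
    rw [Lp.toLp_coeFn, norm_evol] at h3
    refine le_trans (le_of_eq (integral_congr_ae ?_)) (h3.trans ?_)
    · filter_upwards [e'] with X hX
      rw [hX]
    · exact mul_le_mul_of_nonneg_right (hn τ) (norm_nonneg _)
  refine ⟨h1, fun p => ⟨(h2 p).1, (h2 p).2.2.trans ?_⟩⟩
  refine intervalIntegral.integral_congr_ae ?_
  filter_upwards [Measure.ae_ne volume t] with τ hτ _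
  exact (hv.isRapid a τ).pair_heatInt ha ha' (sub_ne_zero.mpr hτ.symm) p

end Forcing

/-! ### The boundary term -/

section Boundary

variable {d : ℕ} {a : ℝ}

/-- The integral operator with the boundary kernel. -/
def bdryInt (a : ℝ) (φ : EuclideanSpace ℝ (Fin d) → ℂ) (t : ℝ) (X : Pt d) : ℂ :=
  ∫ y, heatKer a X (y, 0) t * φ y

lemma integrable_weight_mul_schwartz (Φ : 𝓢(Pt d, ℂ)) (τ : ℝ) :
    Integrable fun y : EuclideanSpace ℝ (Fin d) => (1 + ‖y‖) ^ 2 * ‖Φ (y, τ)‖ := by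
  obtain ⟨C, hC, h⟩ := exists_norm_schwartz_prod_le Φ (2 + (d + 1))
  have hc : Continuous fun y : EuclideanSpace ℝ (Fin d) => (1 + ‖y‖) ^ 2 * ‖Φ (y, τ)‖ := by
    have := Φ.continuous.comp (by fun_prop :
      Continuous fun y : EuclideanSpace ℝ (Fin d) => ((y, τ) : Pt d))
    exact Continuous.mul (by fun_prop) this.norm
  refine ((integrable_one_add_norm_pow_euclidean d).const_mul C).mono' hc.aestronglyMeasurable
    (ae_of_all _ fun y => ?_)
  rw [Real.norm_eq_abs, abs_of_nonneg (by positivity)]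
  calc _ ≤ (1 + ‖y‖) ^ 2 * (C * ((1 + ‖y‖) ^ (2 + (d + 1)))⁻¹) := by
        gcongr
        exact h y τ
    _ = _ := by
        rw [pow_add]
        field_simp

lemma integrable_bdryInt (ha : -1 < a) {t : ℝ} (ht : t ≠ 0) (Φ : 𝓢(Pt d, ℂ)) (τ : ℝ) (X : Pt d) :
    Integrable fun y : EuclideanSpace ℝ (Fin d) => heatKer a X (y, 0) t * Φ (y, τ) := by
  obtain ⟨C, hC, h⟩ := exists_norm_heatKer_le (d := d) ha ht
  have hm : Measurable fun y : EuclideanSpace ℝ (Fin d) => heatKer a X (y, 0) t * Φ (y, τ) :=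
    ((measurable_heatKer ha).comp (show Measurable fun y : EuclideanSpace ℝ (Fin d) =>
      (((X, (y, 0)), t) : (Pt d × Pt d) × ℝ) by fun_prop)).mul
      (Φ.continuous.measurable.comp (by fun_prop))
  refine ((integrable_weight_mul_schwartz Φ τ).const_mul (C * (1 + ‖X‖) ^ 2)).mono'
    hm.aestronglyMeasurable (ae_of_all _ fun y => ?_)
  have h1 := h X (y, 0)
  rw [show ‖((y, 0) : Pt d)‖ = ‖y‖ by simp [Prod.norm_def]] at h1
  rw [norm_mul, ← mul_assoc]
  gcongr

lemma integrable_prod_bdry (ha : -1 < a) (ha' : a < 1) {t : ℝ} (ht : t ≠ 0) (Φ : 𝓢(Pt d, ℂ)) (τ : ℝ)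
    (p : GaussParam d) :
    Integrable (fun P : Pt d × EuclideanSpace ℝ (Fin d) =>
      heatKer a P.1 (P.2, 0) t * Φ (P.2, τ) * gaussP a p P.1) ((omega d a).prod volume) := by
  obtain ⟨C, hC, h⟩ := exists_norm_heatKer_le (d := d) ha ht
  have rγ := isRapid_gauss (a := a) ha p.1.2 p.2
  have hm : Measurable fun P : Pt d × EuclideanSpace ℝ (Fin d) =>
      heatKer a P.1 (P.2, 0) t * Φ (P.2, τ) * gaussP a p P.1 :=
    (((measurable_heatKer ha).comp (show Measurable fun P : Pt d × EuclideanSpace ℝ (Fin d) =>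
      (((P.1, (P.2, 0)), t) : (Pt d × Pt d) × ℝ) by fun_prop)).mul
      (Φ.continuous.measurable.comp (by fun_prop))).mul
      ((continuous_gauss a _ _).measurable.comp measurable_fst)
  refine (((rγ.integrable_weight ha ha').mul_prod (integrable_weight_mul_schwartz Φ τ)).const_mul
    C).mono' hm.aestronglyMeasurable (ae_of_all _ fun P => ?_)
  have h1 := h P.1 (P.2, 0)
  rw [show ‖((P.2, 0) : Pt d)‖ = ‖P.2‖ by simp [Prod.norm_def]] at h1
  rw [norm_mul, norm_mul]
  calc _ ≤ C * (1 + ‖P.1‖) ^ 2 * (1 + ‖P.2‖) ^ 2 * ‖Φ (P.2, τ)‖ * ‖gaussP a p P.1‖ := by gcongr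
    _ = _ := by ring

lemma integrable_bdryInt_mul (ha : -1 < a) (ha' : a < 1) {t : ℝ} (ht : t ≠ 0) (Φ : 𝓢(Pt d, ℂ))
    (τ : ℝ) (p : GaussParam d) :
    Integrable (fun X => bdryInt a (fun y => Φ (y, τ)) t X * gaussP a p X) (omega d a) := by
  refine (integrable_prod_bdry ha ha' ht Φ τ p).integral_prod_left.congr (ae_of_all _ fun X => ?_)
  simp only [integral_mul_const]
  rfl

lemma pair_bdryInt (ha : -1 < a) (ha' : a < 1) {t : ℝ} (ht : t ≠ 0) (Φ : 𝓢(Pt d, ℂ)) (τ : ℝ)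
    (p : GaussParam d) : pair (a := a) (bdryInt a (fun y => Φ (y, τ)) t) p
      = ∫ y, Φ (y, τ) * gaussP a (shift t p) (y, 0) := by
  have h := integral_integral_swap (f := fun X (y : EuclideanSpace ℝ (Fin d)) =>
    heatKer a X (y, 0) t * Φ (y, τ) * gaussP a p X) (integrable_prod_bdry ha ha' ht Φ τ p)
  simp only [integral_mul_const] at h
  refine h.trans (integral_congr_ae (ae_of_all _ fun y => ?_))
  have h2 := integral_heatKer_mul_gauss ha (y, 0) ht p.1.2 p.2
  simp only [gaussP, shift]
  rw [← h2, ← integral_const_mul]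
  refine integral_congr_ae (ae_of_all _ fun X => ?_)
  simp only
  rw [heatKer_comm]
  ring

/-- The boundary integral differs from the evolution of a tensor product with a Gaussian in `z` only
by an explicit factor. -/
lemma bdryInt_mul_gaussZ (ha : -1 < a) {t : ℝ} (ht : t ≠ 0) {q : ℂ} (hq : 0 < q.re)
    (φ : EuclideanSpace ℝ (Fin d) → ℂ) (X : Pt d) :
    bdryInt a φ t X * gaussZ a (q + 4 * Complex.I * t) X.2
      = heatZ a X.2 0 t * heatInt a (fun Y => gaussZ a q Y.2 * φ Y.1) t X := by
  have h1 : heatInt a (fun Y => gaussZ a q Y.2 * φ Y.1) t X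
      = (∫ y, kerX X.1 y t * φ y) * gaussZ a (q + 4 * Complex.I * t) X.2 := by
    rw [heatInt, omega_eq_prod, ← integral_heatZ_mul_gaussZ ha X.2 ht hq, ← integral_prod_mul]
    refine integral_congr_ae (ae_of_all _ fun Y => ?_)
    simp only [heatKer]
    ring
  have h2 : bdryInt a φ t X = heatZ a X.2 0 t * ∫ y, kerX X.1 y t * φ y := by
    rw [bdryInt, ← integral_const_mul]
    refine integral_congr_ae (ae_of_all _ fun y => ?_)
    simp only [heatKer]
    ring
  rw [h1, h2]
  ring

lemma le_norm_gaussZ (ha : -1 < a) {q T t : ℝ} (hq : 0 < q) (ht : |t| ≤ T) (z : ℝ) :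
    (q + 4 * T) ^ (-((a + 1) / 2)) * Real.exp (-(z ^ 2 / q))
      ≤ ‖gaussZ a (q + 4 * Complex.I * t) z‖ := by
  set w : ℂ := q + 4 * Complex.I * t with hw
  have hre : w.re = q := by simp [hw]
  have him : w.im = 4 * t := by simp [hw]
  have hw0 : 0 < ‖w‖ := norm_pos_iff.mpr (ne_zero_of_re_pos (by rw [hre]; exact hq))
  have h1 : ‖w‖ ≤ q + 4 * T := by
    refine (norm_add_le _ _).trans ?_
    simp only [Complex.norm_real, Real.norm_eq_abs, norm_mul, Complex.norm_ofNat, Complex.norm_I,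
      mul_one, abs_of_pos hq]
    linarith
  have h2 : (-(z : ℂ) ^ 2 / w).re = -(z ^ 2 * (q / ‖w‖ ^ 2)) := by
    rw [← Complex.ofReal_pow, ← Complex.ofReal_neg, div_eq_mul_inv, Complex.re_ofReal_mul,
      Complex.inv_re, hre, Complex.sq_norm]
    ring
  have h3 : q / ‖w‖ ^ 2 ≤ 1 / q := by
    rw [div_le_div_iff₀ (by positivity) hq, one_mul, ← sq, Complex.sq_norm,
      Complex.normSq_apply, hre,
      him]
    nlinarith [sq_nonneg t]
  rw [gaussZ, norm_mul, ← Complex.ofReal_neg, Complex.norm_cpow_real, Complex.norm_exp, h2]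
  refine mul_le_mul ?_ ?_ (Real.exp_pos _).le (by positivity)
  · exact Real.rpow_le_rpow_of_nonpos hw0 h1 (by linarith)
  · refine Real.exp_le_exp.mpr (neg_le_neg ?_)
    rw [div_eq_mul_one_div (z ^ 2)]
    gcongr

/-- The time singularity of the boundary term is `|t - τ| ^ (-(a + 1) / 2)`, which is integrable. -/
lemma exists_integral_norm_bdryInt_le (ha : -1 < a) (ha' : a < 1) (Φ : 𝓢(Pt d, ℂ))
    (p : GaussParam d) (T : ℝ) : ∃ C, ∀ t τ : ℝ, t ≠ 0 → |t| ≤ T →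
      ∫ X, ‖bdryInt a (fun y => Φ (y, τ)) t X * gaussP a p X‖ ∂(omega d a)
        ≤ C * |t| ^ (-((a + 1) / 2)) := by
  obtain ⟨C, ρ, hC, hρ, hγ⟩ := exists_norm_gauss_le ha p.1.2 p.2 le_rfl
  -- The Gaussian in `z` is chosen wider than the one of parameters `p`, to be divided by.
  set q : ℝ := 2 / ρ with hqdef
  have hq : 0 < q := by positivity
  have hqc : 0 < (q : ℂ).re := by simpa using hq
  have hfam : IsRapidFamily fun τ (X : Pt d) => gaussZ a q X.2 * Φ (X.1, τ) := by
    refine isRapidFamily_mul_schwartz ?_ (fun N => ?_) Φ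
    · unfold gaussZ
      fun_prop
    · obtain ⟨D, hD, h⟩ := (isRapid_gauss (d := 0) (a := a) ha hqc 0).decay N
      refine ⟨D, hD, fun z hz => ?_⟩
      have := h (0, z) hz
      simpa [gauss, gaussX, Prod.norm_def] using this
  obtain ⟨M, hM, hn⟩ := hfam.exists_norm_toL2_le ha ha'
  have hw := memLp_exp_neg_sq (d := d) ha ha' (half_pos hρ)
  have hwc := hw.ofReal (K := ℂ)
  set K : ℝ := 2 * 4 ^ (-((a + 1) / 2)) * |bes ((a + 1) / 2) 0| * (q + 4 * T) ^ ((a + 1) / 2) * C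
  refine ⟨K * (M * ‖hwc.toLp‖), fun t τ ht htT => ?_⟩
  have hT : 0 ≤ T := (abs_nonneg t).trans htT
  have hqT : 0 < q + 4 * T := by positivity
  set v : L2 d a := hfam.toL2 ha ha' τ
  have hv : evol ha ha' t v =ᵐ[omega d a] heatInt a (fun X => gaussZ a q X.2 * Φ (X.1, τ)) t :=
    (hfam.isRapid a τ).evol_eq_heatInt ha ha' ht
  have hpt : ∀ᵐ X ∂(omega d a), ‖bdryInt a (fun y => Φ (y, τ)) t X * gaussP a p X‖
      ≤ K * |t| ^ (-((a + 1) / 2)) * ‖evol ha ha' t v X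
        * ((Real.exp (-(ρ / 2) * (‖X.1‖ ^ 2 + X.2 ^ 2)) : ℝ) : ℂ)‖ := by
    filter_upwards [hv] with X hX
    have h1 := congrArg norm (bdryInt_mul_gaussZ ha ht hqc (fun y => Φ (y, τ)) X)
    rw [norm_mul, norm_mul, norm_heatZ] at h1
    have h2 := le_norm_gaussZ ha hq htT X.2
    have h3 : ‖gaussP a p X‖ ≤ C * (Real.exp (-(ρ / 2) * (‖X.1‖ ^ 2 + X.2 ^ 2))
        * Real.exp (-(X.2 ^ 2 / q))) := by
      have := hγ 0 (by simp) X
      rw [Complex.ofReal_zero, mul_zero, add_zero] at this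
      refine this.trans (mul_le_mul_of_nonneg_left ?_ hC)
      rw [← Real.exp_add]
      refine Real.exp_le_exp.mpr ?_
      have : X.2 ^ 2 / q = ρ / 2 * X.2 ^ 2 := by rw [hqdef]; field_simp
      rw [this]
      nlinarith [mul_nonneg hρ.le (sq_nonneg ‖X.1‖)]
    set E := Real.exp (-(X.2 ^ 2 / q))
    set E' := Real.exp (-(ρ / 2) * (‖X.1‖ ^ 2 + X.2 ^ 2))
    set b := ‖bdryInt a (fun y => Φ (y, τ)) t X‖
    have h4 : b * E ≤ (q + 4 * T) ^ ((a + 1) / 2) * (2 * (4 * |t|) ^ (-((a + 1) / 2))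
        * |bes ((a + 1) / 2) 0|) * ‖evol ha ha' t v X‖ := by
      have h5 : b * ((q + 4 * T) ^ (-((a + 1) / 2)) * E)
          ≤ b * ‖gaussZ a (q + 4 * Complex.I * t) X.2‖ :=
        mul_le_mul_of_nonneg_left h2 (norm_nonneg _)
      have h6 : (q + 4 * T) ^ ((a + 1) / 2) * (q + 4 * T) ^ (-((a + 1) / 2)) = 1 := by
        rw [← Real.rpow_add hqT, add_neg_cancel, Real.rpow_zero]
      have h7 := mul_le_mul_of_nonneg_left (h5.trans h1.le)
        (Real.rpow_nonneg hqT.le ((a + 1) / 2))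
      have h8 : (q + 4 * T) ^ ((a + 1) / 2) * (b * ((q + 4 * T) ^ (-((a + 1) / 2)) * E))
          = b * E := by
        linear_combination (b * E) * h6
      rw [h8, ← hX] at h7
      refine h7.trans (le_of_eq ?_)
      simp only [ne_eq, OfNat.ofNat_ne_zero, not_false_eq_true, zero_pow, mul_zero]
      ring
    rw [norm_mul, norm_mul, Complex.norm_real, Real.norm_eq_abs, Real.abs_exp]
    calc _ ≤ b * (C * (E' * E)) := mul_le_mul_of_nonneg_left h3 (norm_nonneg _)
      _ = (b * E) * (C * E') := by ring
      _ ≤ ((q + 4 * T) ^ ((a + 1) / 2) * (2 * (4 * |t|) ^ (-((a + 1) / 2))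
        * |bes ((a + 1) / 2) 0|) * ‖evol ha ha' t v X‖) * (C * E') :=
          mul_le_mul_of_nonneg_right h4 (by positivity)
      _ = _ := by
          rw [Real.mul_rpow (by norm_num) (abs_nonneg t)]
          simp only [K]
          ring
  have hI := integral_norm_mul_le (Lp.memLp (evol ha ha' t v)) hwc
  rw [Lp.toLp_coeFn, norm_evol] at hI
  have hK : 0 ≤ K * |t| ^ (-((a + 1) / 2)) := by positivity
  calc _ ≤ ∫ X, K * |t| ^ (-((a + 1) / 2)) * ‖evol ha ha' t v X
        * ((Real.exp (-(ρ / 2) * (‖X.1‖ ^ 2 + X.2 ^ 2)) : ℝ) : ℂ)‖ ∂(omega d a) :=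
        integral_mono_ae (integrable_bdryInt_mul ha ha' ht Φ τ p).norm
          (((Lp.memLp (evol ha ha' t v)).integrable_mul hwc).norm.const_mul _) hpt
    _ ≤ K * |t| ^ (-((a + 1) / 2)) * (M * ‖hwc.toLp‖) := by
        rw [integral_const_mul]
        refine mul_le_mul_of_nonneg_left (hI.trans ?_) hK
        exact mul_le_mul_of_nonneg_right (hn τ) (norm_nonneg _)
    _ = _ := by ring

lemma intervalIntegrable_abs_rpow {r : ℝ} (hr : -1 < r) (t : ℝ) :
    IntervalIntegrable (fun x : ℝ => |x| ^ r) volume t 0 := by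
  have h : ∀ t, 0 ≤ t → IntervalIntegrable (fun x : ℝ => |x| ^ r) volume t 0 := by
    intro t ht
    refine (intervalIntegral.intervalIntegrable_rpow' hr).congr fun x hx => ?_
    rw [uIoc_of_ge ht] at hx
    rw [abs_of_pos hx.1]
  rcases le_total 0 t with h0 | h0
  · exact h t h0
  · simpa using (IntervalIntegrable.iff_comp_neg (by simp)).mp (h (-t) (by linarith))

lemma time_integral_bdryInt (ha : -1 < a) (ha' : a < 1) (Φ : 𝓢(Pt d, ℂ)) (t : ℝ) :
    (∀ᵐ X ∂(omega d a),
      IntervalIntegrable (fun τ => bdryInt a (fun y => Φ (y, τ)) (t - τ) X) volume 0 t) ∧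
    ∀ p : GaussParam d,
      Integrable (fun X => (∫ τ in (0 : ℝ)..t, bdryInt a (fun y => Φ (y, τ)) (t - τ) X)
        * gaussP a p X) (omega d a) ∧
      IntervalIntegrable (fun τ => ∫ y, Φ (y, τ) * gaussP a (shift (t - τ) p) (y, 0)) volume 0 t ∧
      pair (a := a) (fun X => ∫ τ in (0 : ℝ)..t, bdryInt a (fun y => Φ (y, τ)) (t - τ) X) p
        = ∫ τ in (0 : ℝ)..t, ∫ y, Φ (y, τ) * gaussP a (shift (t - τ) p) (y, 0) := by
  have hm : Measurable fun P : ℝ × Pt d => bdryInt a (fun y => Φ (y, P.1)) (t - P.1) P.2 := by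
    have h1 : Measurable fun Q : (ℝ × Pt d) × EuclideanSpace ℝ (Fin d) =>
        heatKer a Q.1.2 (Q.2, 0) (t - Q.1.1) * Φ (Q.2, Q.1.1) :=
      ((measurable_heatKer ha).comp
        (show Measurable fun Q : (ℝ × Pt d) × EuclideanSpace ℝ (Fin d) =>
        (((Q.1.2, (Q.2, 0)), t - Q.1.1) : (Pt d × Pt d) × ℝ) by fun_prop)).mul
        (Φ.continuous.measurable.comp (by fun_prop))
    exact (h1.stronglyMeasurable.integral_prod_right' (ν := volume)).measurable
  obtain ⟨h1, h2⟩ := time_integral (a := a) t hm fun p => by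
    obtain ⟨C, hC⟩ := exists_integral_norm_bdryInt_le ha ha' Φ p |t|
    refine ⟨fun τ => C * |t - τ| ^ (-((a + 1) / 2)), ?_, fun τ hτ hne => ?_⟩
    · have h3 : IntervalIntegrable (fun x : ℝ => |x| ^ (-((a + 1) / 2))) volume t 0 :=
        intervalIntegrable_abs_rpow (by linarith) t
      have h4 := h3.comp_sub_left t
      simp only [sub_self, sub_zero] at h4
      exact h4.const_mul C
    · have hne' : t - τ ≠ 0 := sub_ne_zero.mpr hne.symm
      refine ⟨integrable_bdryInt_mul ha ha' hne' Φ τ p, hC _ _ hne' ?_⟩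
      rcases le_total 0 t with h0 | h0
      · rw [uIoc_of_le h0] at hτ
        rw [abs_of_nonneg h0, abs_of_nonneg (by linarith [hτ.2])]
        linarith [hτ.1]
      · rw [uIoc_of_ge h0] at hτ
        rw [abs_of_nonpos h0, abs_of_nonpos (by linarith [hτ.1])]
        linarith [hτ.2]
  have hae : ∀ p : GaussParam d, ∀ᵐ τ : ℝ, τ ∈ uIoc 0 t →
      pair (a := a) (bdryInt a (fun y => Φ (y, τ)) (t - τ)) p
        = ∫ y, Φ (y, τ) * gaussP a (shift (t - τ) p) (y, 0) := by
    intro p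
    filter_upwards [Measure.ae_ne volume t] with τ hτ _
    exact pair_bdryInt ha ha' (sub_ne_zero.mpr hτ.symm) Φ τ p
  refine ⟨h1, fun p => ⟨(h2 p).1, (h2 p).2.1.congr_ae ?_, (h2 p).2.2.trans ?_⟩⟩
  · exact (ae_restrict_iff' measurableSet_uIoc).mpr (hae p)
  · exact intervalIntegral.integral_congr_ae (hae p)

end Boundary

/-! ### The lift of the Neumann datum -/

section Profile

variable {a R : ℝ} {h : ℝ → ℝ}

/-- The profile of the lift in the variable `z`. -/
def liftProfile (a : ℝ) (h : ℝ → ℝ) (z : ℝ) : ℝ := z ^ (1 - a) / (1 - a) * h z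

/-- The derivative of `liftProfile` on `z > 0`. -/
def liftProfile' (a : ℝ) (h : ℝ → ℝ) (z : ℝ) : ℝ :=
  z ^ (-a) * h z + z ^ (1 - a) / (1 - a) * deriv h z

/-- The Bessel operator applied to `liftProfile`, on `z > 0`. -/
def liftBessel (a : ℝ) (h : ℝ → ℝ) (z : ℝ) : ℝ :=
  (2 + a / (1 - a)) * z ^ (-a) * deriv h z + z ^ (1 - a) / (1 - a) * deriv (deriv h) z

lemma hasDerivAt_rpow_div (ha' : a < 1) {z : ℝ} (hz : 0 < z) :
    HasDerivAt (fun z : ℝ => z ^ (1 - a) / (1 - a)) (z ^ (-a)) z := by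
  refine ((Real.hasDerivAt_rpow_const (p := 1 - a) (Or.inl hz.ne')).div_const
    (1 - a)).congr_deriv ?_
  rw [mul_div_cancel_left₀ _ (by linarith : (1 - a) ≠ 0), show 1 - a - 1 = -a by ring]

lemma IsCutoff.hasDerivAt (hh : IsCutoff R h) (z : ℝ) : HasDerivAt h (deriv h z) z :=
  (hh.1.differentiable (by simp)).differentiableAt.hasDerivAt

lemma IsCutoff.contDiff_deriv (hh : IsCutoff R h) : ContDiff ℝ ∞ (deriv h) :=
  ((contDiff_infty_iff_deriv).mp hh.1).2

lemma IsCutoff.hasDerivAt_deriv (hh : IsCutoff R h) (z : ℝ) :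
    HasDerivAt (deriv h) (deriv (deriv h) z) z :=
  (hh.contDiff_deriv.differentiable (by simp)).differentiableAt.hasDerivAt

lemma IsCutoff.continuous_deriv_deriv (hh : IsCutoff R h) : Continuous (deriv (deriv h)) :=
  ((contDiff_infty_iff_deriv).mp hh.contDiff_deriv).2.continuous

lemma IsCutoff.deriv_eq_zero (hh : IsCutoff R h) {z : ℝ} (hz : z ∈ Ioo 0 R ∪ Ioi (2 * R)) :
    deriv h z = 0 := by
  rcases hz with hz | hz
  · have : h =ᶠ[𝓝 z] fun _ => 1 := by
      filter_upwards [isOpen_Ioo.mem_nhds hz] with y hy using hh.2.1 y (Ioo_subset_Icc_self hy)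
    rw [this.deriv_eq, deriv_const]
  · have : h =ᶠ[𝓝 z] fun _ => 0 := by
      filter_upwards [isOpen_Ioi.mem_nhds hz] with y hy using hh.2.2 y (le_of_lt hy)
    rw [this.deriv_eq, deriv_const]

lemma IsCutoff.deriv_deriv_eq_zero (hh : IsCutoff R h) {z : ℝ} (hz : z ∈ Ioo 0 R ∪ Ioi (2 * R)) :
    deriv (deriv h) z = 0 := by
  have : deriv h =ᶠ[𝓝 z] fun _ => 0 := by
    filter_upwards [(isOpen_Ioo.union isOpen_Ioi).mem_nhds hz] with y hy using hh.deriv_eq_zero hy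
  rw [this.deriv_eq, deriv_const]

lemma hasDerivAt_liftProfile (ha' : a < 1) (hh : IsCutoff R h) {z : ℝ} (hz : 0 < z) :
    HasDerivAt (liftProfile a h) (liftProfile' a h z) z :=
  (hasDerivAt_rpow_div ha' hz).fun_mul (hh.hasDerivAt z)

lemma hasDerivAt_liftProfile' (ha' : a < 1) (hh : IsCutoff R h) {z : ℝ} (hz : 0 < z) :
    HasDerivAt (liftProfile' a h) (liftBessel a h z - a / z * liftProfile' a h z) z := by
  have h1 := ((Real.hasDerivAt_rpow_const (p := -a) (Or.inl hz.ne')).fun_mul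
    (hh.hasDerivAt z)).fun_add
    ((hasDerivAt_rpow_div ha' hz).fun_mul (hh.hasDerivAt_deriv z))
  refine h1.congr_deriv ?_
  have h2 : (1 - a) ≠ 0 := by linarith
  simp only [liftBessel, liftProfile']
  rw [Real.rpow_sub hz (-a), Real.rpow_one, show 1 - a = -a + 1 by ring,
    Real.rpow_add hz, Real.rpow_one]
  rw [show -a + 1 = 1 - a by ring]
  field_simp
  ring

lemma measurable_liftProfile (hh : IsCutoff R h) : Measurable fun z => (liftProfile a h z : ℂ) := by
  have := hh.1.continuous.measurable
  unfold liftProfile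
  fun_prop

lemma measurable_liftBessel (hh : IsCutoff R h) : Measurable fun z => (liftBessel a h z : ℂ) := by
  have h1 := hh.contDiff_deriv.continuous.measurable
  have h2 := hh.continuous_deriv_deriv.measurable
  unfold liftBessel
  fun_prop

lemma exists_norm_le_of_support {f : ℝ → ℝ} {B R : ℝ} (hR : 0 < R)
    (hf : ∀ z, 0 < z → z ≤ R → |f z| ≤ B)
    (hf0 : ∀ z, R < z → f z = 0) (N : ℕ) :
    ∃ C, 0 ≤ C ∧ ∀ z, 0 < z → ‖(f z : ℂ)‖ ≤ C * ((1 + |z|) ^ N)⁻¹ := by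
  have hB : 0 ≤ B := (abs_nonneg _).trans (hf R hR le_rfl)
  refine ⟨B * (1 + R) ^ N, by positivity, fun z hz => ?_⟩
  rw [Complex.norm_real, Real.norm_eq_abs]
  rcases le_or_gt z R with h | h
  · rw [← div_eq_mul_inv, le_div_iff₀ (by positivity)]
    refine mul_le_mul (hf z hz h) ?_ (by positivity) hB
    rw [abs_of_pos hz]
    gcongr
  · rw [hf0 z h, abs_zero]
    positivity

lemma exists_norm_liftProfile_le (ha' : a < 1) (hR : 0 < R) (hh : IsCutoff R h) (N : ℕ) :
    ∃ C, 0 ≤ C ∧ ∀ z, 0 < z → ‖(liftProfile a h z : ℂ)‖ ≤ C * ((1 + |z|) ^ N)⁻¹ := by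
  have hc : Continuous (liftProfile a h) :=
    ((Real.continuous_rpow_const (by linarith)).div_const _).mul hh.1.continuous
  obtain ⟨B, hB⟩ := isCompact_Icc.exists_bound_of_continuousOn (s := Icc 0 (2 * R)) hc.continuousOn
  refine exists_norm_le_of_support (by linarith : 0 < 2 * R) (fun z h0 h1 => hB z ⟨h0.le, h1⟩)
    (fun z hz => ?_) N
  rw [liftProfile, hh.2.2 z hz.le, mul_zero]

lemma exists_norm_liftBessel_le (hR : 0 < R) (hh : IsCutoff R h) (N : ℕ) :
    ∃ C, 0 ≤ C ∧ ∀ z, 0 < z → ‖(liftBessel a h z : ℂ)‖ ≤ C * ((1 + |z|) ^ N)⁻¹ := by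
  have hc : ContinuousOn (liftBessel a h) (Icc R (2 * R)) := by
    intro z hz
    have hz0 : z ≠ 0 := (hR.trans_le hz.1).ne'
    have h1 := hh.contDiff_deriv.continuous.continuousAt (x := z)
    have h2 := hh.continuous_deriv_deriv.continuousAt (x := z)
    have h3 := Real.continuousAt_rpow_const z (-a) (Or.inl hz0)
    have h4 := Real.continuousAt_rpow_const z (1 - a) (Or.inl hz0)
    exact (((continuousAt_const.mul h3).mul h1).add ((h4.div_const _).mul h2)).continuousWithinAt
  have h0 : ∀ z ∈ Ioo 0 R ∪ Ioi (2 * R), liftBessel a h z = 0 := fun z hz => by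
    rw [liftBessel, hh.deriv_eq_zero hz, hh.deriv_deriv_eq_zero hz, mul_zero, mul_zero, add_zero]
  obtain ⟨B, hB⟩ := isCompact_Icc.exists_bound_of_continuousOn hc
  refine exists_norm_le_of_support (by linarith : 0 < 2 * R) (B := B) (fun z hz h1 => ?_)
    (fun z hz => h0 z (Or.inr hz)) N
  rcases lt_or_ge z R with h2 | h2
  · rw [h0 z (Or.inl ⟨hz, h2⟩), abs_zero]
    exact (norm_nonneg _).trans (hB R ⟨le_rfl, by linarith⟩)
  · exact hB z ⟨h2, h1⟩

end Profile

section Lift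

variable {d : ℕ} {a R : ℝ} {h : ℝ → ℝ}

lemma neumannLift_eq (a : ℝ) (h : ℝ → ℝ) (Φ : 𝓢(Pt d, ℂ)) (t : ℝ) (X : Pt d) :
    neumannLift a h Φ t X = (liftProfile a h X.2 : ℂ) * Φ (X.1, t) := rfl

lemma isRapidFamily_neumannLift (ha' : a < 1) (hR : 0 < R) (hh : IsCutoff R h) (Φ : 𝓢(Pt d, ℂ)) :
    IsRapidFamily (neumannLift a h Φ) :=
  isRapidFamily_mul_schwartz (measurable_liftProfile hh) (exists_norm_liftProfile_le ha' hR hh) Φ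

/-- The value of `halfOp` on the lift. -/
def liftOp (a : ℝ) (h : ℝ → ℝ) (Φ : 𝓢(Pt d, ℂ)) (t : ℝ) (X : Pt d) : ℂ :=
  (liftProfile a h X.2 : ℂ) * lapX Φ (X.1, t) + (liftBessel a h X.2 : ℂ) * Φ (X.1, t)

lemma isRapidFamily_liftOp (ha' : a < 1) (hR : 0 < R) (hh : IsCutoff R h) (Φ : 𝓢(Pt d, ℂ)) :
    IsRapidFamily (liftOp a h Φ) :=
  (isRapidFamily_mul_schwartz (measurable_liftProfile hh) (exists_norm_liftProfile_le ha' hR hh)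
    (lapX Φ)).add
  (isRapidFamily_mul_schwartz (measurable_liftBessel hh) (exists_norm_liftBessel_le hR hh) Φ)

lemma hasDerivAt_neumannLift (a : ℝ) (h : ℝ → ℝ) (Φ : 𝓢(Pt d, ℂ)) (t : ℝ) (X : Pt d) :
    HasDerivAt (fun s => neumannLift a h Φ s X) (neumannLift a h (dz Φ) t X) t :=
  (hasDerivAt_dz Φ X.1 t).const_mul _

lemma halfOp_neumannLift (ha' : a < 1) (hh : IsCutoff R h) (Φ : 𝓢(Pt d, ℂ)) (t : ℝ) {X : Pt d}
    (hX : 0 < X.2) : halfOp a (neumannLift a h Φ t) X = liftOp a h Φ t X := by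
  have h1 : Laplacian.laplacian
      (fun x : EuclideanSpace ℝ (Fin d) => neumannLift a h Φ t (x, X.2)) X.1
      = (liftProfile a h X.2 : ℂ) * lapX Φ (X.1, t) := by
    have e := laplacian_eq_lapX ((liftProfile a h X.2 : ℂ) • Φ) (X.1, t)
    have e2 : lapX ((liftProfile a h X.2 : ℂ) • Φ) = (liftProfile a h X.2 : ℂ) • lapX Φ := by
      simp only [lapX, dx, LineDeriv.lineDerivOp_smul, Finset.smul_sum]
    rw [e2] at e
    exact e
  have h2 : besselOp a (fun z => neumannLift a h Φ t (X.1, z)) X.2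
      = (liftBessel a h X.2 : ℂ) * Φ (X.1, t) := by
    have d1 : ∀ z, 0 < z → HasDerivAt (fun z => neumannLift a h Φ t (X.1, z))
        ((liftProfile' a h z : ℂ) * Φ (X.1, t)) z := fun z hz =>
      (hasDerivAt_liftProfile ha' hh hz).ofReal_comp.mul_const (Φ (X.1, t))
    have d2 : deriv (fun z => neumannLift a h Φ t (X.1, z))
        =ᶠ[𝓝 X.2] fun z => (liftProfile' a h z : ℂ) * Φ (X.1, t) := by
      filter_upwards [isOpen_Ioi.mem_nhds hX] with z hz using (d1 z hz).deriv
    have d3 : HasDerivAt (fun z => (liftProfile' a h z : ℂ) * Φ (X.1, t)) _ X.2 :=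
      (hasDerivAt_liftProfile' ha' hh hX).ofReal_comp.mul_const (Φ (X.1, t))
    rw [besselOp, d2.deriv_eq, d3.deriv, (d1 X.2 hX).deriv]
    push_cast
    ring
  rw [halfOp, h1, h2, liftOp]

/-- Green's formula for the lift: the Neumann datum appears as a boundary term. -/
lemma integral_liftOp_mul (ha : -1 < a) (ha' : a < 1) (hR : 0 < R) (hh : IsCutoff R h)
    (Φ : 𝓢(Pt d, ℂ)) (t : ℝ) (V : 𝓢(Pt d, ℂ)) (hV : ∀ x z, V (x, -z) = V (x, z)) :
    ∫ X, liftOp a h Φ t X * V X ∂(omega d a)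
      = (∫ X, neumannLift a h Φ t X * halfOp a V X ∂(omega d a)) - ∫ x, Φ (x, t) * V (x, 0) := by
  refine green_half_space ha ha' ((isRapidFamily_neumannLift ha' hR hh Φ).isRapid a t)
    ((isRapidFamily_mul_schwartz (measurable_liftProfile hh)
      (exists_norm_liftProfile_le ha' hR hh) (lapX Φ)).isRapid a t)
    ((isRapidFamily_mul_schwartz (measurable_liftBessel hh)
      (exists_norm_liftBessel_le hR hh) Φ).isRapid a t) V hV (fun z _ => ?_) fun x i₁ i₂ => ?_
  · have e := SchwartzMap.integral_mul_laplacian_right_eq_left (μ := volume) (slice t Φ) (slice z V)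
    rw [laplacian_slice, laplacian_slice] at e
    simp only [slice_apply] at e
    simp only [neumannLift_eq, mul_assoc, integral_const_mul]
    rw [e]
  · have hlim : Tendsto (fun z : ℝ => Φ (x, t) * V (x, z) -
        ((z / (1 - a) : ℝ) : ℂ) * Φ (x, t) * dz V (x, z))
        (𝓝[>] 0) (𝓝 (Φ (x, t) * V (x, 0))) := by
      have hc : Continuous fun z : ℝ =>
          Φ (x, t) * V (x, z) - ((z / (1 - a) : ℝ) : ℂ) * Φ (x, t) * dz V (x, z) := by
        have c1 : Continuous fun z => V (x, z) := V.continuous.comp (by fun_prop)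
        have c2 : Continuous fun z => dz V (x, z) := (dz V).continuous.comp (by fun_prop)
        fun_prop
      have := (hc.tendsto 0).mono_left (nhdsWithin_le_nhds (s := Ioi 0))
      simpa using this
    have key := green_half_line (a := a) (L := Φ (x, t) * V (x, 0))
      (f := fun z => neumannLift a h Φ t (x, z))
      (f₁ := fun z => (liftProfile' a h z : ℂ) * Φ (x, t))
      (f₂ := fun z => ((liftBessel a h z - a / z * liftProfile' a h z : ℝ) : ℂ) * Φ (x, t))
      (g := fun z => V (x, z))
      (fun z hz => (hasDerivAt_liftProfile ha' hh hz).ofReal_comp.mul_const (Φ (x, t)))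
      (fun z hz => (hasDerivAt_liftProfile' ha' hh hz).ofReal_comp.mul_const _)
      (fun z _ => hasDerivAt_dz V x z) (fun z _ => hasDerivAt_dz (dz V) x z) ?_ i₂ ?_ ?_
    · refine Eq.trans (integral_congr_ae (ae_of_all _ fun z => ?_)) key
      push_cast
      ring
    · refine i₁.congr (ae_of_all _ fun z => ?_)
      push_cast
      ring
    · refine hlim.congr' ?_
      filter_upwards [Ioo_mem_nhdsGT hR] with z hz
      have hz0 : 0 < z := hz.1
      have e1 : z ^ a * z ^ (-a) = 1 := by
        rw [← Real.rpow_add hz0, add_neg_cancel, Real.rpow_zero]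
      have e3 : liftProfile' a h z = z ^ (-a) := by
        rw [liftProfile', hh.2.1 z ⟨hz.1.le, hz.2.le⟩, hh.deriv_eq_zero (Or.inl hz)]
        ring
      have e4 : liftProfile a h z = z ^ (1 - a) / (1 - a) := by
        rw [liftProfile, hh.2.1 z ⟨hz.1.le, hz.2.le⟩, mul_one]
      simp only [neumannLift_eq, e3, e4]
      have e1' : ((z ^ a : ℝ) : ℂ) * ((z ^ (-a) : ℝ) : ℂ) = 1 := by exact_mod_cast e1
      have e2' : ((z ^ a : ℝ) : ℂ) * ((z ^ (1 - a) / (1 - a) : ℝ) : ℂ)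
          = ((z / (1 - a) : ℝ) : ℂ) := by
        rw [← Complex.ofReal_mul]
        congr 1
        rw [← mul_div_assoc, ← Real.rpow_add hz0, add_sub_cancel, Real.rpow_one]
      linear_combination (-Φ (x, t) * V (x, z)) * e1' + (Φ (x, t) * dz V (x, z)) * e2'
    · refine tendsto_const_nhds.congr' ?_
      filter_upwards [eventually_gt_atTop (2 * R)] with z hz
      have e3 : liftProfile' a h z = 0 := by
        rw [liftProfile', hh.2.2 z hz.le, hh.deriv_eq_zero (Or.inr hz)]
        ring
      have e4 : liftProfile a h z = 0 := by rw [liftProfile, hh.2.2 z hz.le, mul_zero]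
      simp only [neumannLift_eq, e3, e4, Complex.ofReal_zero, zero_mul, sub_zero, mul_zero]

end Lift

/-! ### The weak formula -/

section Weak

variable {d : ℕ} {a : ℝ}

lemma IsRapidFamily.pair_eq_bil {v : ℝ → Pt d → ℂ} (hv : IsRapidFamily v) (ha : -1 < a)
    (ha' : a < 1)
    (τ : ℝ) (p : GaussParam d) :
    pair (a := a) (v τ) p = bil d a (hv.toL2 ha ha' τ) (gaussL2 ha ha' p) := by
  rw [bil_gaussL2]
  refine integral_congr_ae ?_
  filter_upwards [hv.coeFn_toL2 ha ha' τ] with X hX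
  rw [hX]

lemma IsRapidFamily.continuous_pair {v : ℝ → Pt d → ℂ} (hv : IsRapidFamily v) (ha : -1 < a)
    (ha' : a < 1) (t : ℝ) (p : GaussParam d) :
    Continuous fun τ => pair (a := a) (v τ) (shift (t - τ) p) := by
  simp_rw [hv.pair_eq_bil ha ha']
  have h1 := (bil d a).continuous.comp (hv.continuous_toL2 ha ha')
  exact h1.clm_apply ((continuous_gaussL2_shift ha ha' p).comp (continuous_sub_left t))

lemma IsRapidFamily.hasDerivAt_pair {v v' : ℝ → Pt d → ℂ} (hv : IsRapidFamily v)
    (hv' : IsRapidFamily v') (hd : ∀ τ X, HasDerivAt (fun s => v s X) (v' τ X) τ) (ha : -1 < a)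
    (ha' : a < 1) (t τ : ℝ) (p : GaussParam d) :
    HasDerivAt (fun s => pair (a := a) (v s) (shift (t - s) p))
      (pair (a := a) (v' τ) (shift (t - τ) p) - Complex.I *
        ∫ X, v τ X * gaussOp a (shift (t - τ) p).1 (shift (t - τ) p).2 X ∂(omega d a)) τ := by
  obtain ⟨C₁, ρ₁, hC₁, hρ₁, h₁⟩ := exists_norm_gauss_le ha p.1.2 p.2 (S := |t - τ| + 1)
    (by positivity)
  obtain ⟨C₂, ρ₂, hC₂, hρ₂, h₂⟩ := exists_norm_gaussOp_le ha p (S := |t - τ| + 1) (by positivity)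
  obtain ⟨D₁, hD₁, k₁⟩ := hv'.decay 0
  obtain ⟨D₂, hD₂, k₂⟩ := hv.decay 0
  simp only [pow_zero, inv_one, mul_one] at k₁ k₂
  have hb : Integrable (fun X => D₁ * (C₁ * Real.exp (-ρ₁ * (‖X.1‖ ^ 2 + X.2 ^ 2)))
      + D₂ * (C₂ * Real.exp (-ρ₂ * (‖X.1‖ ^ 2 + X.2 ^ 2)))) (omega d a) :=
    (((integrable_exp_neg_sq ha hρ₁).const_mul C₁).const_mul D₁).add
      (((integrable_exp_neg_sq ha hρ₂).const_mul C₂).const_mul D₂)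
  have hint : ∀ s, Integrable (fun X => v s X * gaussP a (shift (t - s) p) X) (omega d a) :=
    fun s => integrable_mul_gaussP ha ha' ((hv.isRapid a s).memLp ha ha') _
  have hint' : Integrable (fun X => v' τ X * gaussP a (shift (t - τ) p) X) (omega d a) :=
    integrable_mul_gaussP ha ha' ((hv'.isRapid a τ).memLp ha ha') _
  have hint₂ : Integrable (fun X => v τ X * gaussOp a (shift (t - τ) p).1 (shift (t - τ) p).2 X)
      (omega d a) :=
    (hv.isRapid a τ).integrable_mul ha ha' (isRapid_gaussOp ha _)
  have key := hasDerivAt_integral_of_dominated_loc_of_deriv_le (μ := omega d a) (x₀ := τ)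
    (F := fun s X => v s X * gaussP a (shift (t - s) p) X)
    (F' := fun s X => v' s X * gaussP a (shift (t - s) p) X
      - v s X * (Complex.I * gaussOp a (shift (t - s) p).1 (shift (t - s) p).2 X))
    (s := Metric.ball τ 1) (Metric.ball_mem_nhds τ one_pos)
    (Eventually.of_forall fun s => (hint s).1) (hint τ) ?_ ?_ hb
    (ae_of_all _ fun X s _ => ?_)
  · refine key.2.congr_deriv ?_
    rw [pair, ← integral_const_mul, ← integral_sub hint' (hint₂.const_mul _)]
    exact integral_congr_ae (ae_of_all _ fun X => by ring)
  · refine hint'.1.sub ((hint₂.const_mul Complex.I).1.congr (ae_of_all _ fun X => ?_))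
    ring
  · filter_upwards [ae_omega_pos d a] with X hX s hs
    have hs' : |t - s| ≤ |t - τ| + 1 := by
      have h1 : |s - τ| < 1 := by simpa [Real.dist_eq] using hs
      have h2 : t - s = (t - τ) + (τ - s) := by ring
      rw [h2]
      refine (abs_add_le _ _).trans ?_
      rw [abs_sub_comm τ s]
      linarith
    refine (norm_sub_le _ _).trans ?_
    rw [norm_mul, norm_mul, norm_mul, Complex.norm_I, one_mul]
    gcongr
    · exact k₁ s X hX
    · exact h₁ (t - s) hs' X
    · exact k₂ s X hX
    · exact h₂ (t - s) hs' X
  · have h3 : HasDerivAt (fun s => gaussP a (shift (t - s) p) X)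
        (-(Complex.I * gaussOp a (shift (t - s) p).1 (shift (t - s) p).2 X)) s :=
      (hasDerivAt_gauss_shift a p X (t - s)).comp_const_sub t s
    refine ((hd s X).fun_mul h3).congr_deriv ?_
    ring

/-- Along the backward flow of a Gaussian, the lift satisfies the equation up to its residual and
the boundary term created by the Neumann datum. -/
lemma pair_neumannLift_sub (ha : -1 < a) (ha' : a < 1) {R : ℝ} (hR : 0 < R) {h : ℝ → ℝ}
    (hh : IsCutoff R h) (Φ : 𝓢(Pt d, ℂ)) (t : ℝ) (p : GaussParam d) :
    pair (a := a) (neumannLift a h Φ t) p - pair (a := a) (neumannLift a h Φ 0) (shift t p)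
      = (∫ τ in (0 : ℝ)..t, pair (a := a) (fun X => neumannLift a h (dz Φ) τ X
          - Complex.I * liftOp a h Φ τ X) (shift (t - τ) p))
        - Complex.I * ∫ τ in (0 : ℝ)..t, ∫ y, Φ (y, τ) * gaussP a (shift (t - τ) p) (y, 0) := by
  have hW := isRapidFamily_neumannLift ha' hR hh Φ
  have hW' := isRapidFamily_neumannLift ha' hR hh (dz Φ)
  have hA := isRapidFamily_liftOp ha' hR hh Φ
  have hres := hW'.sub (hA.const_mul Complex.I)
  have hb := ((time_integral_bdryInt ha ha' Φ t).2 p).2.1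
  have hd : ∀ τ, HasDerivAt (fun s => pair (a := a) (neumannLift a h Φ s) (shift (t - s) p))
      (pair (a := a) (fun X => neumannLift a h (dz Φ) τ X - Complex.I * liftOp a h Φ τ X)
        (shift (t - τ) p) - Complex.I * ∫ y, Φ (y, τ) * gaussP a (shift (t - τ) p) (y, 0)) τ := by
    intro τ
    refine (hW.hasDerivAt_pair hW' (hasDerivAt_neumannLift a h Φ) ha ha' t τ p).congr_deriv ?_
    set p' := shift (t - τ) p
    have e1 := integral_liftOp_mul ha ha' hR hh Φ τ (gaussS ha p') (gaussS_even ha p')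
    simp only [gaussS_apply] at e1
    have e2 : ∫ X, neumannLift a h Φ τ X * halfOp a (gaussS ha p') X ∂(omega d a)
        = ∫ X, neumannLift a h Φ τ X * gaussOp a p'.1 p'.2 X ∂(omega d a) := by
      refine integral_congr_ae ?_
      filter_upwards [ae_omega_pos d a] with X hX
      rw [halfOp_gaussS ha p' hX.ne']
    rw [e2] at e1
    have e3 : pair (a := a) (fun X => neumannLift a h (dz Φ) τ X - Complex.I * liftOp a h Φ τ X) p'
        = pair (a := a) (neumannLift a h (dz Φ) τ) p'
          - Complex.I * ∫ X, liftOp a h Φ τ X * gaussP a p' X ∂(omega d a) := by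
      have i1 := integrable_mul_gaussP ha ha' ((hW'.isRapid a τ).memLp ha ha') p'
      have i2 := integrable_mul_gaussP ha ha' ((hA.isRapid a τ).memLp ha ha') p'
      simp only [pair, sub_mul, mul_assoc]
      rw [integral_sub i1 (i2.const_mul _), integral_const_mul]
    rw [e3, e1]
    ring
  have hc := hres.continuous_pair ha ha' t p
  have key := intervalIntegral.integral_eq_sub_of_hasDerivAt (fun τ _ => hd τ)
    ((hc.intervalIntegrable 0 t).sub (hb.const_mul Complex.I))
  rw [intervalIntegral.integral_sub (hc.intervalIntegrable 0 t) (hb.const_mul Complex.I),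
    intervalIntegral.integral_const_mul, sub_self, sub_zero, shift_zero] at key
  exact key.symm

end Weak

/-! ### The mild solution -/

section ZeroSolution

variable {d : ℕ} {a : ℝ} (ha : -1 < a) (ha' : a < 1)

lemma continuous_evol_comp {v : ℝ → L2 d a} (hv : Continuous v) {r : ℝ → ℝ} (hr : Continuous r) :
    Continuous fun t => evol ha ha' (r t) (v t) := by
  refine continuous_iff_continuousAt.mpr fun t => ?_
  rw [ContinuousAt, tendsto_iff_norm_sub_tendsto_zero]
  have h1 : Tendsto (fun s => ‖v s - v t‖ + ‖evol ha ha' (r s) (v t) - evol ha ha' (r t) (v t)‖)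
      (𝓝 t) (𝓝 0) := by
    have c : Continuous fun s =>
        ‖v s - v t‖ + ‖evol ha ha' (r s) (v t) - evol ha ha' (r t) (v t)‖ :=
      (hv.sub continuous_const).norm.add
        (((continuous_evol ha ha' (v t)).comp hr).sub continuous_const).norm
    simpa using c.tendsto t
  refine squeeze_zero (fun _ => norm_nonneg _) (fun s => ?_) h1
  rw [← norm_evol ha ha' (r s) (v s - v t), map_sub]
  exact norm_sub_le_norm_sub_add_norm_sub _ _ _

/-- The variation of constants formula. -/
def zeroSol (v₀ : L2 d a) (f : ℝ → L2 d a) (t : ℝ) : L2 d a :=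
  evol ha ha' t v₀ + ∫ τ in (0 : ℝ)..t, evol ha ha' (t - τ) (f τ)

lemma continuous_zeroSol (v₀ : L2 d a) {f : ℝ → L2 d a} (hf : Continuous f) :
    Continuous (zeroSol ha ha' v₀ f) := by
  have hc : Continuous fun τ => evol ha ha' (-τ) (f τ) :=
    continuous_evol_comp ha ha' hf continuous_neg
  have e : ∀ t, ∫ τ in (0 : ℝ)..t, evol ha ha' (t - τ) (f τ)
      = evol ha ha' t (∫ τ in (0 : ℝ)..t, evol ha ha' (-τ) (f τ)) := by
    intro t
    rw [← (evol ha ha' t).intervalIntegral_comp_comm (hc.intervalIntegrable 0 t)]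
    refine intervalIntegral.integral_congr fun τ _ => ?_
    rw [sub_eq_add_neg, evol_add]
    rfl
  refine (continuous_evol ha ha' v₀).add ?_
  simp_rw [e]
  exact continuous_evol_comp ha ha'
    (intervalIntegral.continuous_primitive (fun _ _ => hc.intervalIntegrable _ _) 0) continuous_id

lemma bil_zeroSol (v₀ : L2 d a) {f : ℝ → L2 d a} (hf : Continuous f) (t : ℝ) (p : GaussParam d) :
    bil d a (zeroSol ha ha' v₀ f t) (gaussL2 ha ha' p) = bil d a v₀ (gaussL2 ha ha' (shift t p))
      + ∫ τ in (0 : ℝ)..t, bil d a (f τ) (gaussL2 ha ha' (shift (t - τ) p)) := by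
  have hc : Continuous fun τ => evol ha ha' (t - τ) (f τ) :=
    continuous_evol_comp ha ha' hf (continuous_sub_left t)
  have e := ((bil d a).flip (gaussL2 ha ha' p)).intervalIntegral_comp_comm
    (hc.intervalIntegrable (μ := volume) 0 t)
  simp only [ContinuousLinearMap.flip_apply, bil_evol, evol_gaussL2] at e
  rw [zeroSol, map_add, add_apply, bil_evol, evol_gaussL2, e]

end ZeroSolution

section Solution

variable {d : ℕ} {a R : ℝ} {h : ℝ → ℝ}

/-- The datum of the problem for `U - W`. -/
def datum (a : ℝ) (h : ℝ → ℝ) (u₀ Φ : 𝓢(Pt d, ℂ)) (X : Pt d) : ℂ := u₀ X - neumannLift a h Φ 0 X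

/-- The forcing term of the problem for `U - W`. -/
def forcing (a : ℝ) (h : ℝ → ℝ) (F : 𝓢(Pt d × ℝ, ℂ)) (Φ : 𝓢(Pt d, ℂ)) (τ : ℝ) (X : Pt d) : ℂ :=
  F (X, τ) - (neumannLift a h (dz Φ) τ X - Complex.I * liftOp a h Φ τ X)

lemma isRapid_datum (ha' : a < 1) (hR : 0 < R) (hh : IsCutoff R h) (u₀ Φ : 𝓢(Pt d, ℂ)) :
    IsRapid a (datum a h u₀ Φ) :=
  (IsRapid.of_schwartz u₀).sub ((isRapidFamily_neumannLift ha' hR hh Φ).isRapid a 0)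

lemma isRapidFamily_forcing (ha' : a < 1) (hR : 0 < R) (hh : IsCutoff R h) (F : 𝓢(Pt d × ℝ, ℂ))
    (Φ : 𝓢(Pt d, ℂ)) : IsRapidFamily (forcing a h F Φ) :=
  (isRapidFamily_schwartz F).sub ((isRapidFamily_neumannLift ha' hR hh (dz Φ)).sub
    ((isRapidFamily_liftOp ha' hR hh Φ).const_mul Complex.I))

variable (ha : -1 < a) (ha' : a < 1) (hR : 0 < R) (hh : IsCutoff R h) (u₀ : 𝓢(Pt d, ℂ))
  (F : 𝓢(Pt d × ℝ, ℂ)) (Φ : 𝓢(Pt d, ℂ))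

/-- The mild solution of the problem with zero Neumann condition for `U - W`. -/
def innerSol : ℝ → L2 d a :=
  zeroSol ha ha' ((isRapid_datum ha' hR hh u₀ Φ).memLp ha ha').toLp
    ((isRapidFamily_forcing ha' hR hh F Φ).toL2 ha ha')

/-- The mild solution, built with the cutoff `h`. -/
def sol (t : ℝ) : L2 d a :=
  (isRapidFamily_neumannLift ha' hR hh Φ).toL2 ha ha' t + innerSol ha ha' hR hh u₀ F Φ t

lemma continuous_innerSol : Continuous (innerSol ha ha' hR hh u₀ F Φ) :=
  continuous_zeroSol ha ha' _ ((isRapidFamily_forcing ha' hR hh F Φ).continuous_toL2 ha ha')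

lemma continuous_sol : Continuous (sol ha ha' hR hh u₀ F Φ) :=
  ((isRapidFamily_neumannLift ha' hR hh Φ).continuous_toL2 ha ha').add
    (continuous_innerSol ha ha' hR hh u₀ F Φ)

/-- Tested against Gaussians, the solution does not depend on the cutoff. -/
lemma pair_sol (t : ℝ) (p : GaussParam d) :
    pair (a := a) (sol ha ha' hR hh u₀ F Φ t) p = pair (a := a) u₀ (shift t p)
      + (∫ τ in (0 : ℝ)..t, pair (a := a) (fun X => F (X, τ)) (shift (t - τ) p))
      - Complex.I * ∫ τ in (0 : ℝ)..t, ∫ y, Φ (y, τ) * gaussP a (shift (t - τ) p) (y, 0) := by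
  have hW := isRapidFamily_neumannLift ha' hR hh Φ
  have hF := isRapidFamily_schwartz F
  have hf := isRapidFamily_forcing ha' hR hh F Φ
  have hres := (isRapidFamily_neumannLift ha' hR hh (dz Φ)).sub
    ((isRapidFamily_liftOp ha' hR hh Φ).const_mul Complex.I)
  have e1 : bil d a ((isRapid_datum ha' hR hh u₀ Φ).memLp ha ha').toLp (gaussL2 ha ha' (shift t p))
      = pair (a := a) u₀ (shift t p) - pair (a := a) (neumannLift a h Φ 0) (shift t p) := by
    rw [bil_gaussL2, pair, pair, pair, ← integral_sub
      (integrable_mul_gaussP ha ha' ((IsRapid.of_schwartz u₀).memLp ha ha') _)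
      (integrable_mul_gaussP ha ha' ((hW.isRapid a 0).memLp ha ha') _)]
    refine integral_congr_ae ?_
    filter_upwards [MemLp.coeFn_toLp ((isRapid_datum ha' hR hh u₀ Φ).memLp ha ha')] with X hX
    rw [hX, datum]
    ring
  have e2 : ∀ τ, bil d a (hf.toL2 ha ha' τ) (gaussL2 ha ha' (shift (t - τ) p))
      = pair (a := a) (fun X => F (X, τ)) (shift (t - τ) p)
        - pair (a := a) (fun X => neumannLift a h (dz Φ) τ X - Complex.I * liftOp a h Φ τ X)
          (shift (t - τ) p) := by
    intro τ
    rw [← hf.pair_eq_bil, pair, pair, pair, ← integral_sub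
      (integrable_mul_gaussP ha ha' ((hF.isRapid a τ).memLp ha ha') _)
      (integrable_mul_gaussP ha ha' ((hres.isRapid a τ).memLp ha ha') _)]
    refine integral_congr_ae (ae_of_all _ fun X => ?_)
    simp only [forcing]
    ring
  rw [← bil_gaussL2 ha ha', sol, map_add, add_apply, innerSol,
    bil_zeroSol ha ha' _ (hf.continuous_toL2 ha ha'), e1, ← hW.pair_eq_bil]
  simp_rw [e2]
  rw [intervalIntegral.integral_sub ((hF.continuous_pair ha ha' t p).intervalIntegrable 0 t)
    ((hres.continuous_pair ha ha' t p).intervalIntegrable 0 t)]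
  linear_combination pair_neumannLift_sub ha ha' hR hh Φ t p

lemma sol_eq_sol {R' : ℝ} {h' : ℝ → ℝ} (hR' : 0 < R') (hh' : IsCutoff R' h') :
    sol ha ha' hR hh u₀ F Φ = sol ha ha' hR' hh' u₀ F Φ :=
  funext fun t => eq_of_forall_pair ha ha' fun p => by rw [pair_sol, pair_sol]

/-- The right-hand side of the representation formula, in terms of `heatKer`. -/
def represent (a : ℝ) (t : ℝ) (X : Pt d) : ℂ :=
  heatInt a u₀ t X + (∫ τ in (0 : ℝ)..t, heatInt a (fun Y => F (Y, τ)) (t - τ) X)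
    - Complex.I * ∫ τ in (0 : ℝ)..t, bdryInt a (fun y => Φ (y, τ)) (t - τ) X

lemma sol_eq_represent {t : ℝ} (ht : t ≠ 0) :
    sol ha ha' hR hh u₀ F Φ t =ᵐ[omega d a] represent u₀ F Φ a t := by
  have hu := IsRapid.of_schwartz (a := a) u₀
  have i1 := fun p => integrable_mul_gaussP ha ha' (Lp.memLp (sol ha ha' hR hh u₀ F Φ t)) p
  have i2 := hu.integrable_heatInt_mul ha ha' ht
  have hF := ((isRapidFamily_schwartz F).time_integral_heatInt ha ha' t).2
  have hB := (time_integral_bdryInt ha ha' Φ t).2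
  have i3 : ∀ p : GaussParam d,
      Integrable (fun X => represent u₀ F Φ a t X * gaussP a p X) (omega d a) := by
    intro p
    simp only [represent, sub_mul, add_mul, mul_assoc]
    exact ((i2 p).add (hF p).1).sub ((hB p).1.const_mul _)
  have e : ∀ p : GaussParam d, pair (a := a) (represent u₀ F Φ a t) p
      = pair (a := a) (sol ha ha' hR hh u₀ F Φ t) p := by
    intro p
    rw [pair_sol, ← hu.pair_heatInt ha ha' ht, ← (hF p).2, ← (hB p).2.2]
    simp only [pair, represent, sub_mul, add_mul, mul_assoc]
    rw [integral_sub (by exact (i2 p).add (hF p).1) ((hB p).1.const_mul _),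
      integral_add (i2 p) (hF p).1, integral_const_mul]
  have key : (fun X => sol ha ha' hR hh u₀ F Φ t X - represent u₀ F Φ a t X) =ᵐ[omega d a] 0 := by
    refine ae_eq_zero_of_forall_gauss (fun q b hq => ?_) fun q b hq => ?_
    · simp_rw [sub_mul]
      exact (i1 (⟨q, hq⟩, b)).sub (i3 (⟨q, hq⟩, b))
    · simp_rw [sub_mul]
      rw [integral_sub (i1 (⟨q, hq⟩, b)) (i3 (⟨q, hq⟩, b)), sub_eq_zero]
      exact (e (⟨q, hq⟩, b)).symm
  filter_upwards [key] with X hX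
  exact sub_eq_zero.mp hX

lemma isMildSolution_sol (J : Set ℝ) : IsMildSolution a J u₀ F Φ (sol ha ha' hR hh u₀ F Φ) := by
  refine ⟨(continuous_sol ha ha' hR hh u₀ F Φ).continuousOn, fun R' hR' h' hh' => ?_⟩
  have hf := isRapidFamily_forcing ha' hR' hh' F Φ
  refine ⟨((isRapid_datum ha' hR' hh' u₀ Φ).memLp ha ha').toLp, hf.toL2 ha ha',
    innerSol ha ha' hR' hh' u₀ F Φ, MemLp.coeFn_toLp _, fun t _ => ?_, fun t _ => ?_,
    (continuous_innerSol ha ha' hR' hh' u₀ F Φ).continuousOn,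
    fun t _ => (hf.continuous_toL2 ha ha').intervalIntegrable _ _,
    evol ha ha', isSchrodingerGroup_evol ha ha', fun t _ => rfl⟩
  · filter_upwards [hf.coeFn_toL2 ha ha' t, ae_omega_pos d a] with X hX hpos
    rw [hX, forcing, (hasDerivAt_neumannLift a h' Φ t X).deriv, halfOp_neumannLift ha' hh' Φ t hpos]
  · rw [sol_eq_sol ha ha' hR hh u₀ F Φ hR' hh', sol]
    filter_upwards [Lp.coeFn_add ((isRapidFamily_neumannLift ha' hR' hh' Φ).toL2 ha ha' t)
      (innerSol ha ha' hR' hh' u₀ F Φ t),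
      (isRapidFamily_neumannLift ha' hR' hh' Φ).coeFn_toL2 ha ha' t] with X h1 h2
    rw [h1, Pi.add_apply, h2, add_sub_cancel_left]

lemma IsMildSolution.eqOn_sol {J : Set ℝ} (hJ : J.OrdConnected) (h0 : (0 : ℝ) ∈ J)
    {V : ℝ → L2 d a} (hV : IsMildSolution a J u₀ F Φ V) : EqOn V (sol ha ha' hR hh u₀ F Φ) J := by
  obtain ⟨v₀, f, u, hv₀, hf, hu, -, -, T, hT, hTu⟩ := hV.2 R hR h hh
  have hff := isRapidFamily_forcing ha' hR hh F Φ
  have e0 : v₀ = ((isRapid_datum ha' hR hh u₀ Φ).memLp ha ha').toLp :=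
    Lp.ext (hv₀.trans (MemLp.coeFn_toLp ((isRapid_datum ha' hR hh u₀ Φ).memLp ha ha')).symm)
  have e1 : ∀ t ∈ J, f t = hff.toL2 ha ha' t := by
    intro t ht
    refine Lp.ext ?_
    filter_upwards [hf t ht, hff.coeFn_toL2 ha ha' t, ae_omega_pos d a] with X h1 h2 hpos
    rw [h1, h2, forcing, (hasDerivAt_neumannLift a h Φ t X).deriv,
      halfOp_neumannLift ha' hh Φ t hpos]
  intro t ht
  have e2 : u t = innerSol ha ha' hR hh u₀ F Φ t := by
    rw [hTu t ht, innerSol, zeroSol, hT.eq_evol ha ha', e0]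
    congr 1
    refine intervalIntegral.integral_congr fun τ hτ => ?_
    rw [e1 τ (hJ.uIcc_subset h0 ht hτ)]
  refine Lp.ext ?_
  rw [sol, ← e2]
  filter_upwards [Lp.coeFn_add ((isRapidFamily_neumannLift ha' hR hh Φ).toL2 ha ha' t) (u t),
    (isRapidFamily_neumannLift ha' hR hh Φ).coeFn_toL2 ha ha' t, hu t ht] with X h1 h2 h3
  rw [h1, Pi.add_apply, h2, h3]
  ring

end Solution

/-! ### The representation formula -/

section Representation

variable {d : ℕ} {a : ℝ}

lemma Tstar_eq (u₀ : 𝓢(Pt d, ℂ)) {t : ℝ} (ht : t ≠ 0) {X : Pt d} (hX : 0 < X.2) :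
    Tstar a u₀ X t = heatInt a u₀ t X := by
  refine integral_congr_ae ?_
  filter_upwards [ae_omega_pos d a] with Y hY
  rw [ker_eq ht hX hY]

lemma integral_ker_mul_eq (F : 𝓢(Pt d × ℝ, ℂ)) {t τ : ℝ} (hτ : τ ≠ t) {X : Pt d} (hX : 0 < X.2) :
    ∫ Y, ker a X Y (t - τ) * F (Y, τ) ∂(omega d a) = heatInt a (fun Y => F (Y, τ)) (t - τ) X := by
  refine integral_congr_ae ?_
  filter_upwards [ae_omega_pos d a] with Y hY
  rw [ker_eq (sub_ne_zero.mpr hτ.symm) hX hY]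

lemma integral_kerBdry_mul_eq (Φ : 𝓢(Pt d, ℂ)) {t τ : ℝ} (hτ : τ ≠ t) (X : Pt d) :
    ∫ y, kerBdry a X y (t - τ) * Φ (y, τ) = bdryInt a (fun y => Φ (y, τ)) (t - τ) X := by
  refine integral_congr_ae (ae_of_all _ fun y => ?_)
  simp only
  rw [kerBdry_eq _ _ (sub_ne_zero.mpr hτ.symm)]

lemma Da_eq (F : 𝓢(Pt d × ℝ, ℂ)) (t : ℝ) {X : Pt d} (hX : 0 < X.2) :
    Da a F X t = ∫ τ in (0 : ℝ)..t, heatInt a (fun Y => F (Y, τ)) (t - τ) X := by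
  refine intervalIntegral.integral_congr_ae ?_
  filter_upwards [Measure.ae_ne volume t] with τ hτ _ using integral_ker_mul_eq F hτ hX

lemma ThetaStar_eq (Φ : 𝓢(Pt d, ℂ)) (t : ℝ) (X : Pt d) :
    ThetaStar a Φ X t
      = -Complex.I * ∫ τ in (0 : ℝ)..t, bdryInt a (fun y => Φ (y, τ)) (t - τ) X := by
  rw [ThetaStar]
  congr 1
  refine intervalIntegral.integral_congr_ae ?_
  filter_upwards [Measure.ae_ne volume t] with τ hτ _ using integral_kerBdry_mul_eq Φ hτ X

lemma ae_duhamelConverges (ha : -1 < a) (ha' : a < 1) (u₀ : 𝓢(Pt d, ℂ)) (F : 𝓢(Pt d × ℝ, ℂ))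
    (Φ : 𝓢(Pt d, ℂ)) {t : ℝ} (ht : t ≠ 0) :
    ∀ᵐ X ∂(omega d a), DuhamelConverges a u₀ F Φ X t := by
  have hF := isRapidFamily_schwartz F
  have hker : ∀ {r : ℝ}, r ≠ 0 → ∀ {u : Pt d → ℂ}, IsRapid a u → ∀ {X : Pt d}, 0 < X.2 →
      Integrable (fun Y => ker a X Y r * u Y) (omega d a) := by
    intro r hr u hu X hX
    refine (hu.integrable_heatKer_mul ha ha' hr X).congr ?_
    filter_upwards [ae_omega_pos d a] with Y hY
    rw [ker_eq hr hX hY]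
  have hne : ∀ᵐ τ ∂(volume.restrict (uIoc 0 t)), τ ≠ t := ae_restrict_of_ae (Measure.ae_ne volume t)
  filter_upwards [ae_omega_pos d a, (hF.time_integral_heatInt ha ha' t).1,
    (time_integral_bdryInt ha ha' Φ t).1] with X hX h1 h2
  refine ⟨hker ht (IsRapid.of_schwartz u₀) hX,
    fun τ hτ => hker (sub_ne_zero.mpr hτ.symm) (hF.isRapid a τ) hX, h1.congr_ae ?_,
    fun τ hτ => ?_, h2.congr_ae ?_⟩
  · filter_upwards [hne] with τ hτ using (integral_ker_mul_eq F hτ hX).symm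
  · have hr : t - τ ≠ 0 := sub_ne_zero.mpr hτ.symm
    refine (integrable_bdryInt ha hr Φ τ X).congr (ae_of_all _ fun y => ?_)
    simp only
    rw [kerBdry_eq _ _ hr]
  · filter_upwards [hne] with τ hτ using (integral_kerBdry_mul_eq Φ hτ X).symm

lemma exists_isCutoff : ∃ h : ℝ → ℝ, IsCutoff 1 h := by
  refine ⟨fun z => Real.smoothTransition (2 - z), ?_, fun z hz => ?_, fun z hz => ?_⟩
  · exact Real.smoothTransition.contDiff.comp (contDiff_const.sub contDiff_id)
  · exact Real.smoothTransition.one_of_one_le (by linarith [hz.2])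
  · exact Real.smoothTransition.zero_of_nonpos (by linarith)

end Representation

end HalfSpace

end

theorem theoremT (d : ℕ) (a : ℝ) (ha : -1 < a) (ha' : a < 1)
    (J : Set ℝ) (hJ : J.OrdConnected) (h0 : (0 : ℝ) ∈ J)
    (u₀ : 𝓢(HalfSpace.Pt d, ℂ)) (F : 𝓢(HalfSpace.Pt d × ℝ, ℂ)) (Φ : 𝓢(HalfSpace.Pt d, ℂ)) :
    ∃ U : ℝ → HalfSpace.L2 d a,
      HalfSpace.IsMildSolution a J u₀ F Φ U ∧
      (∀ V : ℝ → HalfSpace.L2 d a, HalfSpace.IsMildSolution a J u₀ F Φ V → Set.EqOn V U J) ∧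
      ∀ t ∈ J, t ≠ 0 → ∀ᵐ X ∂(HalfSpace.omega d a),
        HalfSpace.DuhamelConverges a u₀ F Φ X t ∧
        U t X = HalfSpace.Tstar a u₀ X t + HalfSpace.Da a F X t + HalfSpace.ThetaStar a Φ X t := by
  obtain ⟨h, hh⟩ := HalfSpace.exists_isCutoff
  refine ⟨HalfSpace.sol ha ha' one_pos hh u₀ F Φ,
    HalfSpace.isMildSolution_sol ha ha' one_pos hh u₀ F Φ J,
    fun V hV => hV.eqOn_sol ha ha' one_pos hh u₀ F Φ hJ h0, fun t _ ht => ?_⟩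
  filter_upwards [HalfSpace.ae_omega_pos d a, HalfSpace.ae_duhamelConverges ha ha' u₀ F Φ ht,
    HalfSpace.sol_eq_represent ha ha' one_pos hh u₀ F Φ ht] with X hX h1 h2
  refine ⟨h1, ?_⟩
  rw [h2, HalfSpace.represent, HalfSpace.Tstar_eq u₀ ht hX, HalfSpace.Da_eq F t hX,
    HalfSpace.ThetaStar_eq]
  ring
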